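/- Let $M$ be a compact connected $n$-dimensional smooth Riemannian manifold without boundary, with Riemannian volume measure $\mu$ and divergence $\mathrm{div}$, and let $u_0$ be a smooth vector field on $M$ whose divergence is not identically zero. For $T>0$, a smooth solution on $[0,T)$ is a time-dependent vector field $u(t,x)$, smooth on $[0,T)\times M$, such that $h=\mathrm{div}\,u$ satisfies $$h_t+\langle u,\nabla h\rangle+\tfrac12 h^2=-\frac{1}{2\mu(M)}\int_M h^2\,d\mu \quad\text{on } [0,T)\times M,\qquad h(0,x)=\mathrm{div}\,u_0(x).$$ Let $\kappa>0$ be given by $\kappa^2=\frac{1}{4\mu(M)}\int_M(\mathrm{div}\,u_0)^2\,d\mu$ and put $$T_{\max}=\frac{\pi}{2\kappa}+\frac1\kappa\arctan\Big(\frac1{2\kappa}\inf_{x\in M}\mathrm{div}\,u_0(x)\Big).$$ Then $0<T_{\max}<\infty$, and $T_{\max}$ is the lifespan of the smooth solutions of this Cauchy problem, in the following sense (the equation determines $u$ only up to divergence-free fields): 1. there is a smooth solution on $[0,T_{\max})$ with $u(0)=u_0$; 2. if there is a smooth solution on $[0,T)$, then $T\le T_{\max}$; 3. if $u$ is a smooth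 solution on $[0,T)$ and $0\le S<T$, then some smooth solution on $[0,T_{\max})$ coincides with $u$ on $[0,S]$. Furthermore, for every smooth solution $u$ on $[0,T_{\max})$, $$\|u(t)\|_{C^1}=\sup_{x\in M}|u(t,x)|+\sup_{x\in M}|\nabla u(t,x)|\longrightarrow+\infty\quad\text{as } t\nearrow T_{\max},$$ where $\nabla$ is the Levi-Civita connection and $|\nabla u|$ is the norm induced by the metric on $T^*M\otimes TM$. -/

import Mathlib

open Set Filter Topology MeasureTheory Real
open scoped Manifold ContDiff ENNReal Bundle

noncomputable section

namespace FisherRao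

section Geometry

variable {n : ℕ} {M : Type*} [TopologicalSpace M] [ChartedSpace (EuclideanSpace ℝ (Fin n)) M]
  [IsManifold (𝓡 n) ∞ M]

/-- A smooth Riemannian metric on the manifold `M` (without boundary) of dimension `n`. -/
abbrev Metric (n : ℕ) (M : Type*) [TopologicalSpace M]
    [ChartedSpace (EuclideanSpace ℝ (Fin n)) M] [IsManifold (𝓡 n) ∞ M] :=
  Bundle.ContMDiffRiemannianMetric (𝓡 n) ∞ (EuclideanSpace ℝ (Fin n))
    (fun x : M => TangentSpace (𝓡 n) x)

/-- A (not necessarily smooth) vector field on `M`. -/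
abbrev VField (n : ℕ) (M : Type*) [TopologicalSpace M]
    [ChartedSpace (EuclideanSpace ℝ (Fin n)) M] :=
  (x : M) → TangentSpace (𝓡 n) x

/-- The coordinate vector `∂_i`, at the point with coordinates `y`, of the chart centred at `p`. -/
def coordVec (p : M) (y : EuclideanSpace ℝ (Fin n)) (i : Fin n) :
    TangentSpace (𝓡 n) ((extChartAt (𝓡 n) p).symm y) :=
  mfderiv 𝓘(ℝ, EuclideanSpace ℝ (Fin n)) (𝓡 n) (extChartAt (𝓡 n) p).symm y
    (EuclideanSpace.single i (1 : ℝ))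

/-- The matrix `g_{ij} = g(∂_i, ∂_j)` of the metric, as a function of the coordinates `y` of the
chart at `p`. -/
def gram (g : Metric n M) (p : M) (y : EuclideanSpace ℝ (Fin n)) : Matrix (Fin n) (Fin n) ℝ :=
  Matrix.of fun i j =>
    g.inner ((extChartAt (𝓡 n) p).symm y) (coordVec p y i) (coordVec p y j)

/-- The Riemannian density `√det (g_{ij})` in the coordinates of the chart at `p`. -/
def volDensity (g : Metric n M) (p : M) (y : EuclideanSpace ℝ (Fin n)) : ℝ :=
  √(gram g p y).det

/-- The `i`-th component `u^i` of a vector field in the coordinates of the chart at `p`. -/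
def comp (u : VField n M) (p : M) (i : Fin n) (y : EuclideanSpace ℝ (Fin n)) : ℝ :=
  (show EuclideanSpace ℝ (Fin n) from
    mfderiv (𝓡 n) 𝓘(ℝ, EuclideanSpace ℝ (Fin n)) (extChartAt (𝓡 n) p)
      ((extChartAt (𝓡 n) p).symm y) (u ((extChartAt (𝓡 n) p).symm y))) i

/-- The partial derivative `∂f/∂y_i`. -/
def pd (i : Fin n) (f : EuclideanSpace ℝ (Fin n) → ℝ) (y : EuclideanSpace ℝ (Fin n)) : ℝ :=
  fderiv ℝ f y (EuclideanSpace.single i (1 : ℝ))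

/-- The divergence of a vector field with respect to the Riemannian volume,
`div u = (1 / √det g) ∑ i, ∂_i (√det g u^i)`, computed at `p` in the chart at `p`. -/
def divergence (g : Metric n M) (u : VField n M) (p : M) : ℝ :=
  (volDensity g p (extChartAt (𝓡 n) p p))⁻¹ *
    ∑ i, pd i (fun y => volDensity g p y * comp u p i y) (extChartAt (𝓡 n) p p)

/-- The Riemannian volume measure of the domain of the chart at `p`, namely `√det g dy` transported
to `M` (and zero outside that domain). -/
def chartVolume [MeasurableSpace M] (g : Metric n M) (p : M) : Measure M :=
  Measure.map (extChartAt (𝓡 n) p).symm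
    ((volume.restrict (extChartAt (𝓡 n) p).target).withDensity
      (fun y => ENNReal.ofReal (volDensity g p y)))

/-- The Riemannian volume measure `μ` of `M`. The measures `chartVolume g p` agree on overlaps of
chart domains, so that their supremum is the measure restricting to each of them. -/
def vol [MeasurableSpace M] (g : Metric n M) : Measure M := ⨆ p, chartVolume g p

/-- The Christoffel symbol `Γ^k_{ij}` of the Levi-Civita connection in the chart at `p`. -/
def christoffel (g : Metric n M) (p : M) (k i j : Fin n) (y : EuclideanSpace ℝ (Fin n)) : ℝ :=
  (1 / 2) * ∑ l, (gram g p y)⁻¹ k l *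
    (pd i (fun z => gram g p z j l) y + pd j (fun z => gram g p z i l) y
      - pd l (fun z => gram g p z i j) y)

/-- The matrix `(∇_i u)^k = ∂_i u^k + ∑ j, Γ^k_{ij} u^j` (row `k`, column `i`) of the covariant
derivative of `u` at `p`, in the chart at `p`. -/
def covDeriv (g : Metric n M) (u : VField n M) (p : M) : Matrix (Fin n) (Fin n) ℝ :=
  Matrix.of fun k i =>
    pd i (comp u p k) (extChartAt (𝓡 n) p p)
      + ∑ j, christoffel g p k i j (extChartAt (𝓡 n) p p) * comp u p j (extChartAt (𝓡 n) p p)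

/-- The norm `|u(p)|` with respect to the metric. -/
def normAt (g : Metric n M) (u : VField n M) (p : M) : ℝ := √(g.inner p (u p) (u p))

/-- The norm `|∇u(p)|` in `T*M ⊗ TM`, that is
`|∇u|² = ∑ g^{ij} g_{kl} (∇_i u)^k (∇_j u)^l`. -/
def normCovDerivAt (g : Metric n M) (u : VField n M) (p : M) : ℝ :=
  √(∑ i, ∑ j, ∑ k, ∑ l, (gram g p (extChartAt (𝓡 n) p p))⁻¹ i j *
      gram g p (extChartAt (𝓡 n) p p) k l * covDeriv g u p k i * covDeriv g u p l j)

/-- The norm `‖u‖_{C¹} = sup_x |u(x)| + sup_x |∇u(x)|`, with suprema in `[0, ∞]`. -/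
def c1Norm (g : Metric n M) (u : VField n M) : ℝ≥0∞ :=
  (⨆ p, ENNReal.ofReal (normAt g u p)) + ⨆ p, ENNReal.ofReal (normCovDerivAt g u p)

/-- The derivative `⟨v, ∇f⟩ = df(v)` of a function `f` at `x` in the direction `v`. -/
def dirDeriv (f : M → ℝ) (x : M) (v : TangentSpace (𝓡 n) x) : ℝ :=
  mfderiv (𝓡 n) 𝓘(ℝ, ℝ) f x v

/-- The vector field `u` is smooth. -/
def SmoothField (u : VField n M) : Prop :=
  ContMDiff (𝓡 n) (𝓡 n).tangent ∞ (fun x => (⟨x, u x⟩ : TangentBundle (𝓡 n) M))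

/-- The time-dependent vector field `u` is smooth on `[0, T) × M`, up to and including `t = 0`. -/
def SmoothFieldOn (T : ℝ) (u : ℝ → VField n M) : Prop :=
  ContMDiffOn (𝓘(ℝ, ℝ).prod (𝓡 n)) (𝓡 n).tangent ∞
    (fun q : ℝ × M => (⟨q.2, u q.1 q.2⟩ : TangentBundle (𝓡 n) M)) (Ico 0 T ×ˢ univ)

/-- `u` is a smooth solution on `[0, T) × M` of the Cauchy problem
`h_t + ⟨u, ∇h⟩ + h² / 2 = - (1 / (2 μ(M))) ∫ h² dμ`, where `h = div u`,
with initial condition `h(0, ·) = div u₀`. (At `t = 0` the time derivative is one-sided.) -/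
structure IsSmoothSolution [MeasurableSpace M] (g : Metric n M) (u₀ : VField n M) (T : ℝ)
    (u : ℝ → VField n M) : Prop where
  pos : 0 < T
  smooth : SmoothFieldOn T u
  equation : ∀ t ∈ Ico 0 T, ∀ x : M, ∃ ht : ℝ,
    HasDerivWithinAt (fun s => divergence g (u s) x) ht (Ici 0) t ∧
    ht + dirDeriv (divergence g (u t)) x (u t x) + (1 / 2) * divergence g (u t) x ^ 2
      = - (1 / (2 * (vol g).real univ)) * ∫ z, divergence g (u t) z ^ 2 ∂(vol g)
  initial : ∀ x : M, divergence g (u 0) x = divergence g u₀ x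

/-- The constant `κ ≥ 0` with `κ² = (1 / (4 μ(M))) ∫ (div u₀)² dμ`. -/
def kappa [MeasurableSpace M] (g : Metric n M) (u₀ : VField n M) : ℝ :=
  √((1 / (4 * (vol g).real univ)) * ∫ z, divergence g u₀ z ^ 2 ∂(vol g))

end Geometry

end FisherRao

end

set_option linter.unusedSectionVars false

/-! Write h = div u and V = μ(M). Multiplying the equation by h and integrating by parts shows that
∫ h² is conserved: the terms ∫ ⟨u, ∇h²⟩ and ∫ h³ cancel, and ∫ h = 0. So the nonlocal right-hand
side is the constant -2κ², and along the flow of u the equation is the Riccati equation h' = -2κ² -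
h²/2. In other words arctan(h/(2κ)) + κt is constant on trajectories
(`IsSmoothSolution.arctan_flow`). Its minimum over M is arctan(inf div u₀/(2κ)), while arctan stays
above -π/2. Hence κT cannot exceed π/2 + arctan(inf div u₀/(2κ)) = κ Tmax, and for a solution living
up to Tmax the minimum of h tends to -∞. Since div u is the trace of ∇u, |div u| ≤ √n |∇u|, and the
C¹ norm blows up.

For existence the Riccati equation is linearised by h = 2φ'/φ with φ'' = -κ²φ. From a base time b
this gives φ = cos κ(t-b) + τ sin κ(t-b), with τ = div u(b)/(2κ); φ is positive as long as the phase
arctan τ - κ(t-b) stays inside (-π/2, π/2). The choice of κ means exactly that τ² has mean one, so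
φ² keeps total mass V (geometrically, φ moves on a great circle of an L² sphere). Following Moser,
one solves ∂ₜφ² + div(φ² X) = 0 for a field X. This needs only one auxiliary field W with div W = τ²
- 1. The flow ξ of X carries μ to φ²μ, and the velocity v of the inverse flow has div v = (2φ'/φ) ∘
ξ, which solves the Riccati equation. Integrating that equation over M gives back ∫ (div v)² = 4κ²V,
so v solves the nonlocal problem (`exists_solution_of_transport`). With b = 0 and X(0) = -u₀ this
yields a solution up to Tmax with the prescribed initial field.

For continuation, the inverse flow of a given solution u is generated by some X₁ satisfying the same
transport equation, with φ defined from u(b). That equation is affine in X, so X₁ may be blended by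
a time cut-off with a field X₂ defined up to Tmax. The resulting solution equals u before the
cut-off begins, by uniqueness of integral curves (`IsSmoothSolution.exists_extension`).

Three general facts carry the argument. Smooth dependence of flows on initial data comes from the
implicit function theorem in C([0,1], E), applied to the Picard integral equation; compactness then
globalises the flow. A smooth function with zero mean on a compact connected manifold is a
divergence (`exists_divergence_eq`): locally, functions modulo divergences are spanned by one bump,
and connectedness identifies these bumps up to scalars. Finally, the divergence is handled weakly,
by integration by parts against test functions, which gives chart independence, the product rule and
the effect of transport without coordinate changes. -/

noncomputable section

namespace FisherRao

/-! ### Smoothness of superposition operators on spaces of continuous functions. -/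

section Superposition

universe u

variable {K : Type*} [TopologicalSpace K] [CompactSpace K]
  {E F : Type u} [NormedAddCommGroup E] [NormedSpace ℝ E]
  [NormedAddCommGroup F] [NormedSpace ℝ F]

set_option synthInstance.maxHeartbeats 200000

/-- A bounded bilinear map, applied pointwise to continuous functions. -/
def pointwiseBilin {G : Type u} [NormedAddCommGroup G] [NormedSpace ℝ G] (K : Type*)
    [TopologicalSpace K] [CompactSpace K] (B : G →L[ℝ] E →L[ℝ] F) :
    C(K, G) →L[ℝ] C(K, E) →L[ℝ] C(K, F) :=
  LinearMap.mkContinuous₂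
    (LinearMap.mk₂ ℝ (fun (A : C(K, G)) (h : C(K, E)) =>
        (⟨fun s => B (A s) (h s), by fun_prop⟩ : C(K, F)))
      (fun _ _ _ => by ext; simp) (fun _ _ _ => by ext; simp)
      (fun _ _ _ => by ext; simp) (fun _ _ _ => by ext; simp)) ‖B‖
    (fun A h => by
      rw [ContinuousMap.norm_le _ (by positivity)]
      intro s
      refine (B.le_opNorm₂ _ _).trans ?_
      gcongr
      exacts [A.norm_coe_le_norm s, h.norm_coe_le_norm s])

theorem exists_dist_comp_lt {E G : Type*} [NormedAddCommGroup E] [NormedAddCommGroup G]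
    (f : C(E, G)) (γ : C(K, E))
    {ε : ℝ} (hε : 0 < ε) : ∃ δ > 0, ∀ γ' : C(K, E), dist γ' γ < δ → dist (f.comp γ') (f.comp γ) < ε :=
  Metric.continuous_iff.1 (ContinuousMap.continuous_postcomp (X := K) f) γ ε hε

/-- The mean value inequality holds pointwise in s. Uniformity in s comes from the continuity of
postcomposition with f' for the sup norm, so E may be infinite-dimensional. -/
theorem hasFDerivAt_superposition (f : E → F) (f' : E → E →L[ℝ] F) (hf : Continuous f)
    (hf' : Continuous f') (hd : ∀ x, HasFDerivAt f (f' x) x) (γ : C(K, E)) :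
    HasFDerivAt (fun γ : C(K, E) => (⟨f, hf⟩ : C(E, F)).comp γ)
      (pointwiseBilin K (ContinuousLinearMap.id ℝ (E →L[ℝ] F)) ((⟨f', hf'⟩ : C(E, E →L[ℝ] F)).comp γ)) γ := by
  rw [hasFDerivAt_iff_isLittleO, Asymptotics.isLittleO_iff]
  intro ε hε
  obtain ⟨δ, hδ, hδ'⟩ := exists_dist_comp_lt (⟨f', hf'⟩ : C(E, E →L[ℝ] F)) γ hε
  filter_upwards [Metric.ball_mem_nhds γ hδ] with h hh
  rw [ContinuousMap.norm_le _ (by positivity)]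
  intro s
  -- A point z near γ s is the value at s of the translate γ + (z - γ s), which is uniformly close
  -- to γ; hence the sup-norm estimate yields a pointwise one.
  have key : ∀ z ∈ Metric.ball (γ s) δ, ‖f' z - f' (γ s)‖ ≤ ε := by
    intro z hz
    have h1 := hδ' (γ + ContinuousMap.const K (z - γ s)) (by
      rw [dist_eq_norm]
      have : ‖ContinuousMap.const K (z - γ s)‖ ≤ ‖z - γ s‖ :=
        (ContinuousMap.norm_le _ (norm_nonneg _)).2 fun _ => le_rfl
      simpa using this.trans_lt (by simpa [dist_eq_norm] using hz))
    have h2 := (ContinuousMap.dist_apply_le_dist s).trans h1.le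
    simpa [dist_eq_norm] using h2
  have hs : h s ∈ Metric.ball (γ s) δ := (ContinuousMap.dist_apply_le_dist s).trans_lt hh
  have := (convex_ball (γ s) δ).norm_image_sub_le_of_norm_hasFDerivWithin_le'
    (fun z _ => (hd z).hasFDerivWithinAt) key (Metric.mem_ball_self hδ) hs
  refine (show _ ≤ ε * ‖h s - γ s‖ from this).trans ?_
  gcongr
  exact (h - γ).norm_coe_le_norm s

/-- The derivative of superposition by f is superposition by f', followed by a bounded bilinear
action. Since f' has values in another space, the target F is quantified inside the induction on m.
-/
theorem contDiff_superposition_nat (m : ℕ) : ∀ (F : Type u) [NormedAddCommGroup F]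
    [NormedSpace ℝ F] (f : E → F) (hf : ContDiff ℝ ∞ f),
    ContDiff ℝ m (fun γ : C(K, E) => (⟨f, hf.continuous⟩ : C(E, F)).comp γ) := by
  induction m with
  | zero =>
    intro F _ _ f hf
    exact contDiff_zero.2 (ContinuousMap.continuous_postcomp _)
  | succ m ih =>
    intro F _ _ f hf
    have hf' : ContDiff ℝ ∞ (fderiv ℝ f) := hf.fderiv_right (by simp)
    have hd := hasFDerivAt_superposition (K := K) f (fderiv ℝ f) hf.continuous hf'.continuous
      (fun x => (hf.differentiable (by simp) x).hasFDerivAt)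
    exact contDiff_succ_iff_hasFDerivAt.2
      ⟨_, (pointwiseBilin K (ContinuousLinearMap.id ℝ (E →L[ℝ] F))).contDiff.comp (ih _ _ hf'), hd⟩

/-- The superposition operator `γ ↦ f ∘ γ` on `C(K, E)` is smooth if `f` is. -/
theorem contDiff_superposition (f : E → F) (hf : ContDiff ℝ ∞ f) :
    ContDiff ℝ ∞ (fun γ : C(K, E) => (⟨f, hf.continuous⟩ : C(E, F)).comp γ) :=
  contDiff_infty.2 fun m => contDiff_superposition_nat m F f hf

end Superposition

/-! ### Smooth local flows in Banach spaces. -/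

section LocalFlow

universe u

variable {E : Type u} [NormedAddCommGroup E] [NormedSpace ℝ E]

set_option synthInstance.maxHeartbeats 200000

theorem continuous_extend_unitInterval {E : Type*} [TopologicalSpace E] (γ : C(unitInterval, E)) :
    Continuous fun r : ℝ => γ (projIcc 0 1 zero_le_one r) :=
  γ.continuous.comp continuous_projIcc

/-- The primitive `s ↦ ∫₀ˢ γ`, as an operator on `C([0, 1], E)`. -/
def primitiveCLM (E : Type u) [NormedAddCommGroup E] [NormedSpace ℝ E] :
    C(unitInterval, E) →L[ℝ] C(unitInterval, E) :=
  LinearMap.mkContinuous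
    { toFun := fun γ => ⟨fun s => ∫ r in (0 : ℝ)..s, γ (projIcc 0 1 zero_le_one r),
        (intervalIntegral.continuous_primitive
          (fun _ _ => (continuous_extend_unitInterval γ).intervalIntegrable _ _) 0).comp
          continuous_subtype_val⟩
      map_add' := fun γ γ' => by
        ext s
        simp only [ContinuousMap.add_apply, ContinuousMap.coe_mk]
        exact intervalIntegral.integral_add
          ((continuous_extend_unitInterval γ).intervalIntegrable _ _)
          ((continuous_extend_unitInterval γ').intervalIntegrable _ _)
      map_smul' := fun c γ => by
        ext s
        simp only [ContinuousMap.smul_apply, ContinuousMap.coe_mk, RingHom.id_apply]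
        exact intervalIntegral.integral_smul _ _ } 1
    (fun γ => by
      rw [one_mul, ContinuousMap.norm_le _ (norm_nonneg _)]
      intro s
      have := intervalIntegral.norm_integral_le_of_norm_le_const (a := (0 : ℝ)) (b := s)
        (f := fun r => γ (projIcc 0 1 zero_le_one r)) (C := ‖γ‖)
        (fun r _ => γ.norm_coe_le_norm _)
      refine this.trans ?_
      rw [sub_zero, abs_of_nonneg s.2.1]
      exact mul_le_of_le_one_right (norm_nonneg _) s.2.2)

theorem primitiveCLM_apply (γ : C(unitInterval, E)) (s : unitInterval) :
    primitiveCLM E γ s = ∫ r in (0 : ℝ)..s, γ (projIcc 0 1 zero_le_one r) := rfl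

theorem norm_primitiveCLM_le : ‖primitiveCLM E‖ ≤ 1 :=
  LinearMap.mkContinuous_norm_le _ zero_le_one _

theorem norm_pointwiseBilin_apply_le {K : Type*} [TopologicalSpace K] [CompactSpace K]
    {F G : Type u} [NormedAddCommGroup F] [NormedSpace ℝ F] [NormedAddCommGroup G]
    [NormedSpace ℝ G] (B : G →L[ℝ] E →L[ℝ] F) (A : C(K, G)) {c : ℝ} (hc : 0 ≤ c)
    (h : ∀ s, ‖B (A s)‖ ≤ c) : ‖pointwiseBilin K B A‖ ≤ c := by
  refine ContinuousLinearMap.opNorm_le_bound _ hc fun γ => ?_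
  rw [ContinuousMap.norm_le _ (by positivity)]
  intro s
  exact ((B (A s)).le_opNorm _).trans (mul_le_mul (h s) (γ.norm_coe_le_norm s)
        (norm_nonneg _) hc)

/-- Neumann series. -/
theorem isInvertible_id_sub_smul {F : Type*} [NormedAddCommGroup F] [NormedSpace ℝ F]
    [CompleteSpace F] (t : ℝ) (P N : F →L[ℝ] F) {c : ℝ} (hP : ‖P‖ ≤ 1) (hN : ‖N‖ ≤ c)
    (ht : |t| * c < 1) : (ContinuousLinearMap.id ℝ F - t • (P ∘L N)).IsInvertible := by
  have hA : ‖t • (P ∘L N)‖ < 1 := by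
    calc ‖t • (P ∘L N)‖ ≤ |t| * (‖P‖ * ‖N‖) := by
          rw [norm_smul, Real.norm_eq_abs]
          gcongr
          exact ContinuousLinearMap.opNorm_comp_le _ _
      _ ≤ |t| * (1 * c) := by gcongr
      _ < 1 := by rwa [one_mul]
  refine ⟨ContinuousLinearEquiv.ofUnit (Units.oneSub _ hA), ?_⟩
  ext x
  rfl

/-- The map whose zeros `γ` are the solutions of `γ s = x + t ∫₀ˢ f (γ r) dr`. -/
def picardDefect (f : E → E) (hf : Continuous f) (z : (E × ℝ) × C(unitInterval, E)) :
    C(unitInterval, E) :=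
  z.2 - ContinuousMap.const _ z.1.1 - z.1.2 • primitiveCLM E ((⟨f, hf⟩ : C(E, E)).comp z.2)

theorem contDiff_picardDefect (f : E → E) (hf : ContDiff ℝ ∞ f) :
    ContDiff ℝ ∞ (picardDefect f hf.continuous) := by
  have h1 : ContDiff ℝ ∞ fun x : E => ContinuousMap.const unitInterval x := by
    let L : E →ₗᵢ[ℝ] C(unitInterval, E) :=
      { toFun := fun x => ContinuousMap.const _ x
        map_add' := fun _ _ => rfl
        map_smul' := fun _ _ => rfl
        norm_map' := fun x => by
          refine le_antisymm ((ContinuousMap.norm_le _ (norm_nonneg _)).2 fun _ => le_rfl) ?_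
          exact (ContinuousMap.const unitInterval x).norm_coe_le_norm 0 }
    exact L.toContinuousLinearMap.contDiff
  have h2 := contDiff_superposition (K := unitInterval) f hf
  unfold picardDefect
  refine (contDiff_snd.sub (h1.comp contDiff_fst.fst)).sub (contDiff_fst.snd.smul ?_)
  exact (primitiveCLM E).contDiff.comp (h2.comp contDiff_snd)

variable [CompleteSpace E]

/-- The partial derivative in γ is the identity minus t times (primitive ∘ multiplication by f'(γ)),
and this perturbation has norm at most |t| c < 1. It is the hypothesis of the implicit function
theorem. -/
theorem isInvertible_fderiv_picardDefect (f : E → E) (hf : ContDiff ℝ ∞ f)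
    (z : (E × ℝ) × C(unitInterval, E)) {c : ℝ} (hc : 0 ≤ c) (hfc : ∀ s, ‖fderiv ℝ f (z.2 s)‖ ≤ c)
    (ht : |z.1.2| * c < 1) :
    (fderiv ℝ (picardDefect f hf.continuous) z ∘L .inr ℝ (E × ℝ) C(unitInterval, E)).IsInvertible := by
  have hf' : Continuous (fderiv ℝ f) := hf.continuous_fderiv (by simp)
  have hd := hasFDerivAt_superposition (K := unitInterval) f (fderiv ℝ f) hf.continuous hf'
    (fun x => (hf.differentiable (by simp) x).hasFDerivAt) z.2
  set N := pointwiseBilin unitInterval (ContinuousLinearMap.id ℝ (E →L[ℝ] E))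
    ((⟨fderiv ℝ f, hf'⟩ : C(E, E →L[ℝ] E)).comp z.2)
  have h1 : HasFDerivAt (fun γ => picardDefect f hf.continuous (z.1, γ))
      (fderiv ℝ (picardDefect f hf.continuous) z ∘L .inr ℝ (E × ℝ) C(unitInterval, E)) z.2 := by
    have := ((contDiff_picardDefect f hf).differentiable (by simp) z).hasFDerivAt
    exact HasFDerivAt.comp z.2 (f := fun γ => (z.1, γ)) this (hasFDerivAt_prodMk_right _ _)
  have h2 : HasFDerivAt (fun γ => picardDefect f hf.continuous (z.1, γ))
      (ContinuousLinearMap.id ℝ _ - z.1.2 • (primitiveCLM E ∘L N)) z.2 := by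
    exact ((hasFDerivAt_id z.2).sub_const (ContinuousMap.const _ z.1.1)).sub
      (((primitiveCLM E).hasFDerivAt.comp z.2 hd).const_smul z.1.2)
  rw [h1.unique h2]
  exact isInvertible_id_sub_smul _ _ _ norm_primitiveCLM_le
    (norm_pointwiseBilin_apply_le _ _ hc hfc) ht

/-- Time is rescaled to the fixed interval [0, 1], so that t becomes a scalar parameter of an
equation in one function space. -/
theorem picardDefect_eq_zero_of_hasDerivAt (f : E → E) (hf : Continuous f) {α : ℝ → E} {δ : ℝ}
    (hα : ∀ t ∈ Ioo (-δ) δ, HasDerivAt α (f (α t)) t) {t : ℝ} (ht : t ∈ Ioo (-δ) δ)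
    (γ : C(unitInterval, E)) (hγ : ∀ s, γ s = α (t * s)) :
    picardDefect f hf ((α 0, t), γ) = 0 := by
  have hmem : ∀ r ∈ Icc (0 : ℝ) 1, t * r ∈ Ioo (-δ) δ := by
    intro r hr
    have h1 : |t * r| < δ := by
      rw [abs_mul]
      exact (mul_le_of_le_one_right (abs_nonneg _) (abs_le.2 ⟨by linarith [hr.1], hr.2⟩)).trans_lt
        (abs_lt.2 ht)
    exact abs_lt.1 h1
  ext s
  have hsub : Icc 0 (s : ℝ) ⊆ Icc (0 : ℝ) 1 := Icc_subset_Icc le_rfl s.2.2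
  have hderiv : ∀ r ∈ uIcc 0 (s : ℝ), HasDerivAt (fun r => α (t * r)) (t • f (α (t * r))) r := by
    intro r hr
    rw [uIcc_of_le s.2.1] at hr
    have h1 := (hα _ (hmem r (hsub hr))).scomp r ((hasDerivAt_id r).const_mul t)
    rw [mul_one] at h1
    exact h1
  have hcont : ContinuousOn (fun r => t • f (α (t * r))) (uIcc 0 (s : ℝ)) := by
    have : ContinuousOn (fun r => α (t * r)) (uIcc 0 (s : ℝ)) :=
      fun r hr => (hderiv r hr).continuousAt.continuousWithinAt
    exact (hf.comp_continuousOn this).const_smul t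
  have hint := intervalIntegral.integral_eq_sub_of_hasDerivAt hderiv hcont.intervalIntegrable
  have heq : ∫ r in (0 : ℝ)..s, f (γ (projIcc 0 1 zero_le_one r))
      = ∫ r in (0 : ℝ)..s, f (α (t * r)) := by
    refine intervalIntegral.integral_congr fun r hr => ?_
    rw [uIcc_of_le s.2.1] at hr
    simp only [hγ, projIcc_of_mem zero_le_one (hsub hr)]
  simp only [picardDefect, ContinuousMap.sub_apply, ContinuousMap.smul_apply,
    ContinuousMap.const_apply, primitiveCLM_apply, ContinuousMap.comp_apply, ContinuousMap.coe_mk,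
    ContinuousMap.zero_apply]
  rw [heq, hγ, ← intervalIntegral.integral_smul, hint]
  simp

/-- A smooth vector field on a Banach space has a smooth local flow. -/
theorem exists_contDiffOn_localFlow (f : E → E) (hf : ContDiff ℝ ∞ f) (x₀ : E) :
    ∃ δ > 0, ∃ α : E × ℝ → E, (∀ x ∈ Metric.ball x₀ δ, α (x, 0) = x) ∧
      (∀ x ∈ Metric.ball x₀ δ, ∀ t ∈ Ioo (-δ) δ,
        HasDerivAt (fun s => α (x, s)) (f (α (x, t))) t) ∧
      ContDiffOn ℝ ∞ α (Metric.ball x₀ δ ×ˢ Ioo (-δ) δ) := by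
  obtain ⟨ε, hε, a, r, L, K, hr, hpl⟩ := IsPicardLindelof.of_contDiffAt_one (x₀ := x₀)
    (hf.contDiffAt.of_le (by simp) : ContDiffAt ℝ 1 f x₀)
  obtain ⟨α, hα, hαc⟩ := (hpl 0).exists_forall_mem_closedBall_eq_hasDerivWithinAt_continuousOn
  simp only [zero_sub, zero_add] at hα hαc
  have hf' : Continuous (fderiv ℝ f) := hf.continuous_fderiv (by simp)
  set c : ℝ := ‖fderiv ℝ f x₀‖ + 1 with hc
  have hnhds : Metric.closedBall x₀ r ×ˢ Icc (-ε) ε ∈ 𝓝 ((x₀, 0) : E × ℝ) :=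
    prod_mem_nhds (Metric.closedBall_mem_nhds _ hr) (Icc_mem_nhds (by linarith) hε)
  have hα0 : α (x₀, 0) = x₀ := (hα x₀ (Metric.mem_closedBall_self r.2)).1
  have hev : ∀ᶠ z in 𝓝 ((x₀, 0) : E × ℝ), ‖fderiv ℝ f (α z)‖ < c := by
    have h1 : ContinuousAt (fun z => ‖fderiv ℝ f (α z)‖) (x₀, 0) :=
      (hf'.norm.continuousAt (x := α (x₀, 0))).comp (hαc.continuousAt hnhds)
    refine h1.eventually_lt continuousAt_const ?_
    simp [hα0, hc]
  obtain ⟨d, hd, hdsub⟩ := Metric.eventually_nhds_iff_ball.1 (hev.and hnhds)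
  have hcpos : 0 < c := by positivity
  -- The bound c⁻¹ makes |t| c < 1, as the Neumann series requires; the bound d keeps f' below c
  -- along the flow.
  set δ : ℝ := min d c⁻¹ with hδ
  have hδ0 : 0 < δ := lt_min hd (by positivity)
  have hmem : ∀ x ∈ Metric.ball x₀ δ, ∀ t ∈ Ioo (-δ) δ, (x, t) ∈ Metric.ball ((x₀, 0) : E × ℝ) d := by
    intro x hx t ht
    rw [Metric.mem_ball, Prod.dist_eq, max_lt_iff]
    refine ⟨(Metric.mem_ball.1 hx).trans_le (min_le_left _ _), ?_⟩
    rw [dist_zero_right, Real.norm_eq_abs]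
    exact (abs_lt.2 ht).trans_le (min_le_left _ _)
  have hx0 : ∀ x ∈ Metric.ball x₀ δ, α (x, 0) = x := fun x hx =>
    (hα x (hdsub _ (hmem x hx 0 ⟨by linarith, hδ0⟩)).2.1).1
  have hder : ∀ x ∈ Metric.ball x₀ δ, ∀ t ∈ Ioo (-δ) δ,
      HasDerivAt (fun s => α (x, s)) (f (α (x, t))) t := by
    intro x hx t ht
    have h1 := (hdsub _ (hmem x hx t ht)).2
    refine ((hα x h1.1).2 t h1.2).hasDerivAt ?_
    have : Metric.ball t (d - |t|) ⊆ Icc (-ε) ε := by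
      intro s hs
      refine (hdsub (x, s) ?_).2.2
      rw [Metric.mem_ball, Prod.dist_eq, max_lt_iff]
      refine ⟨(Metric.mem_ball.1 hx).trans_le (min_le_left _ _), ?_⟩
      rw [dist_zero_right, Real.norm_eq_abs]
      have h2 : |s - t| < d - |t| := by simpa [Real.dist_eq] using hs
      linarith [abs_sub_abs_le_abs_sub s t]
    refine Filter.mem_of_superset (Metric.ball_mem_nhds t ?_) this
    linarith [abs_lt.2 ht, min_le_left d c⁻¹]
  refine ⟨δ, hδ0, α, hx0, hder, ?_⟩
  -- the curves `s ↦ α (x, t s)` depend continuously on `(x, t)`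
  set X := Metric.ball x₀ δ ×ˢ Ioo (-δ) δ with hX
  have hts : ∀ z ∈ X, ∀ s : unitInterval, z.2 * s ∈ Ioo (-δ) δ := by
    intro z hz s
    have h1 : |z.2 * s| < δ := by
      rw [abs_mul]
      exact (mul_le_of_le_one_right (abs_nonneg _)
        (abs_le.2 ⟨by linarith [s.2.1], s.2.2⟩)).trans_lt (abs_lt.2 hz.2)
    exact abs_lt.1 h1
  let Γ : C(X, C(unitInterval, E)) := ContinuousMap.curry
    ⟨fun q => α (q.1.1.1, q.1.1.2 * q.2), by
      refine hαc.comp_continuous (f := fun q : X × unitInterval => (q.1.1.1, q.1.1.2 * q.2))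
        (by fun_prop) ?_
      intro q
      exact (hdsub _ (hmem _ q.1.2.1 _ (hts _ q.1.2 q.2))).2⟩
  have hΓ : ∀ (z : X) (s : unitInterval), Γ z s = α (z.1.1, z.1.2 * s) := fun _ _ => rfl
  have hXo : IsOpen X := Metric.isOpen_ball.prod isOpen_Ioo
  have hzero : ∀ z : X, picardDefect f hf.continuous (z.1, Γ z) = 0 := by
    intro z
    have := picardDefect_eq_zero_of_hasDerivAt f hf.continuous (hder z.1.1 z.2.1) z.2.2 (Γ z)
      (hΓ z)
    rwa [hx0 _ z.2.1] at this
  intro z hz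
  refine ContDiffAt.contDiffWithinAt ?_
  have hinv := isInvertible_fderiv_picardDefect f hf (z, Γ ⟨z, hz⟩) hcpos.le
    (fun s => (hdsub _ (hmem _ hz.1 _ (hts _ hz s))).1.le) (by
      have h1 : |z.2| < c⁻¹ := (abs_lt.2 hz.2).trans_le (min_le_right _ _)
      calc |z.2| * c < c⁻¹ * c := by gcongr
        _ = 1 := inv_mul_cancel₀ hcpos.ne')
  have hcd : ContDiffAt ℝ ∞ (picardDefect f hf.continuous) (z, Γ ⟨z, hz⟩) :=
    (contDiff_picardDefect f hf).contDiffAt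
  have hn : (∞ : WithTop ℕ∞) ≠ 0 := by simp
  have h1 := hcd.contDiffAt_implicitFunction hn hinv
  have h2 := hcd.eventually_apply_eq_iff_implicitFunction hn hinv
  have hcontΓ : Tendsto (fun z' : X => ((z'.1, Γ z') : (E × ℝ) × C(unitInterval, E)))
      (𝓝 ⟨z, hz⟩) (𝓝 (z, Γ ⟨z, hz⟩)) :=
    (continuous_subtype_val.prodMk Γ.continuous).tendsto _
  have h3 := hcontΓ.eventually h2
  rw [nhds_subtype_eq_comap, eventually_comap] at h3
  -- Near (z, Γ z) the implicit function gives all the zeros, and Γ is a continuous family of zeros,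
  -- so the two coincide. The flow at time t is the value of the rescaled curve at s = 1.
  have h4 : α =ᶠ[𝓝 z] fun z' => (hcd.implicitFunction hn hinv z') 1 := by
    filter_upwards [h3, hXo.mem_nhds hz] with z' h5 h6
    have h7 := (h5 ⟨z', h6⟩ rfl).1 (by rw [hzero, hzero ⟨z, hz⟩])
    simp only at h7
    rw [h7, hΓ]
    simp
  refine ContDiffAt.congr_of_eventuallyEq ?_ h4
  exact (ContinuousMap.evalCLM ℝ (1 : unitInterval)).contDiff.contDiffAt.comp z h1

end LocalFlow

/-! ### Integrals depending smoothly on parameters. -/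

section ParametricIntegral

variable {X : Type} [NormedAddCommGroup X] [NormedSpace ℝ X]

/-- The map is a composition of smooth maps: x ↦ (s ↦ (x, s)) is affine into C([0,1], X × ℝ), then
come superposition by G, the primitive operator and evaluation at 1. No differentiation under the
integral is needed. -/
theorem contDiff_integral_zero_one (G : X × ℝ → ℝ) (hG : ContDiff ℝ ∞ G) :
    ContDiff ℝ ∞ fun x => ∫ r in (0 : ℝ)..1, G (x, r) := by
  let L : (X × ℝ) →ₗᵢ[ℝ] C(unitInterval, X × ℝ) :=
    { toFun := fun x => ContinuousMap.const _ x
      map_add' := fun _ _ => rfl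
      map_smul' := fun _ _ => rfl
      norm_map' := fun x => by
        refine le_antisymm ((ContinuousMap.norm_le _ (norm_nonneg _)).2 fun _ => le_rfl) ?_
        exact (ContinuousMap.const unitInterval x).norm_coe_le_norm 0 }
  let γ : C(unitInterval, X × ℝ) := ⟨fun s => (0, s), by fun_prop⟩
  have h1 := contDiff_superposition (K := unitInterval) G hG
  have h2 : ContDiff ℝ ∞ fun x : X => L (x, 0) + γ :=
    (L.toContinuousLinearMap.contDiff.comp (contDiff_id.prodMk contDiff_const)).add contDiff_const
  have h3 := (ContinuousMap.evalCLM ℝ (1 : unitInterval)).contDiff.comp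
    ((primitiveCLM ℝ).contDiff.comp (h1.comp h2))
  have hL : ∀ (x : X) (s : unitInterval), (L (x, 0) + γ) s = (x, (s : ℝ)) := fun x s => by
    change ((x, 0) : X × ℝ) + (0, (s : ℝ)) = _
    simp
  convert h3 using 1
  ext x
  simp only [Function.comp_apply, ContinuousMap.evalCLM_apply, primitiveCLM_apply,
    Icc.coe_one]
  refine intervalIntegral.integral_congr fun r hr => ?_
  rw [uIcc_of_le zero_le_one] at hr
  simp only [ContinuousMap.comp_apply, ContinuousMap.coe_mk, hL, projIcc_of_mem zero_le_one hr]

/-- An affine substitution moves the variable endpoint into the integrand. -/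
theorem contDiff_intervalIntegral (G : X × ℝ → ℝ) (hG : ContDiff ℝ ∞ G) (a : ℝ) (b : X → ℝ)
    (hb : ContDiff ℝ ∞ b) : ContDiff ℝ ∞ fun x => ∫ s in a..b x, G (x, s) := by
  have h1 : ContDiff ℝ ∞ fun z : X × ℝ => (b z.1 - a) * G (z.1, (b z.1 - a) * z.2 + a) := by
    have := hb.comp (contDiff_fst (𝕜 := ℝ) (E := X) (F := ℝ))
    refine (this.sub contDiff_const).mul (hG.comp (contDiff_fst.prodMk ?_))
    exact ((this.sub contDiff_const).mul contDiff_snd).add contDiff_const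
  convert contDiff_integral_zero_one _ h1 using 1
  ext x
  have := intervalIntegral.smul_integral_comp_mul_add (a := 0) (b := 1) (fun s => G (x, s))
    (b x - a) a
  simp only [mul_zero, zero_add, mul_one, sub_add_cancel, smul_eq_mul] at this
  rw [← this, ← intervalIntegral.integral_const_mul]

end ParametricIntegral

/-! ### Functions supported in a box, modulo divergences. -/

section Box

variable {n : ℕ} (c : EuclideanSpace ℝ (Fin n)) (r : ℝ)

/-- `f` vanishes outside the closed box with centre `c` and half-width `r`. -/
def BoxSupported (f : EuclideanSpace ℝ (Fin n) → ℝ) : Prop :=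
  ∀ y, (∃ i, r < |y i - c i|) → f y = 0

/-- The integral of `f` along the part inside the box of the `k`-th coordinate line through `x`. -/
def lineIntegral (k : Fin n) (f : EuclideanSpace ℝ (Fin n) → ℝ) (x : EuclideanSpace ℝ (Fin n)) : ℝ :=
  ∫ s in (c k - r)..(c k + r), f (x + (s - x k) • EuclideanSpace.single k (1 : ℝ))

/-- The primitive of `f` along the `k`-th coordinate lines, starting from a face of the box. -/
def linePrimitive (k : Fin n) (f : EuclideanSpace ℝ (Fin n) → ℝ) (x : EuclideanSpace ℝ (Fin n)) :
    ℝ :=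
  ∫ s in (c k - r)..(x k), f (x + (s - x k) • EuclideanSpace.single k (1 : ℝ))

variable {c r}

theorem contDiff_coord (k : Fin n) :
    ContDiff ℝ ∞ fun x : EuclideanSpace ℝ (Fin n) => x k :=
  (EuclideanSpace.proj (𝕜 := ℝ) k).contDiff

theorem contDiff_line {f : EuclideanSpace ℝ (Fin n) → ℝ} (hf : ContDiff ℝ ∞ f) (k : Fin n) :
    ContDiff ℝ ∞ fun z : EuclideanSpace ℝ (Fin n) × ℝ =>
      f (z.1 + (z.2 - z.1 k) • EuclideanSpace.single k (1 : ℝ)) :=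
  hf.comp (contDiff_fst.add
    ((contDiff_snd.sub ((contDiff_coord k).comp contDiff_fst)).smul contDiff_const))

theorem contDiff_lineIntegral {f : EuclideanSpace ℝ (Fin n) → ℝ} (hf : ContDiff ℝ ∞ f)
    (k : Fin n) : ContDiff ℝ ∞ (lineIntegral c r k f) :=
  contDiff_intervalIntegral _ (contDiff_line hf k) _ _ contDiff_const

theorem contDiff_linePrimitive {f : EuclideanSpace ℝ (Fin n) → ℝ} (hf : ContDiff ℝ ∞ f)
    (k : Fin n) : ContDiff ℝ ∞ (linePrimitive c r k f) :=
  contDiff_intervalIntegral _ (contDiff_line hf k) _ _ (contDiff_coord k)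

theorem line_add_smul (x : EuclideanSpace ℝ (Fin n)) (k : Fin n) (s t : ℝ) :
    x + t • EuclideanSpace.single k (1 : ℝ) + (s - (x + t • EuclideanSpace.single k (1 : ℝ)) k) •
      EuclideanSpace.single k (1 : ℝ) = x + (s - x k) • EuclideanSpace.single k (1 : ℝ) := by
  simp only [PiLp.add_apply, PiLp.smul_apply, PiLp.single_apply, if_true, smul_eq_mul,
    mul_one, add_assoc, ← add_smul]
  congr 2
  ring

theorem pd_linePrimitive {f : EuclideanSpace ℝ (Fin n) → ℝ} (hf : ContDiff ℝ ∞ f) (k : Fin n)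
    (x : EuclideanSpace ℝ (Fin n)) : pd k (linePrimitive c r k f) x = f x := by
  have h1 : HasFDerivAt (linePrimitive c r k f) (fderiv ℝ (linePrimitive c r k f) x) x :=
    ((contDiff_linePrimitive hf k).differentiable (by simp) x).hasFDerivAt
  have h2 : HasDerivAt (fun t : ℝ => linePrimitive c r k f
      (x + t • EuclideanSpace.single k (1 : ℝ))) (pd k (linePrimitive c r k f) x) 0 := by
    have h3 : HasDerivAt (fun t : ℝ => x + t • EuclideanSpace.single k (1 : ℝ))
        (EuclideanSpace.single k (1 : ℝ)) 0 := by
      simpa using ((hasDerivAt_id (0 : ℝ)).smul_const (EuclideanSpace.single k (1 : ℝ))).const_add x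
    have h4 : HasFDerivAt (linePrimitive c r k f) (fderiv ℝ (linePrimitive c r k f) x)
        (x + (0 : ℝ) • EuclideanSpace.single k (1 : ℝ)) := by simpa using h1
    exact h4.comp_hasDerivAt (0 : ℝ) h3
  have hcont : Continuous fun s : ℝ => f (x + (s - x k) • EuclideanSpace.single k (1 : ℝ)) := by
    have := hf.continuous
    fun_prop
  have h4 : HasDerivAt (fun t : ℝ => linePrimitive c r k f
      (x + t • EuclideanSpace.single k (1 : ℝ))) (f x) 0 := by
    have h5 := intervalIntegral.integral_hasDerivAt_right (a := c k - r) (b := x k)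
      (hcont.intervalIntegrable _ _) (hcont.stronglyMeasurableAtFilter _ _) hcont.continuousAt
    simp only [sub_self, zero_smul, add_zero] at h5
    have h6 : HasDerivAt (fun t : ℝ => x k + t) 1 0 := by
      simpa using (hasDerivAt_id (0 : ℝ)).const_add (x k)
    have h7 := HasDerivAt.comp (0 : ℝ) (h₂ := fun u => ∫ s in (c k - r)..u,
      f (x + (s - x k) • EuclideanSpace.single k (1 : ℝ))) (by simpa using h5) h6
    rw [mul_one] at h7
    refine h7.congr_of_eventuallyEq (Eventually.of_forall fun t => ?_)
    simp only [linePrimitive, line_add_smul, Function.comp_apply]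
    simp
  exact h2.unique h4

theorem BoxSupported.line_eq_zero {f : EuclideanSpace ℝ (Fin n) → ℝ} (hf : BoxSupported c r f)
    {x : EuclideanSpace ℝ (Fin n)} {i k : Fin n} (hik : i ≠ k) (hi : r < |x i - c i|) (s : ℝ) :
    f (x + (s - x k) • EuclideanSpace.single k (1 : ℝ)) = 0 :=
  hf _ ⟨i, by simpa [PiLp.single_apply, hik] using hi⟩

theorem BoxSupported.line_eq_zero' {f : EuclideanSpace ℝ (Fin n) → ℝ} (hf : BoxSupported c r f)
    (x : EuclideanSpace ℝ (Fin n)) {k : Fin n} {s : ℝ} (hs : r < |s - c k|) :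
    f (x + (s - x k) • EuclideanSpace.single k (1 : ℝ)) = 0 :=
  hf _ ⟨k, by simpa [PiLp.single_apply] using hs⟩

/-- Before the first face nothing has been integrated, and beyond the last face the whole line
integral has been, which is zero by hypothesis. Lines that miss the box contribute nothing. -/
theorem BoxSupported.linePrimitive {f : EuclideanSpace ℝ (Fin n) → ℝ} (hf : BoxSupported c r f)
    (hfc : Continuous f) {k : Fin n} (h0 : ∀ x, lineIntegral c r k f x = 0) :
    BoxSupported c r (linePrimitive c r k f) := by
  rintro x ⟨i, hi⟩
  have hcont : Continuous fun s : ℝ => f (x + (s - x k) • EuclideanSpace.single k (1 : ℝ)) := by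
    fun_prop
  by_cases hik : i = k
  · subst hik
    rcases lt_abs.1 hi with h | h
    · rw [FisherRao.linePrimitive, ← intervalIntegral.integral_add_adjacent_intervals
        (hcont.intervalIntegrable _ (c i + r)) (hcont.intervalIntegrable _ _)]
      have := h0 x
      rw [lineIntegral] at this
      rw [this, zero_add]
      refine intervalIntegral.integral_zero_ae (Eventually.of_forall fun s hs => ?_)
      rw [uIoc_of_le (by linarith)] at hs
      exact hf.line_eq_zero' x (lt_abs.2 (Or.inl (by linarith [hs.1])))
    · refine intervalIntegral.integral_zero_ae ?_
      -- The support condition is strict, so f is not known to vanish on the face itself; that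
      -- single point has measure zero.
      have : ∀ᵐ s : ℝ, s ≠ c i - r := by
        simp [ae_iff, measure_singleton]
      filter_upwards [this] with s hs1 hs
      rw [uIoc_of_ge (by linarith)] at hs
      have := lt_of_le_of_ne hs.2 hs1
      exact hf.line_eq_zero' x (lt_abs.2 (Or.inr (by linarith)))
  · exact intervalIntegral.integral_zero_ae
      (Eventually.of_forall fun s _ => hf.line_eq_zero hik hi s)

theorem lineIntegral_add_smul (f : EuclideanSpace ℝ (Fin n) → ℝ) (k : Fin n)
    (x : EuclideanSpace ℝ (Fin n)) (t : ℝ) :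
    lineIntegral c r k f (x + t • EuclideanSpace.single k (1 : ℝ)) = lineIntegral c r k f x := by
  simp only [lineIntegral, line_add_smul]

/-- One step of the reduction: integrating out the `k`-th coordinate. -/
theorem exists_box_reduction_step {θ : ℝ → ℝ} (hθ : ContDiff ℝ ∞ θ)
    (hθ0 : ∀ s, r < |s| → θ s = 0) (hθ1 : ∫ s in -r..r, θ s = 1)
    {f : EuclideanSpace ℝ (Fin n) → ℝ} (hf : ContDiff ℝ ∞ f) (hfb : BoxSupported c r f)
    (k : Fin n) :
    ∃ W : EuclideanSpace ℝ (Fin n) → ℝ, ContDiff ℝ ∞ W ∧ BoxSupported c r W ∧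
      ∀ x, f x = θ (x k - c k) * lineIntegral c r k f x + pd k W x := by
  -- Subtracting the right multiple of θ on each line makes all line integrals in direction k
  -- vanish, so the primitive of g is again supported in the box.
  set g : EuclideanSpace ℝ (Fin n) → ℝ := fun x => f x - θ (x k - c k) * lineIntegral c r k f x
    with hg
  have hgs : ContDiff ℝ ∞ g :=
    hf.sub ((hθ.comp ((contDiff_coord k).sub contDiff_const)).mul (contDiff_lineIntegral hf k))
  have hgb : BoxSupported c r g := by
    rintro x ⟨i, hi⟩
    simp only [hg]
    rw [hfb x ⟨i, hi⟩, zero_sub, neg_eq_zero]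
    by_cases hik : i = k
    · subst hik
      rw [hθ0 _ hi, zero_mul]
    · have : lineIntegral c r k f x = 0 := intervalIntegral.integral_zero_ae
        (Eventually.of_forall fun s _ => hfb.line_eq_zero hik hi s)
      rw [this, mul_zero]
  have hfc := hf.continuous
  have h0 : ∀ x, lineIntegral c r k g x = 0 := by
    intro x
    have h1 : ∀ s : ℝ, g (x + (s - x k) • EuclideanSpace.single k (1 : ℝ)) =
        f (x + (s - x k) • EuclideanSpace.single k (1 : ℝ))
          - θ (s - c k) * lineIntegral c r k f x := by
      intro s
      simp only [hg, lineIntegral_add_smul]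
      simp
    have hcont : Continuous fun s : ℝ => f (x + (s - x k) • EuclideanSpace.single k (1 : ℝ)) := by
      fun_prop
    have hcθ : Continuous fun s : ℝ => θ (s - c k) * lineIntegral c r k f x := by
      have := hθ.continuous
      fun_prop
    rw [lineIntegral]
    simp only [h1]
    rw [intervalIntegral.integral_sub (hcont.intervalIntegrable _ _)
      (hcθ.intervalIntegrable _ _), intervalIntegral.integral_mul_const,
      intervalIntegral.integral_comp_sub_right (fun s => θ s)]
    have e1 : c k - r - c k = -r := by ring
    have e2 : c k + r - c k = r := by ring
    rw [e1, e2, hθ1, one_mul, lineIntegral, sub_self]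
  refine ⟨linePrimitive c r k g, contDiff_linePrimitive hgs k,
    hgb.linePrimitive hgs.continuous h0, fun x => ?_⟩
  rw [pd_linePrimitive hgs k x]
  simp only [hg]
  ring

/-- The coordinates in S are integrated out one at a time. Modulo divergences, what remains is a
product of bumps in these coordinates times a factor H that no longer depends on them; when S is
everything, H is constant. -/
theorem exists_box_reduction {θ : ℝ → ℝ} (hθ : ContDiff ℝ ∞ θ)
    (hθ0 : ∀ s, r < |s| → θ s = 0) (hθ1 : ∫ s in -r..r, θ s = 1)
    {f : EuclideanSpace ℝ (Fin n) → ℝ} (hf : ContDiff ℝ ∞ f) (hfb : BoxSupported c r f)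
    (S : Finset (Fin n)) :
    ∃ V : Fin n → EuclideanSpace ℝ (Fin n) → ℝ, (∀ i, ContDiff ℝ ∞ (V i)) ∧
      (∀ i, BoxSupported c r (V i)) ∧ ∃ G H : EuclideanSpace ℝ (Fin n) → ℝ, ContDiff ℝ ∞ G ∧
      BoxSupported c r G ∧ (∀ x, f x = G x + ∑ i, pd i (V i) x) ∧
      (∀ x, G x = (∏ i ∈ S, θ (x i - c i)) * H x) ∧
      ∀ i ∈ S, ∀ x (t : ℝ), H (x + t • EuclideanSpace.single i (1 : ℝ)) = H x := by
  classical
  induction S using Finset.induction_on with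
  | empty =>
    refine ⟨fun _ _ => 0, fun _ => contDiff_const, fun _ _ _ => rfl, f, f, hf, hfb, ?_, ?_, ?_⟩
    · intro x
      simp [pd]
    · simp
    · simp
  | insert k S hk ih =>
    obtain ⟨V, hV, hVb, G, H, hG, hGb, hfG, hGH, hH⟩ := ih
    obtain ⟨W, hW, hWb, hGW⟩ := exists_box_reduction_step hθ hθ0 hθ1 hG hGb k
    have hI : ∀ x, lineIntegral c r k G x =
        (∏ i ∈ S, θ (x i - c i)) * lineIntegral c r k H x := by
      intro x
      rw [lineIntegral, lineIntegral, ← intervalIntegral.integral_const_mul]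
      refine intervalIntegral.integral_congr fun s _ => ?_
      simp only [hGH]
      congr 1
      refine Finset.prod_congr rfl fun i hi => ?_
      have : i ≠ k := fun h => hk (h ▸ hi)
      simp [this]
    refine ⟨fun i => if i = k then V i + W else V i, ?_, ?_,
      fun x => θ (x k - c k) * lineIntegral c r k G x, lineIntegral c r k H, ?_, ?_, ?_, ?_, ?_⟩
    · intro i
      by_cases h : i = k
      · simp only [h, if_true]
        exact (hV k).add hW
      · simpa [h] using hV i
    · intro i
      by_cases h : i = k
      · simp only [h, if_true]
        intro x hx
        simp [hVb k x hx, hWb x hx]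
      · simpa [h] using hVb i
    · exact (hθ.comp ((contDiff_coord k).sub contDiff_const)).mul (contDiff_lineIntegral hG k)
    · rintro x ⟨i, hi⟩
      by_cases hik : i = k
      · subst hik
        simp [hθ0 _ hi]
      · have : lineIntegral c r k G x = 0 := intervalIntegral.integral_zero_ae
          (Eventually.of_forall fun s _ => hGb.line_eq_zero hik hi s)
        simp [this]
    · intro x
      have hsum : ∑ i, pd i (if i = k then V i + W else V i) x
          = ∑ i, pd i (V i) x + pd k W x := by
        rw [← Finset.add_sum_erase _ _ (Finset.mem_univ k),
          ← Finset.add_sum_erase _ (fun i => pd i (V i) x) (Finset.mem_univ k)]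
        have : ∑ i ∈ Finset.univ.erase k, pd i (if i = k then V i + W else V i) x =
            ∑ i ∈ Finset.univ.erase k, pd i (V i) x :=
          Finset.sum_congr rfl fun i hi => by rw [if_neg (Finset.ne_of_mem_erase hi)]
        rw [this, if_pos rfl]
        have h2 : pd k (V k + W) x = pd k (V k) x + pd k W x := by
          rw [pd, pd, pd, fderiv_add ((hV k).differentiable (by simp) x)
            (hW.differentiable (by simp) x)]
          rfl
        rw [h2]
        ring
      rw [hsum, hfG, hGW]
      ring
    · intro x
      beta_reduce
      rw [hI, Finset.prod_insert hk]
      ring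
    · intro i hi x t
      rcases Finset.mem_insert.1 hi with rfl | hi
      · exact lineIntegral_add_smul _ _ _ _
      · have hik : i ≠ k := fun h => hk (h ▸ hi)
        rw [lineIntegral, lineIntegral]
        refine intervalIntegral.integral_congr fun s _ => ?_
        have e : (x + t • EuclideanSpace.single i (1 : ℝ)) k = x k := by
          simp [hik.symm]
        simp only [e]
        rw [add_right_comm]
        exact hH i hi _ t

theorem eq_apply_zero_of_forall_single {H : EuclideanSpace ℝ (Fin n) → ℝ}
    (hH : ∀ i x (t : ℝ), H (x + t • EuclideanSpace.single i (1 : ℝ)) = H x)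
    (x : EuclideanSpace ℝ (Fin n)) : H x = H 0 := by
  classical
  have h : ∀ S : Finset (Fin n), H (∑ i ∈ S, x i • EuclideanSpace.single i (1 : ℝ)) = H 0 := by
    intro S
    induction S using Finset.induction_on with
    | empty => simp
    | insert k S hk ih => rw [Finset.sum_insert hk, add_comm, hH, ih]
  rw [← h Finset.univ]
  congr 1
  ext j
  simp [Pi.single_apply]

/-- Modulo divergences, a smooth function supported in a box is a multiple of a fixed one. -/
theorem exists_box_divergence (c : EuclideanSpace ℝ (Fin n)) {r : ℝ} (hr : 0 < r) :
    ∃ β : EuclideanSpace ℝ (Fin n) → ℝ, ContDiff ℝ ∞ β ∧ BoxSupported c r β ∧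
      ∀ f : EuclideanSpace ℝ (Fin n) → ℝ, ContDiff ℝ ∞ f → BoxSupported c r f →
        ∃ (C : ℝ) (V : Fin n → EuclideanSpace ℝ (Fin n) → ℝ), (∀ i, ContDiff ℝ ∞ (V i)) ∧
          (∀ i, BoxSupported c r (V i)) ∧ ∀ x, f x = C * β x + ∑ i, pd i (V i) x := by
  let b : ContDiffBump (0 : ℝ) := ⟨r / 2, r, by linarith, by linarith⟩
  set θ : ℝ → ℝ := b.normed volume with hθdef
  have hθ : ContDiff ℝ ∞ θ := b.contDiff_normed
  have hθ0 : ∀ s, r < |s| → θ s = 0 := by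
    intro s hs
    rw [← Function.notMem_support, hθdef, b.support_normed_eq]
    simpa using hs.le
  have hθ1 : ∫ s in -r..r, θ s = 1 := by
    rw [intervalIntegral.integral_of_le (by linarith), ← b.integral_normed (μ := volume)]
    refine setIntegral_eq_integral_of_forall_compl_eq_zero fun s hs => ?_
    rw [← Function.notMem_support, b.support_normed_eq]
    intro h
    rw [Metric.mem_ball, dist_zero_right, Real.norm_eq_abs, abs_lt] at h
    exact hs ⟨h.1, h.2.le⟩
  refine ⟨fun x => ∏ i, θ (x i - c i), contDiff_prod fun i _ =>
    hθ.comp ((contDiff_coord i).sub contDiff_const), ?_, ?_⟩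
  · rintro x ⟨i, hi⟩
    exact Finset.prod_eq_zero (Finset.mem_univ i) (hθ0 _ hi)
  · intro f hf hfb
    obtain ⟨V, hV, hVb, G, H, -, -, hfG, hGH, hH⟩ :=
      exists_box_reduction hθ hθ0 hθ1 hf hfb Finset.univ
    refine ⟨H 0, V, hV, hVb, fun x => ?_⟩
    rw [hfG, hGH, eq_apply_zero_of_forall_single (fun i => hH i (Finset.mem_univ i)) x, mul_comm]

end Box

/-! ### Smoothness of functions and fields read in charts. -/

section Coordinates

variable {n : ℕ} {M : Type*} [TopologicalSpace M] [ChartedSpace (EuclideanSpace ℝ (Fin n)) M]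
  [IsManifold (𝓡 n) ∞ M]

instance isManifold_one : IsManifold (𝓡 n) 1 M := IsManifold.of_le (n := ∞) (by simp)

/-- The coordinate representation of a vector field in the chart at `p`. -/
def fieldRep (u : VField n M) (p : M) (y : EuclideanSpace ℝ (Fin n)) : EuclideanSpace ℝ (Fin n) :=
  mfderiv (𝓡 n) 𝓘(ℝ, EuclideanSpace ℝ (Fin n)) (extChartAt (𝓡 n) p)
      ((extChartAt (𝓡 n) p).symm y) (u ((extChartAt (𝓡 n) p).symm y))

theorem mfderiv_chart_mfderiv_symm {p : M} {y : EuclideanSpace ℝ (Fin n)}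
    (hy : y ∈ (extChartAt (𝓡 n) p).target) (v : EuclideanSpace ℝ (Fin n)) :
    mfderiv (𝓡 n) 𝓘(ℝ, EuclideanSpace ℝ (Fin n)) (extChartAt (𝓡 n) p)
      ((extChartAt (𝓡 n) p).symm y)
      (mfderiv 𝓘(ℝ, EuclideanSpace ℝ (Fin n)) (𝓡 n) (extChartAt (𝓡 n) p).symm y v) = v := by
  have h := mfderiv_extChartAt_comp_mfderivWithin_extChartAt_symm (I := 𝓡 n) hy
  simp only [modelWithCornersSelf_coe, range_id, mfderivWithin_univ] at h
  exact DFunLike.congr_fun h v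

theorem mfderiv_symm_mfderiv_chart {p : M} {x : M} (hx : x ∈ (extChartAt (𝓡 n) p).source)
    (v : TangentSpace (𝓡 n) x) :
    mfderiv 𝓘(ℝ, EuclideanSpace ℝ (Fin n)) (𝓡 n) (extChartAt (𝓡 n) p).symm
      (extChartAt (𝓡 n) p x)
      (mfderiv (𝓡 n) 𝓘(ℝ, EuclideanSpace ℝ (Fin n)) (extChartAt (𝓡 n) p) x v) = v := by
  have h := mfderivWithin_extChartAt_symm_comp_mfderiv_extChartAt' (I := 𝓡 n) hx
  simp only [modelWithCornersSelf_coe, range_id, mfderivWithin_univ] at h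
  exact DFunLike.congr_fun h v

theorem contMDiffOn_symm (p : M) :
    ContMDiffOn 𝓘(ℝ, EuclideanSpace ℝ (Fin n)) (𝓡 n) ∞ (extChartAt (𝓡 n) p).symm
      (extChartAt (𝓡 n) p).target :=
  contMDiffOn_extChartAt_symm p

theorem contMDiffOn_chart (p : M) :
    ContMDiffOn (𝓡 n) 𝓘(ℝ, EuclideanSpace ℝ (Fin n)) ∞ (extChartAt (𝓡 n) p)
      (extChartAt (𝓡 n) p).source := by
  rw [extChartAt_source]
  exact contMDiffOn_extChartAt

theorem mdifferentiableAt_symm {p : M} {y : EuclideanSpace ℝ (Fin n)}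
    (hy : y ∈ (extChartAt (𝓡 n) p).target) :
    MDifferentiableAt 𝓘(ℝ, EuclideanSpace ℝ (Fin n)) (𝓡 n) (extChartAt (𝓡 n) p).symm y :=
  ((contMDiffOn_symm p).contMDiffAt ((isOpen_extChartAt_target p).mem_nhds hy)).mdifferentiableAt
    (by simp)

theorem dirDeriv_eq_fderiv {f : M → ℝ} {p : M} {y : EuclideanSpace ℝ (Fin n)}
    (hy : y ∈ (extChartAt (𝓡 n) p).target)
    (hf : MDifferentiableAt (𝓡 n) 𝓘(ℝ, ℝ) f ((extChartAt (𝓡 n) p).symm y))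
    (v : TangentSpace (𝓡 n) ((extChartAt (𝓡 n) p).symm y)) :
    dirDeriv f ((extChartAt (𝓡 n) p).symm y) v =
      fderiv ℝ (fun z => f ((extChartAt (𝓡 n) p).symm z)) y
        (mfderiv (𝓡 n) 𝓘(ℝ, EuclideanSpace ℝ (Fin n)) (extChartAt (𝓡 n) p)
          ((extChartAt (𝓡 n) p).symm y) v) := by
  have h1 := mfderiv_comp y hf (mdifferentiableAt_symm hy)
  rw [mfderiv_eq_fderiv] at h1
  have h2 := DFunLike.congr_fun h1 (mfderiv (𝓡 n) 𝓘(ℝ, EuclideanSpace ℝ (Fin n))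
    (extChartAt (𝓡 n) p) ((extChartAt (𝓡 n) p).symm y) v)
  have h3 := mfderiv_symm_mfderiv_chart ((extChartAt (𝓡 n) p).map_target hy) v
  rw [(extChartAt (𝓡 n) p).right_inv hy] at h3
  refine Eq.trans ?_ h2.symm
  change mfderiv (𝓡 n) 𝓘(ℝ, ℝ) f _ v = mfderiv (𝓡 n) 𝓘(ℝ, ℝ) f _ _
  exact congrArg _ h3.symm

/-- A time-dependent function on `M`, smooth on `J × M`. -/
def SmoothFun (J : Set ℝ) (F : ℝ → M → ℝ) : Prop :=
  ContMDiffOn (𝓘(ℝ, ℝ).prod (𝓡 n)) 𝓘(ℝ, ℝ) ∞ (fun q : ℝ × M => F q.1 q.2) (J ×ˢ univ)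

/-- A time-dependent vector field on `M`, smooth on `J × M`. -/
def SmoothTimeField (J : Set ℝ) (u : ℝ → VField n M) : Prop :=
  ContMDiffOn (𝓘(ℝ, ℝ).prod (𝓡 n)) (𝓡 n).tangent ∞
    (fun q : ℝ × M => (⟨q.2, u q.1 q.2⟩ : TangentBundle (𝓡 n) M)) (J ×ˢ univ)

theorem contMDiffOn_prod_iff_contDiffOn {G : Type*} [NormedAddCommGroup G] [NormedSpace ℝ G]
    {J : Set ℝ} {F : ℝ → M → G} (p : M) :
    ContMDiffOn (𝓘(ℝ, ℝ).prod (𝓡 n)) 𝓘(ℝ, G) ∞ (fun q : ℝ × M => F q.1 q.2)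
      (J ×ˢ (extChartAt (𝓡 n) p).source) ↔
    ContDiffOn ℝ ∞ (fun z : ℝ × EuclideanSpace ℝ (Fin n) => F z.1 ((extChartAt (𝓡 n) p).symm z.2))
      (J ×ˢ (extChartAt (𝓡 n) p).target) := by
  rw [← contMDiffOn_iff_contDiffOn]
  constructor
  · intro h
    refine h.comp (contDiff_fst.contMDiff.contMDiffOn.prodMk
      ((contMDiffOn_symm p).comp contDiff_snd.contMDiff.contMDiffOn ?_)) ?_
    · exact fun z hz => hz.2
    · exact fun z hz => ⟨hz.1, (extChartAt (𝓡 n) p).map_target hz.2⟩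
  · intro h
    have := h.comp (contMDiffOn_fst.prodMk_space ((contMDiffOn_chart p).comp contMDiffOn_snd
      (fun z hz => hz.2))) (fun z (hz : z ∈ J ×ˢ (extChartAt (𝓡 n) p).source) =>
        ⟨hz.1, (extChartAt (𝓡 n) p).map_source hz.2⟩)
    refine this.congr fun z hz => ?_
    change F z.1 z.2 = F z.1 ((extChartAt (𝓡 n) p).symm (extChartAt (𝓡 n) p z.2))
    rw [(extChartAt (𝓡 n) p).left_inv hz.2]

theorem contMDiffOn_prod_univ_iff {G : Type*} [NormedAddCommGroup G] [NormedSpace ℝ G]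
    {J : Set ℝ} {F : ℝ → M → G} :
    ContMDiffOn (𝓘(ℝ, ℝ).prod (𝓡 n)) 𝓘(ℝ, G) ∞ (fun q : ℝ × M => F q.1 q.2) (J ×ˢ univ) ↔
    ∀ p, ContDiffOn ℝ ∞
      (fun z : ℝ × EuclideanSpace ℝ (Fin n) => F z.1 ((extChartAt (𝓡 n) p).symm z.2))
      (J ×ˢ (extChartAt (𝓡 n) p).target) := by
  simp only [← contMDiffOn_prod_iff_contDiffOn]
  constructor
  · exact fun h p => h.mono (prod_mono_right (subset_univ _))
  · intro h q hq
    refine (h q.2 q ⟨hq.1, mem_extChartAt_source q.2⟩).mono_of_mem_nhdsWithin ?_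
    rw [mem_nhdsWithin]
    exact ⟨univ ×ˢ (extChartAt (𝓡 n) q.2).source, isOpen_univ.prod (isOpen_extChartAt_source q.2),
      ⟨mem_univ _, mem_extChartAt_source q.2⟩, fun z hz => ⟨hz.2.1, hz.1.2⟩⟩

theorem smoothFun_iff {J : Set ℝ} {F : ℝ → M → ℝ} :
    SmoothFun (n := n) J F ↔ ∀ p, ContDiffOn ℝ ∞
      (fun z : ℝ × EuclideanSpace ℝ (Fin n) => F z.1 ((extChartAt (𝓡 n) p).symm z.2))
      (J ×ˢ (extChartAt (𝓡 n) p).target) :=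
  contMDiffOn_prod_univ_iff

/-- The trivialisation of the tangent bundle at p is the derivative of the chart at p. This reduces
smoothness of sections to smoothness of coordinate components. -/
theorem smoothTimeField_iff {J : Set ℝ} {u : ℝ → VField n M} :
    SmoothTimeField J u ↔ ∀ p, ContDiffOn ℝ ∞
      (fun z : ℝ × EuclideanSpace ℝ (Fin n) => fieldRep (u z.1) p z.2)
      (J ×ˢ (extChartAt (𝓡 n) p).target) := by
  have key : ∀ p : M, ContMDiffOn (𝓘(ℝ, ℝ).prod (𝓡 n)) (𝓡 n).tangent ∞
      (fun q : ℝ × M => (⟨q.2, u q.1 q.2⟩ : TangentBundle (𝓡 n) M))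
      (J ×ˢ (extChartAt (𝓡 n) p).source) ↔ ContDiffOn ℝ ∞
      (fun z : ℝ × EuclideanSpace ℝ (Fin n) => fieldRep (u z.1) p z.2)
      (J ×ˢ (extChartAt (𝓡 n) p).target) := by
    intro p
    have h1 := contMDiffOn_prod_iff_contDiffOn (n := n) (J := J) (F := fun t x =>
      (mfderiv (𝓡 n) 𝓘(ℝ, EuclideanSpace ℝ (Fin n)) (extChartAt (𝓡 n) p) x (u t x) :
        EuclideanSpace ℝ (Fin n))) p
    refine Iff.trans ?_ h1
    have hbase : ∀ x, x ∈ (extChartAt (𝓡 n) p).source →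
        x ∈ (trivializationAt (EuclideanSpace ℝ (Fin n)) (TangentSpace (𝓡 n)) p).baseSet := by
      intro x hx
      simpa using hx
    rw [(trivializationAt (EuclideanSpace ℝ (Fin n)) (TangentSpace (𝓡 n)) p).contMDiffOn_iff
      (fun q hq => by
        rw [Bundle.Trivialization.mem_source]
        exact hbase _ hq.2)]
    rw [and_iff_right contMDiffOn_snd]
    refine contMDiffOn_congr fun q hq => ?_
    have hq' : q.2 ∈ (chartAt (EuclideanSpace ℝ (Fin n)) p).source := by
      simpa using hq.2
    have h2 := DFunLike.congr_fun
      (TangentBundle.continuousLinearMapAt_trivializationAt (I := 𝓡 n) hq') (u q.1 q.2)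
    refine Eq.trans ?_ h2
    rw [Bundle.Trivialization.continuousLinearMapAt_apply,
      Bundle.Trivialization.coe_linearMapAt_of_mem _ (hbase _ hq.2)]
  constructor
  · exact fun h p => (key p).1 (h.mono (prod_mono_right (subset_univ _)))
  · intro h q hq
    refine ((key q.2).2 (h q.2) q ⟨hq.1, mem_extChartAt_source q.2⟩).mono_of_mem_nhdsWithin ?_
    rw [mem_nhdsWithin]
    exact ⟨univ ×ˢ (extChartAt (𝓡 n) q.2).source, isOpen_univ.prod (isOpen_extChartAt_source q.2),
      ⟨mem_univ _, mem_extChartAt_source q.2⟩, fun z hz => ⟨hz.2.1, hz.1.2⟩⟩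

end Coordinates

/-! ### Calculus of time-dependent functions and fields. -/

section SmoothCalculus

/-- The spatial derivative is the full derivative within J × V applied to (0, w). Only unique
differentiability of J is required, so that half-open intervals [0, T) are allowed. -/
theorem contDiffOn_fderiv_slice {E G : Type*} [NormedAddCommGroup E] [NormedSpace ℝ E]
    [NormedAddCommGroup G] [NormedSpace ℝ G] {J : Set ℝ} (hJ : UniqueDiffOn ℝ J) {V : Set E}
    (hV : IsOpen V) {F : ℝ → E → G} (hF : ContDiffOn ℝ ∞ (fun z : ℝ × E => F z.1 z.2) (J ×ˢ V))
    {w : ℝ × E → E} (hw : ContDiffOn ℝ ∞ w (J ×ˢ V)) :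
    ContDiffOn ℝ ∞ (fun z : ℝ × E => fderiv ℝ (F z.1) z.2 (w z)) (J ×ˢ V) := by
  have h1 : ContDiffOn ℝ ∞ (fderivWithin ℝ (fun z : ℝ × E => F z.1 z.2) (J ×ˢ V)) (J ×ˢ V) :=
    hF.fderivWithin (hJ.prod hV.uniqueDiffOn) (by simp)
  have h2 := h1.clm_apply ((contDiffOn_const (c := (0 : ℝ))).prodMk hw)
  refine h2.congr fun z hz => ?_
  have h3 := (hF.differentiableOn (by simp) z hz).hasFDerivWithinAt
  have h4 : HasFDerivWithinAt (fun y : E => (z.1, y)) (ContinuousLinearMap.inr ℝ ℝ E) V z.2 :=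
    (hasFDerivAt_prodMk_right z.1 z.2).hasFDerivWithinAt
  have h5 := (HasFDerivWithinAt.comp z.2 (t := J ×ˢ V) h3 h4 (fun y hy => ⟨hz.1, hy⟩)).hasFDerivAt
    (hV.mem_nhds hz.2)
  rw [show fderiv ℝ (F z.1) z.2 = _ from h5.fderiv]
  rfl

theorem contDiffOn_deriv_slice {E G : Type*} [NormedAddCommGroup E] [NormedSpace ℝ E]
    [NormedAddCommGroup G] [NormedSpace ℝ G] {J : Set ℝ} (hJ : IsOpen J) {V : Set E}
    (hV : IsOpen V) {F : ℝ → E → G} (hF : ContDiffOn ℝ ∞ (fun z : ℝ × E => F z.1 z.2) (J ×ˢ V)) :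
    ContDiffOn ℝ ∞ (fun z : ℝ × E => deriv (fun s => F s z.2) z.1) (J ×ˢ V) := by
  have h1 : ContDiffOn ℝ ∞ (fderivWithin ℝ (fun z : ℝ × E => F z.1 z.2) (J ×ˢ V)) (J ×ˢ V) :=
    hF.fderivWithin (hJ.prod hV).uniqueDiffOn (by simp)
  have h2 := h1.clm_apply (contDiffOn_const (c := ((1 : ℝ), (0 : E))))
  refine h2.congr fun z hz => ?_
  have h3 := (hF.differentiableOn (by simp) z hz).hasFDerivWithinAt
  have h4 : HasDerivWithinAt (fun s : ℝ => (s, z.2)) ((1 : ℝ), (0 : E)) J z.1 :=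
    ((hasDerivAt_id z.1).prodMk (hasDerivAt_const z.1 z.2)).hasDerivWithinAt
  have h5 := (HasFDerivWithinAt.comp_hasDerivWithinAt (t := J ×ˢ V) z.1 h3 h4
    (fun y hy => ⟨hy, hz.2⟩)).hasDerivAt (hJ.mem_nhds hz.1)
  exact h5.deriv

variable {n : ℕ} {M : Type*} [TopologicalSpace M] [ChartedSpace (EuclideanSpace ℝ (Fin n)) M]
  [IsManifold (𝓡 n) ∞ M] {J : Set ℝ}

theorem SmoothFun.mono {J' : Set ℝ} {F : ℝ → M → ℝ} (hF : SmoothFun (n := n) J F) (h : J' ⊆ J) :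
    SmoothFun (n := n) J' F :=
  ContMDiffOn.mono hF (prod_mono_left h)

theorem SmoothTimeField.mono {J' : Set ℝ} {u : ℝ → VField n M} (hu : SmoothTimeField J u)
    (h : J' ⊆ J) : SmoothTimeField J' u :=
  ContMDiffOn.mono hu (prod_mono_left h)

theorem smoothFun_const {f : M → ℝ} (hf : ContMDiff (𝓡 n) 𝓘(ℝ, ℝ) ∞ f) :
    SmoothFun (n := n) J fun _ => f :=
  (hf.comp contMDiff_snd).contMDiffOn

theorem smoothFun_time {a : ℝ → ℝ} (ha : ContDiffOn ℝ ∞ a J) :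
    SmoothFun (n := n) J fun t (_ : M) => a t :=
  ha.contMDiffOn.comp contMDiffOn_fst (fun _ hz => hz.1)

theorem SmoothFun.contMDiff {F : ℝ → M → ℝ} (hF : SmoothFun (n := n) J F) {t : ℝ} (ht : t ∈ J) :
    ContMDiff (𝓡 n) 𝓘(ℝ, ℝ) ∞ (F t) := by
  rw [← contMDiffOn_univ]
  exact ContMDiffOn.comp (g := fun q : ℝ × M => F q.1 q.2) (f := fun x : M => (t, x)) hF
    (contMDiff_const.prodMk contMDiff_id).contMDiffOn (fun x _ => ⟨ht, mem_univ _⟩)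

theorem SmoothFun.add {F G : ℝ → M → ℝ} (hF : SmoothFun (n := n) J F)
    (hG : SmoothFun (n := n) J G) : SmoothFun (n := n) J fun t x => F t x + G t x :=
  ContMDiffOn.add hF hG

theorem SmoothFun.mul {F G : ℝ → M → ℝ} (hF : SmoothFun (n := n) J F)
    (hG : SmoothFun (n := n) J G) : SmoothFun (n := n) J fun t x => F t x * G t x :=
  ContMDiffOn.mul hF hG

theorem SmoothFun.comp_contDiffAt {F : ℝ → M → ℝ} (hF : SmoothFun (n := n) J F) {a : ℝ → ℝ}
    (ha : ∀ t ∈ J, ∀ x, ContDiffAt ℝ ∞ a (F t x)) : SmoothFun (n := n) J fun t x => a (F t x) :=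
  fun q hq => (ha q.1 hq.1 q.2).contMDiffAt.comp_contMDiffWithinAt q (hF q hq)

theorem SmoothFun.inv {F : ℝ → M → ℝ} (hF : SmoothFun (n := n) J F)
    (h0 : ∀ t ∈ J, ∀ x, F t x ≠ 0) : SmoothFun (n := n) J fun t x => (F t x)⁻¹ :=
  hF.comp_contDiffAt (a := fun s => s⁻¹) fun t ht x => contDiffAt_inv ℝ (h0 t ht x)

theorem SmoothFun.congr {F G : ℝ → M → ℝ} (hF : SmoothFun (n := n) J F)
    (h : ∀ t ∈ J, ∀ x, G t x = F t x) : SmoothFun (n := n) J G :=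
  ContMDiffOn.congr hF fun q hq => h q.1 hq.1 q.2

theorem SmoothFun.continuousOn {F : ℝ → M → ℝ} (hF : SmoothFun (n := n) J F) :
    ContinuousOn (fun q : ℝ × M => F q.1 q.2) (J ×ˢ univ) :=
  ContMDiffOn.continuousOn hF

theorem SmoothFun.comp_map {F : ℝ → M → ℝ} (hF : SmoothFun (n := n) J F) {ξ : ℝ → M → M}
    (hξ : ContMDiffOn (𝓘(ℝ, ℝ).prod (𝓡 n)) (𝓡 n) ∞ (fun q : ℝ × M => ξ q.1 q.2) (J ×ˢ univ)) :
    SmoothFun (n := n) J fun t x => F t (ξ t x) :=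
  ContMDiffOn.comp hF (contMDiffOn_fst.prodMk hξ) fun _ hq => ⟨hq.1, mem_univ _⟩

theorem SmoothFun.dt (hJ : IsOpen J) {F : ℝ → M → ℝ} (hF : SmoothFun (n := n) J F) :
    SmoothFun (n := n) J fun t x => deriv (fun s => F s x) t := by
  rw [smoothFun_iff] at hF ⊢
  exact fun p => contDiffOn_deriv_slice hJ (isOpen_extChartAt_target p)
    (F := fun t y => F t ((extChartAt (𝓡 n) p).symm y)) (hF p)

theorem SmoothFun.contDiffOn_time {F : ℝ → M → ℝ} (hF : SmoothFun (n := n) J F) (x : M) :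
    ContDiffOn ℝ ∞ (fun s => F s x) J := by
  rw [← contMDiffOn_iff_contDiffOn]
  exact ContMDiffOn.comp hF (contMDiff_id.prodMk contMDiff_const).contMDiffOn
    (fun t ht => ⟨ht, mem_univ _⟩)

theorem SmoothFun.hasDerivAt (hJ : IsOpen J) {F : ℝ → M → ℝ} (hF : SmoothFun (n := n) J F)
    {t : ℝ} (ht : t ∈ J) (x : M) :
    HasDerivAt (fun s => F s x) (deriv (fun s => F s x) t) t :=
  (((hF.contDiffOn_time x).contDiffAt (hJ.mem_nhds ht)).differentiableAt (by simp)).hasDerivAt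

theorem SmoothFun.dirDeriv (hJ : UniqueDiffOn ℝ J) {F : ℝ → M → ℝ} (hF : SmoothFun (n := n) J F)
    {u : ℝ → VField n M} (hu : SmoothTimeField J u) :
    SmoothFun (n := n) J fun t x => FisherRao.dirDeriv (F t) x (u t x) := by
  have hF' := hF
  rw [smoothFun_iff] at hF' ⊢
  intro p
  refine (contDiffOn_fderiv_slice hJ (isOpen_extChartAt_target p)
    (F := fun t y => F t ((extChartAt (𝓡 n) p).symm y)) (hF' p)
    (smoothTimeField_iff.1 hu p)).congr fun z hz => ?_
  exact dirDeriv_eq_fderiv hz.2 ((hF.contMDiff hz.1).mdifferentiableAt (by simp)) _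

theorem smoothTimeField_const {u : VField n M} (hu : SmoothField u) :
    SmoothTimeField J fun _ => u :=
  (ContMDiff.comp hu contMDiff_snd).contMDiffOn

theorem SmoothTimeField.smoothField {u : ℝ → VField n M} (hu : SmoothTimeField J u) {t : ℝ}
    (ht : t ∈ J) : SmoothField (u t) := by
  rw [SmoothField, ← contMDiffOn_univ]
  exact ContMDiffOn.comp hu (contMDiff_const.prodMk contMDiff_id).contMDiffOn
    (fun x _ => ⟨ht, mem_univ _⟩)

theorem SmoothTimeField.add {u v : ℝ → VField n M} (hu : SmoothTimeField J u)
    (hv : SmoothTimeField J v) : SmoothTimeField J fun t x => u t x + v t x := by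
  rw [smoothTimeField_iff] at hu hv ⊢
  intro p
  refine ((hu p).add (hv p)).congr fun z _ => ?_
  exact map_add _ _ _

theorem SmoothTimeField.smul {F : ℝ → M → ℝ} (hF : SmoothFun (n := n) J F) {u : ℝ → VField n M}
    (hu : SmoothTimeField J u) : SmoothTimeField J fun t x => F t x • u t x := by
  rw [smoothTimeField_iff] at hu ⊢
  rw [smoothFun_iff] at hF
  intro p
  refine ((hF p).smul (hu p)).congr fun z _ => ?_
  exact map_smul _ _ _

theorem SmoothTimeField.congr {u v : ℝ → VField n M} (hu : SmoothTimeField J u)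
    (h : ∀ t ∈ J, ∀ x, v t x = u t x) : SmoothTimeField J v :=
  ContMDiffOn.congr hu fun q hq => by rw [h q.1 hq.1 q.2]

theorem dirDeriv_add (f : M → ℝ) (x : M) (v w : TangentSpace (𝓡 n) x) :
    dirDeriv f x (v + w) = dirDeriv f x v + dirDeriv f x w := map_add _ _ _

theorem dirDeriv_smul (f : M → ℝ) (x : M) (a : ℝ) (v : TangentSpace (𝓡 n) x) :
    dirDeriv f x (a • v) = a * dirDeriv f x v := map_smul _ _ _

theorem dirDeriv_mul {f h : M → ℝ} {x : M} (hf : MDifferentiableAt (𝓡 n) 𝓘(ℝ, ℝ) f x)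
    (hh : MDifferentiableAt (𝓡 n) 𝓘(ℝ, ℝ) h x) (v : TangentSpace (𝓡 n) x) :
    dirDeriv (fun y => f y * h y) x v = f x * dirDeriv h x v + h x * dirDeriv f x v := by
  have := (hf.hasMFDerivAt.mul hh.hasMFDerivAt).mfderiv
  exact DFunLike.congr_fun this v

end SmoothCalculus

/-! ### Smoothness of the metric coefficients. -/

section GramMatrix

variable {n : ℕ} {M : Type*} [TopologicalSpace M] [ChartedSpace (EuclideanSpace ℝ (Fin n)) M]
  [IsManifold (𝓡 n) ∞ M]

/-- In the trivialisation at p the section is constant. -/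
theorem contMDiffOn_coordVec (p : M) (i : Fin n) :
    ContMDiffOn 𝓘(ℝ, EuclideanSpace ℝ (Fin n)) (𝓡 n).tangent ∞
      (fun y => (⟨(extChartAt (𝓡 n) p).symm y, coordVec p y i⟩ : TangentBundle (𝓡 n) M))
      (extChartAt (𝓡 n) p).target := by
  have hbase : ∀ x, x ∈ (extChartAt (𝓡 n) p).source →
      x ∈ (trivializationAt (EuclideanSpace ℝ (Fin n)) (TangentSpace (𝓡 n)) p).baseSet := by
    intro x hx
    simpa using hx
  rw [(trivializationAt (EuclideanSpace ℝ (Fin n)) (TangentSpace (𝓡 n)) p).contMDiffOn_iff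
    (fun q hq => by
      rw [Bundle.Trivialization.mem_source]
      exact hbase _ ((extChartAt (𝓡 n) p).map_target hq))]
  refine ⟨contMDiffOn_symm p, contMDiffOn_const (c := EuclideanSpace.single i (1 : ℝ))
    |>.congr fun y hy => ?_⟩
  have hy' := (extChartAt (𝓡 n) p).map_target hy
  have h2 := DFunLike.congr_fun (TangentBundle.continuousLinearMapAt_trivializationAt (I := 𝓡 n)
    (by simpa using hy' : (extChartAt (𝓡 n) p).symm y ∈
      (chartAt (EuclideanSpace ℝ (Fin n)) p).source)) (coordVec p y i)
  refine Eq.trans ?_ (h2.trans (mfderiv_chart_mfderiv_symm hy _))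
  rw [Bundle.Trivialization.continuousLinearMapAt_apply,
    Bundle.Trivialization.coe_linearMapAt_of_mem _ (hbase _ hy')]

theorem contDiffOn_gram (g : Metric n M) (p : M) (i j : Fin n) :
    ContDiffOn ℝ ∞ (fun y => gram g p y i j) (extChartAt (𝓡 n) p).target := by
  rw [← contMDiffOn_iff_contDiffOn]
  have h1 : ContMDiffOn 𝓘(ℝ, EuclideanSpace ℝ (Fin n))
      ((𝓡 n).prod 𝓘(ℝ, EuclideanSpace ℝ (Fin n) →L[ℝ] EuclideanSpace ℝ (Fin n) →L[ℝ] ℝ)) ∞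
      (fun y => Bundle.TotalSpace.mk' (EuclideanSpace ℝ (Fin n) →L[ℝ] EuclideanSpace ℝ (Fin n) →L[ℝ] ℝ)
        (E := fun x : M => TangentSpace (𝓡 n) x →L[ℝ] TangentSpace (𝓡 n) x →L[ℝ]
          Bundle.Trivial M ℝ x)
        ((extChartAt (𝓡 n) p).symm y) (g.inner ((extChartAt (𝓡 n) p).symm y)))
      (extChartAt (𝓡 n) p).target :=
    g.contMDiff.comp_contMDiffOn (contMDiffOn_symm p)
  have h2 := ContMDiffOn.clm_bundle_apply₂ (F₁ := EuclideanSpace ℝ (Fin n))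
    (F₂ := EuclideanSpace ℝ (Fin n)) (F₃ := ℝ)
    (E₃ := Bundle.Trivial M ℝ) h1 (contMDiffOn_coordVec p i) (contMDiffOn_coordVec p j)
  intro y hy
  have h3 := h2 y hy
  rw [Bundle.contMDiffWithinAt_totalSpace] at h3
  exact h3.2

end GramMatrix

/-! ### The Riemannian density and its change under coordinate changes. -/

section Transformation

variable {n : ℕ} {M : Type*} [TopologicalSpace M] [ChartedSpace (EuclideanSpace ℝ (Fin n)) M]
  [IsManifold (𝓡 n) ∞ M]

/-- The metric in the chart at `p`, as a bilinear form on the model space. -/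
def metricForm (g : Metric n M) (p : M) (y : EuclideanSpace ℝ (Fin n)) :
    EuclideanSpace ℝ (Fin n) →ₗ[ℝ] EuclideanSpace ℝ (Fin n) →ₗ[ℝ] ℝ :=
  LinearMap.mk₂ ℝ (fun v w => g.inner ((extChartAt (𝓡 n) p).symm y)
      (mfderiv 𝓘(ℝ, EuclideanSpace ℝ (Fin n)) (𝓡 n) (extChartAt (𝓡 n) p).symm y v)
      (mfderiv 𝓘(ℝ, EuclideanSpace ℝ (Fin n)) (𝓡 n) (extChartAt (𝓡 n) p).symm y w))
    (fun _ _ _ => by erw [map_add, map_add]; rfl)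
    (fun _ _ _ => by erw [map_smul, map_smul]; rfl)
    (fun _ _ _ => by erw [map_add, map_add])
    (fun _ _ _ => by erw [map_smul, map_smul])

theorem gram_apply (g : Metric n M) (p : M) (y : EuclideanSpace ℝ (Fin n)) (i j : Fin n) :
    gram g p y i j = metricForm g p y (EuclideanSpace.single i 1) (EuclideanSpace.single j 1) := rfl

theorem sum_smul_single (v : EuclideanSpace ℝ (Fin n)) :
    ∑ i, v i • EuclideanSpace.single i (1 : ℝ) = v := by
  ext j
  simp [Pi.single_apply]

theorem metricForm_eq_sum (g : Metric n M) (p : M) (y v w : EuclideanSpace ℝ (Fin n)) :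
    metricForm g p y v w = ∑ i, ∑ j, v i * w j * gram g p y i j := by
  conv_lhs => rw [← sum_smul_single v, ← sum_smul_single w]
  simp only [map_sum, LinearMap.sum_apply, map_smul, LinearMap.smul_apply, smul_eq_mul,
    Finset.mul_sum, gram_apply]
  rw [Finset.sum_comm]
  refine Finset.sum_congr rfl fun i _ => Finset.sum_congr rfl fun j _ => by ring

theorem isSymm_gram (g : Metric n M) (p : M) (y : EuclideanSpace ℝ (Fin n)) :
    (gram g p y).IsSymm := by
  ext i j
  exact g.symm _ _ _

theorem posDef_gram (g : Metric n M) {p : M} {y : EuclideanSpace ℝ (Fin n)}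
    (hy : y ∈ (extChartAt (𝓡 n) p).target) : (gram g p y).PosDef := by
  refine Matrix.PosDef.of_dotProduct_mulVec_pos ?_ fun v hv => ?_
  · rw [Matrix.IsHermitian, Matrix.conjTranspose_eq_transpose_of_trivial]
    exact isSymm_gram g p y
  · have h1 : metricForm g p y (WithLp.toLp 2 v) (WithLp.toLp 2 v) =
        star v ⬝ᵥ (gram g p y).mulVec v := by
      rw [metricForm_eq_sum]
      simp only [dotProduct, Matrix.mulVec, Finset.mul_sum, star_trivial]
      refine Finset.sum_congr rfl fun i _ => Finset.sum_congr rfl fun j _ => by ring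
    rw [← h1]
    refine g.pos _ _ fun h0 => hv ?_
    have h2 := mfderiv_chart_mfderiv_symm hy (WithLp.toLp 2 v)
    rw [h0] at h2
    have h3 : (WithLp.toLp 2 v : EuclideanSpace ℝ (Fin n)) = 0 := by
      rw [← h2]
      exact map_zero _
    simpa using h3

theorem volDensity_pos (g : Metric n M) {p : M} {y : EuclideanSpace ℝ (Fin n)}
    (hy : y ∈ (extChartAt (𝓡 n) p).target) : 0 < volDensity g p y :=
  Real.sqrt_pos.2 (posDef_gram g hy).det_pos

theorem contDiffOn_det_gram (g : Metric n M) (p : M) :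
    ContDiffOn ℝ ∞ (fun y => (gram g p y).det) (extChartAt (𝓡 n) p).target := by
  simp only [Matrix.det_apply]
  refine ContDiffOn.sum fun σ _ => ContDiffOn.const_smul _ ?_
  exact contDiffOn_prod fun i _ => contDiffOn_gram g p _ _

theorem contDiffOn_volDensity (g : Metric n M) (p : M) :
    ContDiffOn ℝ ∞ (volDensity g p) (extChartAt (𝓡 n) p).target :=
  (contDiffOn_det_gram g p).sqrt fun _ hy => (posDef_gram g hy).det_pos.ne'

/-- The coordinate change from the chart at `p` to the chart at `q`. -/
def transition (p q : M) (y : EuclideanSpace ℝ (Fin n)) : EuclideanSpace ℝ (Fin n) :=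
  extChartAt (𝓡 n) q ((extChartAt (𝓡 n) p).symm y)

/-- The domain, in the chart at `p`, of the coordinate change to the chart at `q`. -/
def overlap (n : ℕ) {M : Type*} [TopologicalSpace M] [ChartedSpace (EuclideanSpace ℝ (Fin n)) M]
    (p q : M) : Set (EuclideanSpace ℝ (Fin n)) :=
  (extChartAt (𝓡 n) p).target ∩ (extChartAt (𝓡 n) p).symm ⁻¹' (extChartAt (𝓡 n) q).source

theorem isOpen_overlap (p q : M) : IsOpen (overlap n p q) :=
  (continuousOn_extChartAt_symm p).isOpen_inter_preimage (isOpen_extChartAt_target p)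
    (isOpen_extChartAt_source q)

variable {p q : M} {y : EuclideanSpace ℝ (Fin n)}

theorem transition_mem (hy : y ∈ overlap n p q) : transition p q y ∈ overlap n q p := by
  refine ⟨(extChartAt (𝓡 n) q).map_source hy.2, ?_⟩
  rw [mem_preimage, transition, (extChartAt (𝓡 n) q).left_inv hy.2]
  exact (extChartAt (𝓡 n) p).map_target hy.1

theorem symm_transition (hy : y ∈ overlap n p q) :
    (extChartAt (𝓡 n) q).symm (transition p q y) = (extChartAt (𝓡 n) p).symm y := by
  rw [transition, (extChartAt (𝓡 n) q).left_inv hy.2]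

theorem transition_transition (hy : y ∈ overlap n p q) :
    transition q p (transition p q y) = y := by
  rw [transition, symm_transition hy, (extChartAt (𝓡 n) p).right_inv hy.1]

theorem contDiffOn_transition (p q : M) :
    ContDiffOn ℝ ∞ (transition (n := n) p q) (overlap n p q) := by
  rw [← contMDiffOn_iff_contDiffOn]
  exact (contMDiffOn_chart q).comp ((contMDiffOn_symm p).mono inter_subset_left) fun y hy => hy.2

theorem hasFDerivAt_transition (hy : y ∈ overlap n p q) :
    HasFDerivAt (transition p q) (fderiv ℝ (transition p q) y) y :=
  (((contDiffOn_transition p q).contDiffAt ((isOpen_overlap p q).mem_nhds hy)).differentiableAt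
    (by simp)).hasFDerivAt

theorem injOn_transition (p q : M) : InjOn (transition (n := n) p q) (overlap n p q) :=
  fun y hy y' hy' h => by rw [← transition_transition hy, h, transition_transition hy']

theorem mdifferentiableAt_chart {x : M} (hx : x ∈ (extChartAt (𝓡 n) p).source) :
    MDifferentiableAt (𝓡 n) 𝓘(ℝ, EuclideanSpace ℝ (Fin n)) (extChartAt (𝓡 n) p) x :=
  ((contMDiffOn_chart p).contMDiffAt ((isOpen_extChartAt_source p).mem_nhds hx)).mdifferentiableAt
    (by simp)

theorem fderiv_transition_apply (hy : y ∈ overlap n p q) (v : EuclideanSpace ℝ (Fin n)) :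
    fderiv ℝ (transition p q) y v =
      mfderiv (𝓡 n) 𝓘(ℝ, EuclideanSpace ℝ (Fin n)) (extChartAt (𝓡 n) q)
        ((extChartAt (𝓡 n) p).symm y)
        (mfderiv 𝓘(ℝ, EuclideanSpace ℝ (Fin n)) (𝓡 n) (extChartAt (𝓡 n) p).symm y v) := by
  have h1 := mfderiv_comp y (mdifferentiableAt_chart hy.2) (mdifferentiableAt_symm hy.1)
  rw [mfderiv_eq_fderiv] at h1
  exact DFunLike.congr_fun h1 v

theorem mfderiv_symm_transition (hy : y ∈ overlap n p q) (v : EuclideanSpace ℝ (Fin n)) :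
    (mfderiv 𝓘(ℝ, EuclideanSpace ℝ (Fin n)) (𝓡 n) (extChartAt (𝓡 n) q).symm (transition p q y)
      (fderiv ℝ (transition p q) y v) : EuclideanSpace ℝ (Fin n)) =
    mfderiv 𝓘(ℝ, EuclideanSpace ℝ (Fin n)) (𝓡 n) (extChartAt (𝓡 n) p).symm y v := by
  rw [fderiv_transition_apply hy]
  exact mfderiv_symm_mfderiv_chart hy.2 _

theorem metricForm_transition (g : Metric n M) (hy : y ∈ overlap n p q)
    (v w : EuclideanSpace ℝ (Fin n)) :
    metricForm g q (transition p q y) (fderiv ℝ (transition p q) y v)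
      (fderiv ℝ (transition p q) y w) = metricForm g p y v w := by
  let G : M → EuclideanSpace ℝ (Fin n) → EuclideanSpace ℝ (Fin n) → ℝ := fun x v w => g.inner x v w
  change G ((extChartAt (𝓡 n) q).symm (transition p q y)) _ _ = G _ _ _
  rw [symm_transition hy]
  exact congrArg₂ _ (mfderiv_symm_transition hy v) (mfderiv_symm_transition hy w)

/-- The two Gram matrices are congruent through the Jacobian matrix A of the coordinate change, so
their determinants differ by (det A)². -/
theorem volDensity_transition (g : Metric n M) (hy : y ∈ overlap n p q) :
    volDensity g p y = |(fderiv ℝ (transition p q) y).det| * volDensity g q (transition p q y) := by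
  set A : Matrix (Fin n) (Fin n) ℝ := Matrix.of fun i j =>
    fderiv ℝ (transition p q) y (EuclideanSpace.single j 1) i with hA
  have h1 : gram g p y = A.transpose * gram g q (transition p q y) * A := by
    ext i j
    rw [gram_apply, ← metricForm_transition g hy, metricForm_eq_sum]
    simp only [Matrix.mul_apply, Finset.sum_mul, hA, Matrix.transpose_apply, Matrix.of_apply]
    rw [Finset.sum_comm]
    refine Finset.sum_congr rfl fun i _ => Finset.sum_congr rfl fun j _ => by ring
  have h2 : A.det = (fderiv ℝ (transition p q) y).det := by
    have h3 : A = LinearMap.toMatrix (EuclideanSpace.basisFun (Fin n) ℝ).toBasis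
        (EuclideanSpace.basisFun (Fin n) ℝ).toBasis
        (fderiv ℝ (transition p q) y : EuclideanSpace ℝ (Fin n) →ₗ[ℝ] EuclideanSpace ℝ (Fin n)) := by
      ext i j
      simp [hA, LinearMap.toMatrix_apply]
    rw [h3, LinearMap.det_toMatrix]
  rw [volDensity, volDensity, h1, Matrix.det_mul, Matrix.det_mul, Matrix.det_transpose, ← h2,
    ← Real.sqrt_sq_eq_abs, ← Real.sqrt_mul (sq_nonneg _)]
  congr 1
  ring

end Transformation

/-! ### The Riemannian volume measure. -/

section Volume

theorem measurableSet_inter_preimage_of_continuousOn {X Y : Type*} [TopologicalSpace X]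
    [MeasurableSpace X] [BorelSpace X] [TopologicalSpace Y] [MeasurableSpace Y] [BorelSpace Y]
    {f : X → Y} {s : Set X} (hf : ContinuousOn f s) (hs : MeasurableSet s) {A : Set Y}
    (hA : MeasurableSet A) : MeasurableSet (s ∩ f ⁻¹' A) := by
  have h1 := (continuousOn_iff_continuous_domRestrict.1 hf).measurable hA
  have h2 := MeasurableSet.subtype_image hs h1
  convert h2 using 1
  ext x
  simp [and_comm]

variable {n : ℕ} {M : Type*} [TopologicalSpace M] [ChartedSpace (EuclideanSpace ℝ (Fin n)) M]
  [IsManifold (𝓡 n) ∞ M] [MeasurableSpace M] [BorelSpace M] (g : Metric n M)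

theorem aemeasurable_symm (p : M) :
    AEMeasurable (extChartAt (𝓡 n) p).symm (volume.restrict (extChartAt (𝓡 n) p).target) :=
  (continuousOn_extChartAt_symm p).aemeasurable (isOpen_extChartAt_target p).measurableSet

theorem aemeasurable_volDensity (p : M) :
    AEMeasurable (fun y => ENNReal.ofReal (volDensity g p y))
      (volume.restrict (extChartAt (𝓡 n) p).target) :=
  ((contDiffOn_volDensity g p).continuousOn.aemeasurable
    (isOpen_extChartAt_target p).measurableSet).ennreal_ofReal

theorem chartVolume_apply (p : M) {A : Set M} (hA : MeasurableSet A) :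
    chartVolume g p A = ∫⁻ y in (extChartAt (𝓡 n) p).target ∩ (extChartAt (𝓡 n) p).symm ⁻¹' A,
      ENNReal.ofReal (volDensity g p y) := by
  have hac := withDensity_absolutelyContinuous
    (volume.restrict (extChartAt (𝓡 n) p).target) (fun y => ENNReal.ofReal (volDensity g p y))
  rw [chartVolume, Measure.map_apply_of_aemeasurable ((aemeasurable_symm p).mono_ac hac) hA,
    withDensity_apply₀ _ ((aemeasurable_symm p).nullMeasurable hA), Measure.restrict_restrict₀
      ((aemeasurable_symm p).nullMeasurable hA), inter_comm]

/-- Change of variables: the Jacobian of the transition map is exactly the ratio of the two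
densities. -/
theorem chartVolume_apply_eq (p q : M) {A : Set M} (hA : MeasurableSet A)
    (hAp : A ⊆ (extChartAt (𝓡 n) p).source) (hAq : A ⊆ (extChartAt (𝓡 n) q).source) :
    chartVolume g p A = chartVolume g q A := by
  set B := (extChartAt (𝓡 n) p).target ∩ (extChartAt (𝓡 n) p).symm ⁻¹' A
  have hB : B ⊆ overlap n p q := fun y hy => ⟨hy.1, hAq hy.2⟩
  have hBm : MeasurableSet B := measurableSet_inter_preimage_of_continuousOn
    (continuousOn_extChartAt_symm p) (isOpen_extChartAt_target p).measurableSet hA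
  have himg : (extChartAt (𝓡 n) q).target ∩ (extChartAt (𝓡 n) q).symm ⁻¹' A =
      transition p q '' B := by
    ext y
    constructor
    · rintro ⟨hy1, hy2⟩
      have hy : y ∈ overlap n q p := ⟨hy1, hAp hy2⟩
      refine ⟨transition q p y, ⟨(transition_mem hy).1, ?_⟩, transition_transition hy⟩
      rw [mem_preimage, symm_transition hy]
      exact hy2
    · rintro ⟨z, hz, rfl⟩
      refine ⟨(transition_mem (hB hz)).1, ?_⟩
      rw [mem_preimage, symm_transition (hB hz)]
      exact hz.2
  rw [chartVolume_apply g p hA, chartVolume_apply g q hA, himg,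
    lintegral_image_eq_lintegral_abs_det_fderiv_mul volume hBm
      (fun y hy => (hasFDerivAt_transition (hB hy)).hasFDerivWithinAt)
      ((injOn_transition p q).mono hB)]
  refine setLIntegral_congr_fun hBm fun y hy => ?_
  rw [volDensity_transition g (hB hy), ENNReal.ofReal_mul (abs_nonneg _)]

theorem chartVolume_compl_source (p : M) {A : Set M} (hA : MeasurableSet A)
    (hAp : A ⊆ (extChartAt (𝓡 n) p).sourceᶜ) : chartVolume g p A = 0 := by
  rw [chartVolume_apply g p hA]
  have : (extChartAt (𝓡 n) p).target ∩ (extChartAt (𝓡 n) p).symm ⁻¹' A = ∅ := by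
    ext y
    simp only [mem_inter_iff, mem_preimage, mem_empty_iff_false, iff_false, not_and]
    exact fun hy h => hAp h ((extChartAt (𝓡 n) p).map_target hy)
  rw [this]
  simp

theorem chartVolume_apply_inter_source (p : M) {A : Set M} (hA : MeasurableSet A) :
    chartVolume g p (A ∩ (extChartAt (𝓡 n) p).source) = chartVolume g p A := by
  have hS := (isOpen_extChartAt_source (I := 𝓡 n) p).measurableSet
  rw [← measure_inter_add_sdiff A hS, chartVolume_compl_source g p (hA.diff hS)
    fun x hx => hx.2, add_zero]

theorem restrict_chartVolume_le (p q : M) :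
    (chartVolume g q).restrict (extChartAt (𝓡 n) p).source ≤ chartVolume g p := by
  have hS := (isOpen_extChartAt_source (I := 𝓡 n) p).measurableSet
  have hS' := (isOpen_extChartAt_source (I := 𝓡 n) q).measurableSet
  refine Measure.le_iff.2 fun A hA => ?_
  rw [Measure.restrict_apply hA, ← chartVolume_apply_inter_source g q (hA.inter hS),
    chartVolume_apply_eq g q p ((hA.inter hS).inter hS') inter_subset_right
      (inter_subset_left.trans inter_subset_right)]
  exact measure_mono (inter_subset_left.trans inter_subset_left)

/-- The Riemannian volume restricts to `chartVolume g p` on the domain of the chart at `p`. -/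
theorem restrict_vol (p : M) :
    (vol g).restrict (extChartAt (𝓡 n) p).source = chartVolume g p := by
  set S := (extChartAt (𝓡 n) p).source
  have hS : MeasurableSet S := (isOpen_extChartAt_source (I := 𝓡 n) p).measurableSet
  apply le_antisymm
  · have h1 : vol g ≤ chartVolume g p + (vol g).restrict Sᶜ := by
      refine iSup_le fun q => ?_
      rw [← Measure.restrict_add_restrict_compl (μ := chartVolume g q) hS]
      exact add_le_add (restrict_chartVolume_le g p q)
        (Measure.restrict_mono le_rfl (le_iSup (chartVolume g) q))
    refine (Measure.restrict_mono (le_refl S) h1).trans ?_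
    rw [Measure.restrict_add, Measure.restrict_restrict hS, inter_compl_self,
      Measure.restrict_empty, add_zero]
    exact Measure.restrict_le_self
  · refine Measure.le_iff.2 fun A hA => ?_
    rw [Measure.restrict_apply hA, ← chartVolume_apply_inter_source g p hA]
    exact (le_iSup (chartVolume g) p) _

theorem vol_apply_of_subset (p : M) {A : Set M} (hA : MeasurableSet A)
    (hAp : A ⊆ (extChartAt (𝓡 n) p).source) :
    vol g A = ∫⁻ y in (extChartAt (𝓡 n) p).target ∩ (extChartAt (𝓡 n) p).symm ⁻¹' A,
      ENNReal.ofReal (volDensity g p y) := by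
  rw [← chartVolume_apply g p hA, ← restrict_vol g p, Measure.restrict_apply hA,
    inter_eq_left.2 hAp]

/-- Integrals of functions supported in the domain of a chart, computed in the chart. -/
theorem integral_vol_eq (p : M) {f : M → ℝ} (hf : AEStronglyMeasurable f (vol g))
    (hfp : ∀ x, x ∉ (extChartAt (𝓡 n) p).source → f x = 0) :
    ∫ x, f x ∂(vol g) = ∫ y in (extChartAt (𝓡 n) p).target,
      volDensity g p y * f ((extChartAt (𝓡 n) p).symm y) := by
  have hac := withDensity_absolutelyContinuous
    (volume.restrict (extChartAt (𝓡 n) p).target) (fun y => ENNReal.ofReal (volDensity g p y))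
  rw [← setIntegral_eq_integral_of_forall_compl_eq_zero hfp, restrict_vol]
  have hf' : AEStronglyMeasurable f (chartVolume g p) := by
    rw [← restrict_vol]
    exact hf.restrict
  rw [chartVolume] at hf' ⊢
  rw [integral_map ((aemeasurable_symm p).mono_ac hac) hf',
    integral_withDensity_eq_integral_toReal_smul₀ (aemeasurable_volDensity g p)
      (Eventually.of_forall fun _ => ENNReal.ofReal_lt_top)]
  refine setIntegral_congr_fun (isOpen_extChartAt_target p).measurableSet fun y hy => ?_
  simp only [ENNReal.toReal_ofReal (volDensity_pos g hy).le, smul_eq_mul]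

theorem isLocallyFiniteMeasure_vol : IsLocallyFiniteMeasure (vol g) := by
  refine ⟨fun p => ?_⟩
  have hT := (isOpen_extChartAt_target (I := 𝓡 n) p).mem_nhds (mem_extChartAt_target p)
  obtain ⟨r, hr, hrT⟩ := Metric.nhds_basis_closedBall.mem_iff.1 hT
  set B := Metric.ball (extChartAt (𝓡 n) p p) r
  have hBo : IsOpen ((extChartAt (𝓡 n) p).source ∩ (extChartAt (𝓡 n) p) ⁻¹' B) :=
    (continuousOn_extChartAt p).isOpen_inter_preimage (isOpen_extChartAt_source p)
      Metric.isOpen_ball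
  refine ⟨_, hBo.mem_nhds ⟨mem_extChartAt_source p, Metric.mem_ball_self hr⟩, ?_⟩
  rw [vol_apply_of_subset g p hBo.measurableSet inter_subset_left]
  have hsub : (extChartAt (𝓡 n) p).target ∩ (extChartAt (𝓡 n) p).symm ⁻¹'
      ((extChartAt (𝓡 n) p).source ∩ (extChartAt (𝓡 n) p) ⁻¹' B) ⊆
        Metric.closedBall (extChartAt (𝓡 n) p p) r := by
    rintro y ⟨hy1, -, hy2⟩
    rw [mem_preimage, (extChartAt (𝓡 n) p).right_inv hy1] at hy2
    exact Metric.ball_subset_closedBall hy2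
  refine (lintegral_mono_set hsub).trans_lt ?_
  have hc : IsCompact (Metric.closedBall (extChartAt (𝓡 n) p p) r) := isCompact_closedBall _ _
  obtain ⟨C, hC⟩ := hc.bddAbove_image ((contDiffOn_volDensity g p).continuousOn.mono hrT)
  calc ∫⁻ y in Metric.closedBall (extChartAt (𝓡 n) p p) r, ENNReal.ofReal (volDensity g p y)
      ≤ ∫⁻ y in Metric.closedBall (extChartAt (𝓡 n) p p) r, ENNReal.ofReal C :=
        setLIntegral_mono measurable_const fun y hy =>
          ENNReal.ofReal_le_ofReal (hC (mem_image_of_mem _ hy))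
    _ < ⊤ := by
        rw [setLIntegral_const]
        exact ENNReal.mul_lt_top ENNReal.ofReal_lt_top hc.measure_lt_top

instance isFiniteMeasure_vol [CompactSpace M] : IsFiniteMeasure (vol g) := by
  have := isLocallyFiniteMeasure_vol g
  infer_instance

instance isOpenPosMeasure_vol : (vol g).IsOpenPosMeasure := by
  refine ⟨fun U hU ⟨x, hx⟩ h0 => ?_⟩
  have hS := isOpen_extChartAt_source (I := 𝓡 n) x
  have h1 : vol g (U ∩ (extChartAt (𝓡 n) x).source) = 0 :=
    measure_mono_null inter_subset_left h0
  rw [vol_apply_of_subset g x (hU.inter hS).measurableSet inter_subset_right] at h1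
  set V := (extChartAt (𝓡 n) x).target ∩ (extChartAt (𝓡 n) x).symm ⁻¹'
    (U ∩ (extChartAt (𝓡 n) x).source)
  have hV : IsOpen V := (continuousOn_extChartAt_symm x).isOpen_inter_preimage
    (isOpen_extChartAt_target x) (hU.inter hS)
  have hVne : V.Nonempty := ⟨extChartAt (𝓡 n) x x, mem_extChartAt_target x, by
    rw [mem_preimage, extChartAt_to_inv x]
    exact ⟨hx, mem_extChartAt_source x⟩⟩
  rw [lintegral_eq_zero_iff' ((aemeasurable_volDensity g x).mono_measure
    (Measure.restrict_mono inter_subset_left le_rfl)),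
    EventuallyEq, ae_restrict_iff' hV.measurableSet] at h1
  have h2 : volume V = 0 := by
    refine measure_mono_null (fun y hy => ?_) h1
    simp only [mem_compl_iff, mem_ofPred_eq, Classical.not_imp]
    refine ⟨hy, ?_⟩
    have := volDensity_pos g hy.1
    simpa using this
  exact (hV.measure_pos volume hVne).ne' h2

end Volume

/-! ### The divergence theorem for compact supports in Euclidean space. -/

section EuclideanIntegration

variable {n : ℕ}

/-- Integration by parts against the constant function 1. -/
theorem integral_pd_eq_zero {H : EuclideanSpace ℝ (Fin n) → ℝ} (hH : ContDiff ℝ 1 H)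
    (hc : HasCompactSupport H) (i : Fin n) : ∫ y, pd i H y = 0 := by
  have hint : Integrable fun y => pd i H y :=
    ((hH.continuous_fderiv (by simp)).clm_apply continuous_const).integrable_of_hasCompactSupport
      (hc.fderiv_apply (𝕜 := ℝ) _)
  have h := integral_mul_fderiv_eq_neg_fderiv_mul_of_integrable (μ := volume)
    (f := fun _ : EuclideanSpace ℝ (Fin n) => (1 : ℝ)) (g := H)
    (v := EuclideanSpace.single i (1 : ℝ)) (by simp) (by simpa [pd] using hint)
    (by simpa using hH.continuous.integrable_of_hasCompactSupport hc)
    (fun _ _ => differentiableAt_const _) (fun x _ => hH.differentiable (by simp) x)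
  simpa [pd] using h

theorem contDiff_indicator {V K : Set (EuclideanSpace ℝ (Fin n))} (hV : IsOpen V) (hK : IsClosed K)
    (hKV : K ⊆ V) {h : EuclideanSpace ℝ (Fin n) → ℝ} (hh : ContDiffOn ℝ ∞ h V)
    (h0 : ∀ y ∈ V, y ∉ K → h y = 0) : ContDiff ℝ ∞ (V.indicator h) := by
  rw [contDiff_iff_contDiffAt]
  intro y
  by_cases hy : y ∈ K
  · refine (hh.contDiffAt (hV.mem_nhds (hKV hy))).congr_of_eventuallyEq ?_
    filter_upwards [hV.mem_nhds (hKV hy)] with z hz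
    rw [indicator_of_mem hz]
  · refine (contDiffAt_const (c := (0 : ℝ))).congr_of_eventuallyEq ?_
    filter_upwards [hK.isOpen_compl.mem_nhds hy] with z hz
    by_cases hzV : z ∈ V
    · rw [indicator_of_mem hzV, h0 z hzV hz]
    · rw [indicator_of_notMem hzV]

theorem hasCompactSupport_indicator {V K : Set (EuclideanSpace ℝ (Fin n))} (hK : IsCompact K)
    {h : EuclideanSpace ℝ (Fin n) → ℝ} (h0 : ∀ y ∈ V, y ∉ K → h y = 0) :
    HasCompactSupport (V.indicator h) :=
  HasCompactSupport.intro hK fun y hy => by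
    by_cases hyV : y ∈ V
    · rw [indicator_of_mem hyV, h0 y hyV hy]
    · rw [indicator_of_notMem hyV]

theorem setIntegral_sum_pd_eq_zero {V K : Set (EuclideanSpace ℝ (Fin n))} (hV : IsOpen V)
    (hK : IsCompact K) (hKV : K ⊆ V) {h : Fin n → EuclideanSpace ℝ (Fin n) → ℝ}
    (hh : ∀ i, ContDiffOn ℝ ∞ (h i) V) (h0 : ∀ i, ∀ y ∈ V, y ∉ K → h i y = 0) :
    ∫ y in V, ∑ i, pd i (h i) y = 0 := by
  have hsm : ∀ i, ContDiff ℝ ∞ (V.indicator (h i)) := fun i =>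
    contDiff_indicator hV hK.isClosed hKV (hh i) (h0 i)
  have hcs : ∀ i, HasCompactSupport (V.indicator (h i)) := fun i =>
    hasCompactSupport_indicator hK (h0 i)
  have h1 : ∀ i, ∀ y ∈ V, pd i (h i) y = pd i (V.indicator (h i)) y := by
    intro i y hy
    rw [pd, pd]
    congr 1
    refine Filter.EventuallyEq.fderiv_eq ?_
    filter_upwards [hV.mem_nhds hy] with z hz
    rw [indicator_of_mem hz]
  have h2 : ∀ i, ∀ y ∉ V, pd i (V.indicator (h i)) y = 0 := by
    intro i y hy
    have : y ∉ tsupport (V.indicator (h i)) := by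
      intro hy'
      refine hy (hKV (closure_minimal ?_ hK.isClosed hy'))
      intro z hz
      by_contra hzK
      refine hz ?_
      by_cases hzV : z ∈ V
      · rw [indicator_of_mem hzV, h0 i z hzV hzK]
      · rw [indicator_of_notMem hzV]
    rw [pd, fderiv_of_notMem_tsupport (𝕜 := ℝ) this]
    rfl
  rw [setIntegral_congr_fun hV.measurableSet
    (g := fun y => ∑ i, pd i (V.indicator (h i)) y) fun y hy =>
      Finset.sum_congr rfl fun i _ => h1 i y hy]
  rw [setIntegral_eq_integral_of_forall_compl_eq_zero fun y hy =>
    Finset.sum_eq_zero fun i _ => h2 i y hy, integral_finsetSum]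
  · exact Finset.sum_eq_zero fun i _ => integral_pd_eq_zero ((hsm i).of_le (by simp)) (hcs i) i
  · intro i _
    exact (((hsm i).continuous_fderiv (by simp)).clm_apply
      continuous_const).integrable_of_hasCompactSupport ((hcs i).fderiv_apply (𝕜 := ℝ) _)

end EuclideanIntegration

/-! ### Divergence in a chart, integration by parts, chart independence. -/

section LocalDivergence

variable {n : ℕ} {M : Type*} [TopologicalSpace M] [ChartedSpace (EuclideanSpace ℝ (Fin n)) M]
  [IsManifold (𝓡 n) ∞ M]

/-- The divergence of `u`, computed in the chart at `p`. -/
def divRep (g : Metric n M) (u : VField n M) (p : M) (y : EuclideanSpace ℝ (Fin n)) : ℝ :=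
  (volDensity g p y)⁻¹ * ∑ i, pd i (fun y => volDensity g p y * comp u p i y) y

theorem divergence_eq_divRep_self (g : Metric n M) (u : VField n M) (p : M) :
    divergence g u p = divRep g u p (extChartAt (𝓡 n) p p) := rfl

theorem contDiffOn_comp_time {J : Set ℝ} {u : ℝ → VField n M} (hu : SmoothTimeField J u) (p : M)
    (i : Fin n) : ContDiffOn ℝ ∞ (fun z : ℝ × EuclideanSpace ℝ (Fin n) => comp (u z.1) p i z.2)
      (J ×ˢ (extChartAt (𝓡 n) p).target) :=
  (contDiff_coord i).comp_contDiffOn (smoothTimeField_iff.1 hu p)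

theorem contDiffOn_fieldRep {u : VField n M} (hu : SmoothField u) (p : M) :
    ContDiffOn ℝ ∞ (fieldRep u p) (extChartAt (𝓡 n) p).target :=
  (smoothTimeField_iff.1 (smoothTimeField_const (J := univ) hu) p).comp
    (contDiff_const (c := (0 : ℝ)).prodMk contDiff_id).contDiffOn fun _ hy => ⟨mem_univ _, hy⟩

theorem contDiffOn_comp {u : VField n M} (hu : SmoothField u) (p : M) (i : Fin n) :
    ContDiffOn ℝ ∞ (comp u p i) (extChartAt (𝓡 n) p).target :=
  (contDiff_coord i).comp_contDiffOn (contDiffOn_fieldRep hu p)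

theorem contDiffOn_divRep_time (g : Metric n M) {J : Set ℝ} (hJ : UniqueDiffOn ℝ J)
    {u : ℝ → VField n M} (hu : SmoothTimeField J u) (p : M) :
    ContDiffOn ℝ ∞ (fun z : ℝ × EuclideanSpace ℝ (Fin n) => divRep g (u z.1) p z.2)
      (J ×ˢ (extChartAt (𝓡 n) p).target) := by
  have hρ : ContDiffOn ℝ ∞ (fun z : ℝ × EuclideanSpace ℝ (Fin n) => volDensity g p z.2)
      (J ×ˢ (extChartAt (𝓡 n) p).target) :=
    (contDiffOn_volDensity g p).comp contDiff_snd.contDiffOn fun z hz => hz.2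
  refine (hρ.inv fun z hz => (volDensity_pos g hz.2).ne').mul (ContDiffOn.sum fun i _ => ?_)
  exact contDiffOn_fderiv_slice hJ (isOpen_extChartAt_target p)
    (F := fun t y => volDensity g p y * comp (u t) p i y)
    (hρ.mul (contDiffOn_comp_time hu p i)) contDiffOn_const

theorem contDiffOn_divRep (g : Metric n M) {u : VField n M} (hu : SmoothField u) (p : M) :
    ContDiffOn ℝ ∞ (divRep g u p) (extChartAt (𝓡 n) p).target :=
  ContDiffOn.comp (g := fun z : ℝ × EuclideanSpace ℝ (Fin n) => divRep g u p z.2)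
    (f := fun y => ((0 : ℝ), y))
    (contDiffOn_divRep_time g uniqueDiffOn_univ (smoothTimeField_const (J := univ) hu) p)
    (contDiff_const.prodMk contDiff_id).contDiffOn fun _ hy => ⟨mem_univ _, hy⟩

/-- The product rule for the divergence in a chart. -/
theorem sum_pd_mul_eq (g : Metric n M) {u : VField n M} (hu : SmoothField u) {f : M → ℝ}
    (hf : ContMDiff (𝓡 n) 𝓘(ℝ, ℝ) ∞ f) {p : M} {y : EuclideanSpace ℝ (Fin n)}
    (hy : y ∈ (extChartAt (𝓡 n) p).target) :
    ∑ i, pd i (fun y => f ((extChartAt (𝓡 n) p).symm y) * (volDensity g p y * comp u p i y)) y =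
      volDensity g p y * (f ((extChartAt (𝓡 n) p).symm y) * divRep g u p y
        + dirDeriv f ((extChartAt (𝓡 n) p).symm y) (u ((extChartAt (𝓡 n) p).symm y))) := by
  have hT := (isOpen_extChartAt_target (I := 𝓡 n) p).mem_nhds hy
  have hf' : DifferentiableAt ℝ (fun z => f ((extChartAt (𝓡 n) p).symm z)) y := by
    have h1 := (hf.comp_contMDiffOn (contMDiffOn_symm p)).contDiffOn
    exact (h1.contDiffAt hT).differentiableAt (by simp)
  have hd : ∀ i, DifferentiableAt ℝ (fun y => volDensity g p y * comp u p i y) y := fun i =>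
    (((contDiffOn_volDensity g p).mul (contDiffOn_comp hu p i)).contDiffAt hT).differentiableAt
      (by simp)
  have h1 : ∀ i, pd i (fun y => f ((extChartAt (𝓡 n) p).symm y) *
      (volDensity g p y * comp u p i y)) y =
      f ((extChartAt (𝓡 n) p).symm y) * pd i (fun y => volDensity g p y * comp u p i y) y +
      volDensity g p y * (comp u p i y * pd i (fun z => f ((extChartAt (𝓡 n) p).symm z)) y) := by
    intro i
    rw [pd, fderiv_fun_mul hf' (hd i)]
    simp only [add_apply, smul_apply, smul_eq_mul, pd]
    ring
  have h2 : dirDeriv f ((extChartAt (𝓡 n) p).symm y) (u ((extChartAt (𝓡 n) p).symm y)) =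
      ∑ i, comp u p i y * pd i (fun z => f ((extChartAt (𝓡 n) p).symm z)) y := by
    rw [dirDeriv_eq_fderiv hy (hf.mdifferentiableAt (by simp))]
    change fderiv ℝ _ y (fieldRep u p y) = _
    conv_lhs => rw [← sum_smul_single (fieldRep u p y)]
    simp only [map_sum, map_smul, smul_eq_mul]
    rfl
  rw [h2, Finset.sum_congr rfl fun i _ => h1 i, Finset.sum_add_distrib, ← Finset.mul_sum,
    ← Finset.mul_sum, divRep]
  have := (volDensity_pos g hy).ne'
  field_simp

variable [T2Space M]

theorem exists_bump {x : M} {U : Set M} (hU : U ∈ 𝓝 x) :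
    ∃ f : M → ℝ, ContMDiff (𝓡 n) 𝓘(ℝ, ℝ) ∞ f ∧ (∀ y, 0 ≤ f y) ∧ f =ᶠ[𝓝 x] 1 ∧ tsupport f ⊆ U := by
  obtain ⟨f, -, hf⟩ := (SmoothBumpFunction.nhds_basis_tsupport (I := 𝓡 n) x).mem_iff.1 hU
  exact ⟨f, f.contMDiff, fun y => f.nonneg, f.eventuallyEq_one, hf⟩

variable [CompactSpace M] [MeasurableSpace M] [BorelSpace M]

/-- The integrand is div(f u), and its product with the density is a sum of partial derivatives of
functions compactly supported in the chart. Outside the chart the coordinate divergence has no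
meaning, but there f vanishes. -/
theorem integral_chart_eq_zero (g : Metric n M) {u : VField n M} (hu : SmoothField u) {f : M → ℝ}
    (hf : ContMDiff (𝓡 n) 𝓘(ℝ, ℝ) ∞ f) {p : M} (hfp : tsupport f ⊆ (extChartAt (𝓡 n) p).source) :
    ∫ x, (f x * divRep g u p (extChartAt (𝓡 n) p x) + dirDeriv f x (u x)) ∂(vol g) = 0 := by
  have hdir : Continuous fun x => dirDeriv f x (u x) :=
    (((smoothFun_const (J := univ) hf).dirDeriv uniqueDiffOn_univ
      (smoothTimeField_const hu)).contMDiff (mem_univ 0)).continuous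
  have hS := isOpen_extChartAt_source (I := 𝓡 n) p
  have hcont : Continuous fun x => f x * divRep g u p (extChartAt (𝓡 n) p x) := by
    refine continuous_of_tsupport fun x hx => ?_
    have hx' := hfp (tsupport_mul_subset_left hx)
    refine hf.continuous.continuousAt.mul ?_
    exact ((contDiffOn_divRep g hu p).continuousOn.comp (continuousOn_extChartAt p)
      (fun z hz => (extChartAt (𝓡 n) p).map_source hz)).continuousAt (hS.mem_nhds hx')
  have hdir0 : ∀ x, x ∉ tsupport f → dirDeriv f x (u x) = 0 := by
    intro x hx
    have : f =ᶠ[𝓝 x] fun _ => (0 : ℝ) := notMem_tsupport_iff_eventuallyEq.1 hx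
    rw [dirDeriv, this.mfderiv_eq, mfderiv_const]
    rfl
  have hadd : Continuous fun x => f x * divRep g u p (extChartAt (𝓡 n) p x) + dirDeriv f x (u x) :=
    hcont.add hdir
  rw [integral_vol_eq g p hadd.aestronglyMeasurable]
  · rw [← setIntegral_sum_pd_eq_zero (isOpen_extChartAt_target (I := 𝓡 n) p)
      (K := extChartAt (𝓡 n) p '' tsupport f)
      (h := fun i y => f ((extChartAt (𝓡 n) p).symm y) * (volDensity g p y * comp u p i y))]
    · refine setIntegral_congr_fun (isOpen_extChartAt_target p).measurableSet fun y hy => ?_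
      simp only [sum_pd_mul_eq g hu hf hy, (extChartAt (𝓡 n) p).right_inv hy]
    · exact (isClosed_tsupport f).isCompact.image_of_continuousOn
        ((continuousOn_extChartAt p).mono hfp)
    · rintro _ ⟨x, hx, rfl⟩
      exact (extChartAt (𝓡 n) p).map_source (hfp hx)
    · intro i
      exact (hf.comp_contMDiffOn (contMDiffOn_symm p)).contDiffOn.mul
        ((contDiffOn_volDensity g p).mul (contDiffOn_comp hu p i))
    · intro i y hy hyK
      have : f ((extChartAt (𝓡 n) p).symm y) = 0 := by
        by_contra h
        exact hyK ⟨_, subset_tsupport f h, (extChartAt (𝓡 n) p).right_inv hy⟩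
      rw [this, zero_mul]
  · intro x hx
    have hx' : x ∉ tsupport f := fun h => hx (hfp h)
    rw [hdir0 x hx', image_eq_zero_of_notMem_tsupport hx', zero_mul, add_zero]

/-- The fundamental lemma of the calculus of variations on an open subset of `M`. -/
theorem eq_zero_of_forall_integral_mul_eq_zero (g : Metric n M) {U : Set M} (hU : IsOpen U)
    {h : M → ℝ} (hh : ContinuousOn h U)
    (h0 : ∀ f : M → ℝ, ContMDiff (𝓡 n) 𝓘(ℝ, ℝ) ∞ f → tsupport f ⊆ U →
      ∫ x, f x * h x ∂(vol g) = 0) {x : M} (hx : x ∈ U) : h x = 0 := by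
  by_contra hne
  have hev : {y | y ∈ U ∧ 0 < h x * h y} ∈ 𝓝 x := by
    have h1 : ContinuousAt (fun y => h x * h y) x :=
      continuousAt_const.mul (hh.continuousAt (hU.mem_nhds hx))
    filter_upwards [hU.mem_nhds hx, h1.eventually (lt_mem_nhds (mul_self_pos.2 hne))] with y hy hy'
    exact ⟨hy, hy'⟩
  obtain ⟨f, hf, hf0, hf1, hfU⟩ := exists_bump (n := n) hev
  have hcont : Continuous fun y => f y * h y := by
    refine continuous_of_tsupport fun y hy => ?_
    exact hf.continuous.continuousAt.mul
      (hh.continuousAt (hU.mem_nhds (hfU (tsupport_mul_subset_left hy)).1))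
  have hpos : 0 < ∫ y, h x * (f y * h y) ∂(vol g) := by
    refine (continuous_const.mul hcont).integral_pos_of_hasCompactSupport_nonneg_nonzero (x := x)
      (HasCompactSupport.of_compactSpace _) (fun y => ?_) ?_
    · by_cases hy : y ∈ tsupport f
      · have := (hfU hy).2
        have := mul_nonneg (hf0 y) this.le
        change 0 ≤ h x * (f y * h y)
        linarith
      · change 0 ≤ h x * (f y * h y)
        rw [image_eq_zero_of_notMem_tsupport hy]
        simp
    · rw [hf1.eq_of_nhds]
      simpa using hne
  rw [integral_const_mul, h0 f hf (hfU.trans fun y hy => hy.1), mul_zero] at hpos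
  exact lt_irrefl _ hpos

theorem integral_mul_divRep (g : Metric n M) {u : VField n M} (hu : SmoothField u) {f : M → ℝ}
    (hf : ContMDiff (𝓡 n) 𝓘(ℝ, ℝ) ∞ f) {p : M} (hfp : tsupport f ⊆ (extChartAt (𝓡 n) p).source) :
    ∫ x, f x * divRep g u p (extChartAt (𝓡 n) p x) ∂(vol g) = -∫ x, dirDeriv f x (u x) ∂(vol g) := by
  have hdir : Continuous fun x => dirDeriv f x (u x) :=
    (((smoothFun_const (J := univ) hf).dirDeriv uniqueDiffOn_univ
      (smoothTimeField_const hu)).contMDiff (mem_univ 0)).continuous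
  have hcont : Continuous fun x => f x * divRep g u p (extChartAt (𝓡 n) p x) := by
    refine continuous_of_tsupport fun x hx => ?_
    have hx' := hfp (tsupport_mul_subset_left hx)
    refine hf.continuous.continuousAt.mul ?_
    exact ((contDiffOn_divRep g hu p).continuousOn.comp (continuousOn_extChartAt p)
      (fun z hz => (extChartAt (𝓡 n) p).map_source hz)).continuousAt
        ((isOpen_extChartAt_source p).mem_nhds hx')
  have h := integral_chart_eq_zero g hu hf hfp
  rw [integral_add (hcont.integrable_of_hasCompactSupport (HasCompactSupport.of_compactSpace _))
    (hdir.integrable_of_hasCompactSupport (HasCompactSupport.of_compactSpace _))] at h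
  linarith

/-- The divergence can be computed in any chart. -/
theorem divergence_eq_divRep (g : Metric n M) {u : VField n M} (hu : SmoothField u) {p x : M}
    (hx : x ∈ (extChartAt (𝓡 n) p).source) :
    divergence g u x = divRep g u p (extChartAt (𝓡 n) p x) := by
  have hcont : ∀ q : M, ContinuousOn (fun z => divRep g u q (extChartAt (𝓡 n) q z))
      (extChartAt (𝓡 n) q).source := fun q =>
    (contDiffOn_divRep g hu q).continuousOn.comp (continuousOn_extChartAt q)
      (fun z hz => (extChartAt (𝓡 n) q).map_source hz)
  -- Both chart expressions satisfy the same integration by parts identity, whose right-hand side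
  -- involves no chart. The variational lemma then replaces a coordinate computation.
  have h := eq_zero_of_forall_integral_mul_eq_zero g (x := x)
    (U := (extChartAt (𝓡 n) x).source ∩ (extChartAt (𝓡 n) p).source)
    (h := fun z => divRep g u x (extChartAt (𝓡 n) x z) - divRep g u p (extChartAt (𝓡 n) p z))
    ((isOpen_extChartAt_source x).inter (isOpen_extChartAt_source p))
    (((hcont x).mono inter_subset_left).sub ((hcont p).mono inter_subset_right)) ?_
    ⟨mem_extChartAt_source x, hx⟩
  · rw [divergence_eq_divRep_self]
    exact sub_eq_zero.1 h
  · intro f hf hfU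
    have hint : ∀ q : M, tsupport f ⊆ (extChartAt (𝓡 n) q).source →
        Integrable (fun z => f z * divRep g u q (extChartAt (𝓡 n) q z)) (vol g) := by
      intro q hq
      refine Continuous.integrable_of_hasCompactSupport ?_ (HasCompactSupport.of_compactSpace _)
      refine continuous_of_tsupport fun z hz => ?_
      exact hf.continuous.continuousAt.mul ((hcont q).continuousAt
        ((isOpen_extChartAt_source q).mem_nhds (hq (tsupport_mul_subset_left hz))))
    simp only [mul_sub]
    rw [integral_sub (hint x (hfU.trans inter_subset_left)) (hint p (hfU.trans inter_subset_right)),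
      integral_mul_divRep g hu hf (hfU.trans inter_subset_left),
      integral_mul_divRep g hu hf (hfU.trans inter_subset_right), sub_self]

theorem smoothFun_divergence (g : Metric n M) {J : Set ℝ} (hJ : UniqueDiffOn ℝ J)
    {u : ℝ → VField n M} (hu : SmoothTimeField J u) :
    SmoothFun (n := n) J fun t => divergence g (u t) := by
  rw [smoothFun_iff]
  intro p
  refine (contDiffOn_divRep_time g hJ hu p).congr fun z hz => ?_
  rw [divergence_eq_divRep g (hu.smoothField hz.1) ((extChartAt (𝓡 n) p).map_target hz.2),
    (extChartAt (𝓡 n) p).right_inv hz.2]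

theorem contMDiff_divergence (g : Metric n M) {u : VField n M} (hu : SmoothField u) :
    ContMDiff (𝓡 n) 𝓘(ℝ, ℝ) ∞ (divergence g u) :=
  (smoothFun_divergence g uniqueDiffOn_univ (smoothTimeField_const (J := univ) hu)).contMDiff
    (mem_univ 0)

end LocalDivergence

/-! ### The divergence characterised by duality, and its algebraic rules. -/

section WeakDivergence

variable {n : ℕ} {M : Type*} [TopologicalSpace M] [ChartedSpace (EuclideanSpace ℝ (Fin n)) M]
  [IsManifold (𝓡 n) ∞ M]

theorem dirDeriv_fun_add {f h : M → ℝ} {x : M} (hf : MDifferentiableAt (𝓡 n) 𝓘(ℝ, ℝ) f x)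
    (hh : MDifferentiableAt (𝓡 n) 𝓘(ℝ, ℝ) h x) (v : TangentSpace (𝓡 n) x) :
    dirDeriv (fun y => f y + h y) x v = dirDeriv f x v + dirDeriv h x v := by
  have := (hf.hasMFDerivAt.add hh.hasMFDerivAt).mfderiv
  exact DFunLike.congr_fun this v

theorem dirDeriv_const (c : ℝ) (x : M) (v : TangentSpace (𝓡 n) x) :
    dirDeriv (fun _ : M => c) x v = 0 := by
  rw [dirDeriv, mfderiv_const]
  rfl

theorem dirDeriv_congr {f h : M → ℝ} {x : M} (hfh : f =ᶠ[𝓝 x] h) (v : TangentSpace (𝓡 n) x) :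
    dirDeriv f x v = dirDeriv h x v := by
  rw [dirDeriv, dirDeriv, hfh.mfderiv_eq]
  rfl

theorem dirDeriv_sum {ι : Type*} (s : Finset ι) {f : ι → M → ℝ} {x : M}
    (hf : ∀ i ∈ s, MDifferentiableAt (𝓡 n) 𝓘(ℝ, ℝ) (f i) x) (v : TangentSpace (𝓡 n) x) :
    dirDeriv (fun y => ∑ i ∈ s, f i y) x v = ∑ i ∈ s, dirDeriv (f i) x v := by
  have key : ∀ t : Finset ι, t ⊆ s → MDifferentiableAt (𝓡 n) 𝓘(ℝ, ℝ) (fun y => ∑ i ∈ t, f i y) x ∧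
      dirDeriv (fun y => ∑ i ∈ t, f i y) x v = ∑ i ∈ t, dirDeriv (f i) x v := by
    classical
    intro t
    induction t using Finset.induction_on with
    | empty =>
      intro _
      simp only [Finset.sum_empty]
      exact ⟨mdifferentiableAt_const, dirDeriv_const 0 x v⟩
    | insert a t ha ih =>
      intro hs
      obtain ⟨h1, h2⟩ := ih ((Finset.subset_insert a t).trans hs)
      have h3 := hf a (hs (Finset.mem_insert_self a t))
      simp only [Finset.sum_insert ha]
      exact ⟨h3.add h1, by rw [dirDeriv_fun_add h3 h1, h2]⟩
  exact (key s subset_rfl).2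

theorem continuous_dirDeriv {f : M → ℝ} (hf : ContMDiff (𝓡 n) 𝓘(ℝ, ℝ) ∞ f) {u : VField n M}
    (hu : SmoothField u) : Continuous fun x => dirDeriv f x (u x) :=
  (((smoothFun_const (J := univ) hf).dirDeriv uniqueDiffOn_univ
    (smoothTimeField_const hu)).contMDiff (mem_univ 0)).continuous

theorem contMDiff_dirDeriv {f : M → ℝ} (hf : ContMDiff (𝓡 n) 𝓘(ℝ, ℝ) ∞ f) {u : VField n M}
    (hu : SmoothField u) : ContMDiff (𝓡 n) 𝓘(ℝ, ℝ) ∞ fun x => dirDeriv f x (u x) :=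
  ((smoothFun_const (J := univ) hf).dirDeriv uniqueDiffOn_univ
    (smoothTimeField_const hu)).contMDiff (mem_univ 0)

theorem SmoothField.add {u v : VField n M} (hu : SmoothField u) (hv : SmoothField v) :
    SmoothField fun x => u x + v x :=
  ((smoothTimeField_const (J := univ) hu).add (smoothTimeField_const hv)).smoothField (mem_univ 0)

theorem SmoothField.smul {f : M → ℝ} (hf : ContMDiff (𝓡 n) 𝓘(ℝ, ℝ) ∞ f) {u : VField n M}
    (hu : SmoothField u) : SmoothField fun x => f x • u x :=
  ((smoothTimeField_const (J := univ) hu).smul (smoothFun_const hf)).smoothField (mem_univ 0)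

variable [T2Space M]

/-- The coordinates of a chart coincide locally with smooth functions on `M`. -/
theorem exists_coord {p x : M} (hx : x ∈ (extChartAt (𝓡 n) p).source) (i : Fin n) :
    ∃ f : M → ℝ, ContMDiff (𝓡 n) 𝓘(ℝ, ℝ) ∞ f ∧ ∀ᶠ y in 𝓝 x, f y = extChartAt (𝓡 n) p y i := by
  obtain ⟨χ, hχ, -, hχ1, hχs⟩ := exists_bump (n := n) ((isOpen_extChartAt_source p).mem_nhds hx)
  refine ⟨fun y => χ y * extChartAt (𝓡 n) p y i, ?_, ?_⟩
  · refine contMDiff_of_tsupport fun y hy => ?_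
    refine hχ.contMDiffAt.mul ?_
    exact ((contDiff_coord i).contMDiff.comp_contMDiffOn (contMDiffOn_chart p)).contMDiffAt
      ((isOpen_extChartAt_source p).mem_nhds (hχs (tsupport_mul_subset_left hy)))
  · filter_upwards [hχ1] with y hy
    rw [hy, Pi.one_apply, one_mul]

theorem dirDeriv_eq_mfderiv_chart {f : M → ℝ} {p x : M} {i : Fin n}
    (hx : x ∈ (extChartAt (𝓡 n) p).source)
    (hf : ∀ᶠ y in 𝓝 x, f y = extChartAt (𝓡 n) p y i) (v : TangentSpace (𝓡 n) x) :
    dirDeriv f x v =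
      (show EuclideanSpace ℝ (Fin n) from
        mfderiv (𝓡 n) 𝓘(ℝ, EuclideanSpace ℝ (Fin n)) (extChartAt (𝓡 n) p) x v) i := by
  rw [dirDeriv_congr hf]
  have h1 := ((EuclideanSpace.proj (𝕜 := ℝ) i).hasFDerivAt.hasMFDerivAt.comp x
    (mdifferentiableAt_chart hx).hasMFDerivAt).mfderiv
  exact DFunLike.congr_fun h1 v

theorem eq_of_forall_dirDeriv {x : M} {v w : TangentSpace (𝓡 n) x}
    (h : ∀ f : M → ℝ, ContMDiff (𝓡 n) 𝓘(ℝ, ℝ) ∞ f → dirDeriv f x v = dirDeriv f x w) : v = w := by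
  have hx := mem_extChartAt_source (I := 𝓡 n) x
  rw [← mfderiv_symm_mfderiv_chart hx v, ← mfderiv_symm_mfderiv_chart hx w]
  congr 1
  refine PiLp.ext fun i => ?_
  obtain ⟨f, hf, hfx⟩ := exists_coord hx i
  exact (dirDeriv_eq_mfderiv_chart hx hfx v).symm.trans
    ((h f hf).trans (dirDeriv_eq_mfderiv_chart hx hfx w))

/-- A time-dependent vector field is smooth if it is smooth as a derivation. -/
theorem smoothTimeField_of_dirDeriv {J : Set ℝ} {u : ℝ → VField n M}
    (h : ∀ f : M → ℝ, ContMDiff (𝓡 n) 𝓘(ℝ, ℝ) ∞ f →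
      SmoothFun (n := n) J fun t x => dirDeriv f x (u t x)) : SmoothTimeField J u := by
  rw [smoothTimeField_iff]
  rintro p ⟨t, y⟩ ⟨ht, hy⟩
  rw [contDiffWithinAt_euclidean]
  intro i
  have hx := (extChartAt (𝓡 n) p).map_target hy
  obtain ⟨f, hf, hfx⟩ := exists_coord hx i
  have hT := (isOpen_extChartAt_target (I := 𝓡 n) p).mem_nhds hy
  refine (smoothFun_iff.1 (h f hf) p (t, y) ⟨ht, hy⟩).congr_of_eventuallyEq ?_ ?_
  · refine mem_nhdsWithin_of_mem_nhds ?_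
    have h1 : ∀ᶠ z in 𝓝 y, ∀ᶠ x in 𝓝 ((extChartAt (𝓡 n) p).symm z),
        f x = extChartAt (𝓡 n) p x i :=
      ((continuousOn_extChartAt_symm p).continuousAt hT).eventually hfx.eventually_nhds
    have h2 := h1.and hT
    have h3 : Tendsto (Prod.snd : ℝ × EuclideanSpace ℝ (Fin n) → _) (𝓝 (t, y)) (𝓝 y) :=
      continuous_snd.tendsto _
    filter_upwards [h3.eventually h2] with z hz
    exact (dirDeriv_eq_mfderiv_chart ((extChartAt (𝓡 n) p).map_target hz.2) hz.1 _).symm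
  · exact (dirDeriv_eq_mfderiv_chart hx hfx _).symm

variable [CompactSpace M]

/-- Smooth partitions of unity on a compact manifold. -/
theorem exists_partition {U : M → Set M} (hU : ∀ x, U x ∈ 𝓝 x) :
    ∃ (s : Finset M) (χ : M → M → ℝ), (∀ i, ContMDiff (𝓡 n) 𝓘(ℝ, ℝ) ∞ (χ i)) ∧
      (∀ i, tsupport (χ i) ⊆ U i) ∧ ∀ x, ∑ i ∈ s, χ i x = 1 := by
  choose f hf hf0 hf1 hfU using fun x => exists_bump (n := n) (hU x)
  obtain ⟨s, hs⟩ := isCompact_univ.elim_nhds_subcover (fun x => {y | f x y = 1})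
    (fun x _ => (hf1 x))
  have hpos : ∀ x, 0 < ∑ i ∈ s, f i x := by
    intro x
    obtain ⟨i, hi, hx⟩ := mem_iUnion₂.1 (hs.2 (mem_univ x))
    exact Finset.sum_pos' (fun j _ => hf0 j x) ⟨i, hi, by rw [show f i x = 1 from hx]; norm_num⟩
  have hS : ContMDiff (𝓡 n) 𝓘(ℝ, ℝ) ∞ fun x => (∑ i ∈ s, f i x)⁻¹ := fun x =>
    (contDiffAt_inv ℝ (hpos x).ne').contMDiffAt.comp x (contMDiff_finsetSum (fun i _ => hf i) x)
  refine ⟨s, fun i x => f i x * (∑ i ∈ s, f i x)⁻¹, fun i => (hf i).mul hS, fun i =>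
    tsupport_mul_subset_left.trans (hfU i), fun x => ?_⟩
  rw [← Finset.sum_mul, mul_inv_cancel₀ (hpos x).ne']

variable [MeasurableSpace M] [BorelSpace M]

theorem integrable_vol (g : Metric n M) {f : M → ℝ} (hf : Continuous f) : Integrable f (vol g) :=
  hf.integrable_of_hasCompactSupport (HasCompactSupport.of_compactSpace _)

/-- A partition of unity reduces the identity to test functions supported in a chart. -/
theorem integral_mul_divergence (g : Metric n M) {u : VField n M} (hu : SmoothField u) {f : M → ℝ}
    (hf : ContMDiff (𝓡 n) 𝓘(ℝ, ℝ) ∞ f) :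
    ∫ x, f x * divergence g u x ∂(vol g) = -∫ x, dirDeriv f x (u x) ∂(vol g) := by
  obtain ⟨s, χ, hχ, hχU, hχ1⟩ := exists_partition (n := n)
    (fun p : M => extChartAt_source_mem_nhds (I := 𝓡 n) p)
  have hχf : ∀ i, ContMDiff (𝓡 n) 𝓘(ℝ, ℝ) ∞ fun x => χ i x * f x := fun i => (hχ i).mul hf
  have hd := (contMDiff_divergence g hu).continuous
  have h1 : ∀ x, f x = ∑ i ∈ s, χ i x * f x := fun x => by rw [← Finset.sum_mul, hχ1, one_mul]
  have h2 : ∀ i, ∫ x, χ i x * f x * divergence g u x ∂(vol g) =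
      -∫ x, dirDeriv (fun y => χ i y * f y) x (u x) ∂(vol g) := by
    intro i
    have hs : tsupport (fun x => χ i x * f x) ⊆ (extChartAt (𝓡 n) i).source :=
      tsupport_mul_subset_left.trans (hχU i)
    rw [← integral_mul_divRep g hu (hχf i) hs]
    congr 1
    ext x
    by_cases hx : x ∈ tsupport (fun x => χ i x * f x)
    · rw [divergence_eq_divRep g hu (hs hx)]
    · rw [image_eq_zero_of_notMem_tsupport (f := fun x => χ i x * f x) hx, zero_mul, zero_mul]
  have h3 : ∀ x, dirDeriv f x (u x) = ∑ i ∈ s, dirDeriv (fun y => χ i y * f y) x (u x) := by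
    intro x
    rw [← dirDeriv_sum s fun i _ => (hχf i).mdifferentiableAt (by simp)]
    exact dirDeriv_congr (Eventually.of_forall h1) _
  calc ∫ x, f x * divergence g u x ∂(vol g)
      = ∫ x, ∑ i ∈ s, χ i x * f x * divergence g u x ∂(vol g) := by
        congr 1
        ext x
        rw [← Finset.sum_mul, ← h1]
    _ = -∫ x, dirDeriv f x (u x) ∂(vol g) := by
        rw [integral_finsetSum _ fun i _ => integrable_vol g ((hχf i).continuous.fun_mul hd),
          Finset.sum_congr rfl fun i _ => h2 i, Finset.sum_neg_distrib,
          ← integral_finsetSum _ fun i _ => integrable_vol g (continuous_dirDeriv (hχf i) hu)]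
        simp only [h3]

theorem integral_divergence (g : Metric n M) {u : VField n M} (hu : SmoothField u) :
    ∫ x, divergence g u x ∂(vol g) = 0 := by
  have h := integral_mul_divergence g hu (f := fun _ => 1) contMDiff_const
  simpa only [one_mul, dirDeriv_const, integral_zero, neg_zero] using h

/-- The divergence is characterised by integration by parts. -/
theorem divergence_eq_of_forall_integral (g : Metric n M) {u : VField n M} (hu : SmoothField u)
    {h : M → ℝ} (hh : Continuous h)
    (H : ∀ f : M → ℝ, ContMDiff (𝓡 n) 𝓘(ℝ, ℝ) ∞ f →
      ∫ x, f x * h x ∂(vol g) = -∫ x, dirDeriv f x (u x) ∂(vol g)) (x : M) :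
    divergence g u x = h x := by
  have hd := (contMDiff_divergence g hu).continuous
  refine sub_eq_zero.1 (eq_zero_of_forall_integral_mul_eq_zero g isOpen_univ
    (h := fun x => divergence g u x - h x) (hd.fun_sub hh).continuousOn (fun f hf _ => ?_) (mem_univ x))
  simp only [mul_sub]
  rw [integral_sub (integrable_vol g (hf.continuous.fun_mul hd))
    (integrable_vol g (hf.continuous.fun_mul hh)), integral_mul_divergence g hu hf, H f hf, sub_self]

theorem divergence_add (g : Metric n M) {u v : VField n M} (hu : SmoothField u)
    (hv : SmoothField v) (x : M) :
    divergence g (fun x => u x + v x) x = divergence g u x + divergence g v x := by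
  have hd := (contMDiff_divergence g hu).continuous
  have hd' := (contMDiff_divergence g hv).continuous
  refine divergence_eq_of_forall_integral g (hu.add hv) (hd.fun_add hd') (fun f hf => ?_) x
  simp only [mul_add, dirDeriv_add]
  rw [integral_add (integrable_vol g (hf.continuous.fun_mul hd))
    (integrable_vol g (hf.continuous.fun_mul hd')), integral_mul_divergence g hu hf,
    integral_mul_divergence g hv hf, integral_add (integrable_vol g (continuous_dirDeriv hf hu))
    (integrable_vol g (continuous_dirDeriv hf hv)), neg_add]

theorem divergence_smul (g : Metric n M) {u : VField n M} (hu : SmoothField u) {a : M → ℝ}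
    (ha : ContMDiff (𝓡 n) 𝓘(ℝ, ℝ) ∞ a) (x : M) :
    divergence g (fun x => a x • u x) x = a x * divergence g u x + dirDeriv a x (u x) := by
  have hd := (contMDiff_divergence g hu).continuous
  have hda := continuous_dirDeriv ha hu
  refine divergence_eq_of_forall_integral g (hu.smul ha)
    ((ha.continuous.fun_mul hd).fun_add hda) (fun f hf => ?_) x
  have h1 := integral_mul_divergence g hu (hf.mul ha)
  have h2 : ∀ x, dirDeriv (fun y => f y * a y) x (u x) =
      f x * dirDeriv a x (u x) + a x * dirDeriv f x (u x) := fun x =>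
    dirDeriv_mul (hf.mdifferentiableAt (by simp)) (ha.mdifferentiableAt (by simp)) _
  have h1' : ∫ x, f x * a x * divergence g u x ∂(vol g) =
      -∫ x, (f x * dirDeriv a x (u x) + a x * dirDeriv f x (u x)) ∂(vol g) := by
    simp only [← h2]
    exact h1
  rw [integral_add (integrable_vol g (hf.continuous.fun_mul hda))
    (integrable_vol g (ha.continuous.fun_mul (continuous_dirDeriv hf hu)))] at h1'
  simp only [dirDeriv_smul, mul_add, ← mul_assoc]
  rw [integral_add (integrable_vol g ((hf.continuous.fun_mul ha.continuous).fun_mul hd))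
    (integrable_vol g (hf.continuous.fun_mul hda)), h1']
  ring

/-- The time derivative is continuous, hence bounded on the product of a compact time interval with
M; a constant dominates because the volume is finite. -/
theorem hasDerivAt_integral_vol (g : Metric n M) {J : Set ℝ} (hJ : IsOpen J) {F : ℝ → M → ℝ}
    (hF : SmoothFun (n := n) J F) {t : ℝ} (ht : t ∈ J) :
    HasDerivAt (fun s => ∫ x, F s x ∂(vol g)) (∫ x, deriv (fun s => F s x) t ∂(vol g)) t := by
  obtain ⟨ε, hε, hεJ⟩ := Metric.nhds_basis_closedBall.mem_iff.1 (hJ.mem_nhds ht)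
  have hdt := hF.dt hJ
  obtain ⟨C, hC⟩ := ((isCompact_closedBall t ε).prod (isCompact_univ (X := M))).exists_bound_of_continuousOn
    (hdt.continuousOn.mono (prod_mono_left hεJ))
  refine (hasDerivAt_integral_of_dominated_loc_of_deriv_le (μ := vol g) (𝕜 := ℝ) (E := ℝ)
    (F := F) (F' := fun s x => deriv (fun s => F s x) s) (bound := fun _ => C)
    (Metric.ball_mem_nhds t hε) ?_ ?_ ?_ ?_ (integrable_const C) ?_).2
  · filter_upwards [hJ.mem_nhds ht] with s hs
    exact (hF.contMDiff hs).continuous.aestronglyMeasurable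
  · exact integrable_vol g (hF.contMDiff ht).continuous
  · exact (hdt.contMDiff ht).continuous.aestronglyMeasurable
  · exact Eventually.of_forall fun x s hs =>
      hC (s, x) ⟨Metric.ball_subset_closedBall hs, mem_univ _⟩
  · exact Eventually.of_forall fun x s hs =>
      hF.hasDerivAt hJ (hεJ (Metric.ball_subset_closedBall hs)) x

end WeakDivergence

/-! ### Functions with zero mean are divergences. -/

section TopDegree

variable {n : ℕ} {M : Type*} [TopologicalSpace M] [ChartedSpace (EuclideanSpace ℝ (Fin n)) M]
  [IsManifold (𝓡 n) ∞ M]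

theorem divergence_congr (g : Metric n M) {u v : VField n M} {x : M} (h : ∀ᶠ y in 𝓝 x, u y = v y) :
    divergence g u x = divergence g v x := by
  have h1 : ∀ᶠ y in 𝓝 (extChartAt (𝓡 n) x x),
      u ((extChartAt (𝓡 n) x).symm y) = v ((extChartAt (𝓡 n) x).symm y) :=
    (continuousAt_extChartAt_symm (I := 𝓡 n) x).eventually
      (by rwa [extChartAt_to_inv])
  have h2 : ∀ i, pd i (fun y => volDensity g x y * comp u x i y) (extChartAt (𝓡 n) x x) =
      pd i (fun y => volDensity g x y * comp v x i y) (extChartAt (𝓡 n) x x) := by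
    intro i
    rw [pd, pd]
    congr 1
    refine Filter.EventuallyEq.fderiv_eq ?_
    filter_upwards [h1] with y hy
    simp only [comp, hy]
  simp only [divergence, h2]

theorem divergence_zero (g : Metric n M) (x : M) : divergence g (0 : VField n M) x = 0 := by
  have h : ∀ i y, volDensity g x y * comp (0 : VField n M) x i y = 0 := by
    intro i y
    rw [comp, Pi.zero_apply, map_zero]
    exact mul_zero _
  simp [divergence, h, pd]

/-- The tangent vector with components `w` at the point with coordinates `y`. -/
def chartVector (p : M) (y w : EuclideanSpace ℝ (Fin n)) : EuclideanSpace ℝ (Fin n) :=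
  mfderiv 𝓘(ℝ, EuclideanSpace ℝ (Fin n)) (𝓡 n) (extChartAt (𝓡 n) p).symm y w

theorem chartVector_zero (p : M) (y : EuclideanSpace ℝ (Fin n)) : chartVector p y 0 = 0 :=
  map_zero (mfderiv 𝓘(ℝ, EuclideanSpace ℝ (Fin n)) (𝓡 n) (extChartAt (𝓡 n) p).symm y)

open Classical in
/-- The vector field with components `v` in the chart at `p`, extended by zero. -/
def chartField (p : M) (v : EuclideanSpace ℝ (Fin n) → EuclideanSpace ℝ (Fin n)) : VField n M :=
  fun x => (if x ∈ (extChartAt (𝓡 n) p).source then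
    chartVector p (extChartAt (𝓡 n) p x) (v (extChartAt (𝓡 n) p x)) else 0 :
      EuclideanSpace ℝ (Fin n))

theorem chartField_of_mem {p x : M} (v : EuclideanSpace ℝ (Fin n) → EuclideanSpace ℝ (Fin n))
    (hx : x ∈ (extChartAt (𝓡 n) p).source) :
    chartField p v x = chartVector p (extChartAt (𝓡 n) p x) (v (extChartAt (𝓡 n) p x)) :=
  if_pos hx

theorem chartField_of_notMem {p x : M} (v : EuclideanSpace ℝ (Fin n) → EuclideanSpace ℝ (Fin n))
    (hx : x ∉ (extChartAt (𝓡 n) p).source) : chartField p v x = 0 :=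
  if_neg hx

theorem fieldRep_chartField {p : M} {v : EuclideanSpace ℝ (Fin n) → EuclideanSpace ℝ (Fin n)}
    {y : EuclideanSpace ℝ (Fin n)} (hy : y ∈ (extChartAt (𝓡 n) p).target) :
    fieldRep (chartField p v) p y = v y := by
  have key : ∀ z, z = y → mfderiv (𝓡 n) 𝓘(ℝ, EuclideanSpace ℝ (Fin n)) (extChartAt (𝓡 n) p)
      ((extChartAt (𝓡 n) p).symm y) (chartVector p z (v z)) = v y := by
    rintro _ rfl
    exact mfderiv_chart_mfderiv_symm hy _
  rw [fieldRep, chartField_of_mem v ((extChartAt (𝓡 n) p).map_target hy)]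
  exact key _ ((extChartAt (𝓡 n) p).right_inv hy)

variable [T2Space M]

/-- The image of K in M is compact, hence closed as M is Hausdorff, so the function is zero near
every point outside this image. -/
theorem contMDiff_indicator_chart {p : M} {h : EuclideanSpace ℝ (Fin n) → ℝ}
    {K : Set (EuclideanSpace ℝ (Fin n))} (hK : IsCompact K) (hKp : K ⊆ (extChartAt (𝓡 n) p).target)
    (hh : ContDiffOn ℝ ∞ h (extChartAt (𝓡 n) p).target)
    (h0 : ∀ y ∈ (extChartAt (𝓡 n) p).target, y ∉ K → h y = 0) :
    ContMDiff (𝓡 n) 𝓘(ℝ, ℝ) ∞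
      ((extChartAt (𝓡 n) p).source.indicator fun x => h (extChartAt (𝓡 n) p x)) := by
  have hK' : IsClosed ((extChartAt (𝓡 n) p).symm '' K) :=
    (hK.image_of_continuousOn ((continuousOn_extChartAt_symm p).mono hKp)).isClosed
  refine contMDiff_of_tsupport fun x hx => ?_
  have hx' : x ∈ (extChartAt (𝓡 n) p).source := by
    have h1 : x ∈ (extChartAt (𝓡 n) p).symm '' K := by
      refine closure_minimal (fun z hz => ?_) hK' hx
      have hzs : z ∈ (extChartAt (𝓡 n) p).source := mem_of_indicator_ne_zero hz
      rw [Function.mem_support, indicator_of_mem hzs] at hz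
      by_contra hzK
      refine hz (h0 _ ((extChartAt (𝓡 n) p).map_source hzs) fun hmem => hzK ?_)
      exact ⟨_, hmem, (extChartAt (𝓡 n) p).left_inv hzs⟩
    obtain ⟨y, hy, rfl⟩ := h1
    exact (extChartAt (𝓡 n) p).map_target (hKp hy)
  have hS := (isOpen_extChartAt_source (I := 𝓡 n) p).mem_nhds hx'
  have h1 : ContMDiffAt (𝓡 n) 𝓘(ℝ, ℝ) ∞ (fun x => h (extChartAt (𝓡 n) p x)) x :=
    (hh.contMDiffOn.comp (contMDiffOn_chart p)
      fun z hz => (extChartAt (𝓡 n) p).map_source hz).contMDiffAt hS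
  refine h1.congr_of_eventuallyEq ?_
  filter_upwards [hS] with z hz
  rw [indicator_of_mem hz]

theorem smoothField_chartField {p : M} {v : EuclideanSpace ℝ (Fin n) → EuclideanSpace ℝ (Fin n)}
    {K : Set (EuclideanSpace ℝ (Fin n))} (hK : IsCompact K) (hKp : K ⊆ (extChartAt (𝓡 n) p).target)
    (hv : ContDiffOn ℝ ∞ v (extChartAt (𝓡 n) p).target)
    (h0 : ∀ y ∈ (extChartAt (𝓡 n) p).target, y ∉ K → v y = 0) :
    SmoothField (chartField p v) := by
  refine (smoothTimeField_of_dirDeriv (J := univ) (u := fun _ => chartField p v)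
    fun f hf => smoothFun_const ?_).smoothField (mem_univ 0)
  have hf' : ContDiffOn ℝ ∞ (fun z => f ((extChartAt (𝓡 n) p).symm z))
      (extChartAt (𝓡 n) p).target := (hf.comp_contMDiffOn (contMDiffOn_symm p)).contDiffOn
  refine (contMDiff_indicator_chart hK hKp (h := fun y =>
    fderiv ℝ (fun z => f ((extChartAt (𝓡 n) p).symm z)) y (v y)) ?_ ?_).congr fun x => ?_
  · exact (hf'.fderiv_of_isOpen (isOpen_extChartAt_target p) (by simp)).clm_apply hv
  · intro y hy hyK
    rw [h0 y hy hyK, map_zero]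
  · by_cases hx : x ∈ (extChartAt (𝓡 n) p).source
    · rw [indicator_of_mem hx]
      have hy := (extChartAt (𝓡 n) p).map_source hx
      have key : ∀ y ∈ (extChartAt (𝓡 n) p).target,
          dirDeriv f ((extChartAt (𝓡 n) p).symm y) (chartField p v ((extChartAt (𝓡 n) p).symm y)) =
          fderiv ℝ (fun z => f ((extChartAt (𝓡 n) p).symm z)) y (v y) := by
        intro y hy
        rw [dirDeriv_eq_fderiv hy (hf.mdifferentiableAt (by simp))]
        exact congrArg _ (fieldRep_chartField hy)
      have h2 := key _ hy
      rwa [(extChartAt (𝓡 n) p).left_inv hx] at h2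
    · rw [indicator_of_notMem hx, chartField_of_notMem v hx]
      exact map_zero _

variable [CompactSpace M] [MeasurableSpace M] [BorelSpace M]

theorem divergence_chartField (g : Metric n M) {p : M}
    {v : EuclideanSpace ℝ (Fin n) → EuclideanSpace ℝ (Fin n)}
    {K : Set (EuclideanSpace ℝ (Fin n))} (hK : IsCompact K) (hKp : K ⊆ (extChartAt (𝓡 n) p).target)
    (hv : ContDiffOn ℝ ∞ v (extChartAt (𝓡 n) p).target)
    (h0 : ∀ y ∈ (extChartAt (𝓡 n) p).target, y ∉ K → v y = 0) (x : M) :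
    divergence g (chartField p v) x = (extChartAt (𝓡 n) p).source.indicator (fun x =>
      (volDensity g p (extChartAt (𝓡 n) p x))⁻¹ *
        ∑ i, pd i (fun y => volDensity g p y * v y i) (extChartAt (𝓡 n) p x)) x := by
  by_cases hx : x ∈ (extChartAt (𝓡 n) p).source
  · rw [indicator_of_mem hx, divergence_eq_divRep g (smoothField_chartField hK hKp hv h0) hx, divRep]
    congr 1
    refine Finset.sum_congr rfl fun i _ => ?_
    rw [pd, pd]
    congr 1
    refine Filter.EventuallyEq.fderiv_eq ?_
    filter_upwards [(isOpen_extChartAt_target (I := 𝓡 n) p).mem_nhds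
      ((extChartAt (𝓡 n) p).map_source hx)] with y hy
    congr 1
    exact congrFun (congrArg WithLp.ofLp (fieldRep_chartField hy)) i
  · rw [indicator_of_notMem hx]
    have hK' : IsClosed ((extChartAt (𝓡 n) p).symm '' K) :=
      (hK.image_of_continuousOn ((continuousOn_extChartAt_symm p).mono hKp)).isClosed
    have hxK : x ∈ ((extChartAt (𝓡 n) p).symm '' K)ᶜ := by
      rintro ⟨y, hy, rfl⟩
      exact hx ((extChartAt (𝓡 n) p).map_target (hKp hy))
    rw [divergence_congr (v := 0), divergence_zero]
    filter_upwards [hK'.isOpen_compl.mem_nhds hxK] with z hz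
    by_cases hzs : z ∈ (extChartAt (𝓡 n) p).source
    · have hz' : v (extChartAt (𝓡 n) p z) = 0 :=
        h0 _ ((extChartAt (𝓡 n) p).map_source hzs) fun hmem =>
          hz ⟨_, hmem, (extChartAt (𝓡 n) p).left_inv hzs⟩
      rw [chartField_of_mem v hzs, hz', chartVector_zero]
      rfl
    · exact chartField_of_notMem v hzs

theorem exists_compact_box {c : EuclideanSpace ℝ (Fin n)} {T : Set (EuclideanSpace ℝ (Fin n))}
    (hT : T ∈ 𝓝 c) : ∃ r > 0, {y : EuclideanSpace ℝ (Fin n) | ∀ i, |y i - c i| ≤ r} ⊆ T ∧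
      IsCompact {y : EuclideanSpace ℝ (Fin n) | ∀ i, |y i - c i| ≤ r} ∧
      {y : EuclideanSpace ℝ (Fin n) | ∀ i, |y i - c i| ≤ r} ∈ 𝓝 c := by
  have hcont : Continuous (WithLp.toLp 2 : (Fin n → ℝ) → EuclideanSpace ℝ (Fin n)) :=
    PiLp.continuous_toLp 2 _
  have h1 : (WithLp.toLp 2 : (Fin n → ℝ) → EuclideanSpace ℝ (Fin n)) ⁻¹' T ∈ 𝓝 (WithLp.ofLp c) :=
    hcont.continuousAt.preimage_mem_nhds hT
  obtain ⟨r, hr, hrT⟩ := Metric.nhds_basis_closedBall.mem_iff.1 h1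
  have hbox : {y : EuclideanSpace ℝ (Fin n) | ∀ i, |y i - c i| ≤ r} =
      WithLp.ofLp ⁻¹' Metric.closedBall (WithLp.ofLp c) r := by
    ext y
    simp [Metric.mem_closedBall, dist_pi_le_iff hr.le, Real.dist_eq]
  have hbox2 : {y : EuclideanSpace ℝ (Fin n) | ∀ i, |y i - c i| ≤ r} =
      WithLp.toLp 2 '' Metric.closedBall (WithLp.ofLp c) r := by
    rw [hbox]
    ext y
    constructor
    · intro hy
      exact ⟨WithLp.ofLp y, hy, rfl⟩
    · rintro ⟨z, hz, rfl⟩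
      exact hz
  refine ⟨r, hr, ?_, ?_, ?_⟩
  · rw [hbox2]
    rintro _ ⟨z, hz, rfl⟩
    exact hrT hz
  · rw [hbox2]
    exact (isCompact_closedBall _ _).image hcont
  · rw [hbox]
    exact (PiLp.continuous_ofLp 2 _).continuousAt.preimage_mem_nhds
      (Metric.closedBall_mem_nhds _ hr)

/-- Locally, modulo divergences, the smooth functions form a one-dimensional space. -/
theorem exists_local_generator (g : Metric n M) (p : M) :
    ∃ U ∈ 𝓝 p, ∃ β : M → ℝ, ∀ f : M → ℝ, ContMDiff (𝓡 n) 𝓘(ℝ, ℝ) ∞ f → tsupport f ⊆ U →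
      ∃ (C : ℝ) (W : VField n M), SmoothField W ∧ ∀ x, f x = C * β x + divergence g W x := by
  set φ := extChartAt (𝓡 n) p with hφ
  obtain ⟨r, hr, hT, hK, hnhds⟩ := exists_compact_box
    ((isOpen_extChartAt_target (I := 𝓡 n) p).mem_nhds (mem_extChartAt_target (I := 𝓡 n) p))
  set K := {y : EuclideanSpace ℝ (Fin n) | ∀ i, |y i - φ p i| ≤ r} with hKdef
  have hnotK : ∀ y, y ∉ K ↔ ∃ i, r < |y i - φ p i| := by
    intro y
    simp [hKdef]
  obtain ⟨β, hβ, hβ0, H⟩ := exists_box_divergence (φ p) hr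
  have hρ0 : ∀ y ∈ φ.target, volDensity g p y ≠ 0 := fun y hy => (volDensity_pos g hy).ne'
  refine ⟨φ.source ∩ φ ⁻¹' K, inter_mem (extChartAt_source_mem_nhds p)
    ((continuousAt_extChartAt p).preimage_mem_nhds hnhds),
    φ.source.indicator fun x => (volDensity g p (φ x))⁻¹ * β (φ x), fun f hf hfs => ?_⟩
  have hf0 : ∀ y ∈ φ.target, y ∉ K → f (φ.symm y) = 0 := by
    intro y hy hyK
    by_contra hne
    have := (hfs (subset_tsupport f hne)).2
    rw [mem_preimage, φ.right_inv hy] at this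
    exact hyK this
  have hfρ0 : ∀ y ∈ φ.target, y ∉ K → volDensity g p y * f (φ.symm y) = 0 := by
    intro y hy hyK
    rw [hf0 y hy hyK, mul_zero]
  obtain ⟨C, V, hV, hV0, hCV⟩ := H (φ.target.indicator fun y => volDensity g p y * f (φ.symm y))
    (contDiff_indicator (isOpen_extChartAt_target p) hK.isClosed hT
      ((contDiffOn_volDensity g p).mul (hf.comp_contMDiffOn (contMDiffOn_symm p)).contDiffOn) hfρ0)
    (fun y hy => by
      by_cases hyT : y ∈ φ.target
      · rw [indicator_of_mem hyT, hfρ0 y hyT ((hnotK y).2 hy)]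
      · rw [indicator_of_notMem hyT])
  -- Dividing by the density makes the coordinate divergence of v equal to ρ⁻¹ ∑ ∂ᵢVᵢ, which matches
  -- the decomposition obtained for ρ f.
  set v : EuclideanSpace ℝ (Fin n) → EuclideanSpace ℝ (Fin n) :=
    fun y => WithLp.toLp 2 fun i => (volDensity g p y)⁻¹ * V i y with hv
  have hvs : ContDiffOn ℝ ∞ v φ.target := by
    rw [contDiffOn_euclidean]
    intro i
    exact ((contDiffOn_volDensity g p).inv hρ0).mul (hV i).contDiffOn
  have hv0 : ∀ y ∈ φ.target, y ∉ K → v y = 0 := by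
    intro y _ hyK
    refine PiLp.ext fun i => ?_
    change (volDensity g p y)⁻¹ * V i y = 0
    rw [hV0 i y ((hnotK y).1 hyK), mul_zero]
  refine ⟨C, chartField p v, smoothField_chartField hK hT hvs hv0, fun x => ?_⟩
  rw [divergence_chartField g hK hT hvs hv0]
  by_cases hx : x ∈ φ.source
  · rw [indicator_of_mem hx, indicator_of_mem hx]
    have hy := φ.map_source hx
    have h1 := hCV (φ x)
    rw [indicator_of_mem hy, φ.left_inv hx] at h1
    have h2 : ∀ i, pd i (fun y => volDensity g p y * v y i) (φ x) = pd i (V i) (φ x) := by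
      intro i
      rw [pd, pd]
      congr 1
      refine Filter.EventuallyEq.fderiv_eq ?_
      filter_upwards [(isOpen_extChartAt_target (I := 𝓡 n) p).mem_nhds hy] with y hy
      change volDensity g p y * ((volDensity g p y)⁻¹ * V i y) = V i y
      rw [mul_inv_cancel_left₀ (hρ0 y hy)]
    rw [Finset.sum_congr rfl fun i _ => h2 i]
    have h3 := hρ0 _ hy
    rw [← mul_right_inj' h3, h1, mul_add, mul_inv_cancel_left₀ h3]
    field_simp
  · rw [indicator_of_notMem hx, indicator_of_notMem hx, mul_zero, add_zero]
    by_contra hne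
    exact hx (hfs (subset_tsupport f hne)).1

theorem divergence_const_smul (g : Metric n M) {u : VField n M} (hu : SmoothField u) (a : ℝ)
    (x : M) : divergence g (fun x => a • u x) x = a * divergence g u x := by
  rw [divergence_smul g hu (a := fun _ => a) contMDiff_const, dirDeriv_const, add_zero]

theorem SmoothField.const_smul {u : VField n M} (hu : SmoothField u) (a : ℝ) :
    SmoothField fun x => a • u x := hu.smul (f := fun _ => a) contMDiff_const

/-- `f` is a multiple of `e` modulo divergences. -/
def MultipleModDivergence (g : Metric n M) (e f : M → ℝ) : Prop :=
  ∃ (C : ℝ) (W : VField n M), SmoothField W ∧ ∀ x, f x = C * e x + divergence g W x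

theorem smoothField_zero : SmoothField (fun _ => 0 : VField n M) := by
  refine (smoothTimeField_of_dirDeriv (J := univ) (u := fun _ _ => 0)
    fun f hf => ?_).smoothField (mem_univ 0)
  refine (smoothFun_const contMDiff_const).congr (F := fun _ _ => 0) fun t _ x => map_zero _

theorem MultipleModDivergence.sum {g : Metric n M} {e : M → ℝ} {ι : Type*} {s : Finset ι}
    {f : ι → M → ℝ} (h : ∀ i ∈ s, MultipleModDivergence g e (f i)) :
    MultipleModDivergence g e fun x => ∑ i ∈ s, f i x := by
  classical
  induction s using Finset.induction_on with
  | empty =>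
    refine ⟨0, fun _ => 0, smoothField_zero, fun x => ?_⟩
    have := divergence_zero g x
    simp only [Finset.sum_empty, zero_mul, zero_add]
    exact this.symm
  | insert a t ha ih =>
    obtain ⟨C, W, hW, h1⟩ := ih fun i hi => h i (Finset.mem_insert_of_mem hi)
    obtain ⟨C', W', hW', h2⟩ := h a (Finset.mem_insert_self a t)
    refine ⟨C' + C, fun x => W' x + W x, hW'.add hW, fun x => ?_⟩
    have h1' := h1 x
    dsimp only at h1' ⊢
    rw [Finset.sum_insert ha, h1', h2, divergence_add g hW' hW]
    ring

/-- The points having a neighbourhood whose functions are multiples of e modulo divergences form an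
open set. It is also closed: a bump in the overlap of two neighbourhoods has nonzero integral, so it
relates the two local generators. Connectedness and a partition of unity conclude. -/
theorem exists_multipleModDivergence [ConnectedSpace M] (g : Metric n M) :
    ∃ e : M → ℝ, ∀ f : M → ℝ, ContMDiff (𝓡 n) 𝓘(ℝ, ℝ) ∞ f → MultipleModDivergence g e f := by
  choose U hU β hβ using exists_local_generator g
  obtain ⟨p₀⟩ : Nonempty M := inferInstance
  set e := β p₀
  let A : Set M := {x | ∃ V ∈ 𝓝 x, ∀ f : M → ℝ, ContMDiff (𝓡 n) 𝓘(ℝ, ℝ) ∞ f → tsupport f ⊆ V →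
    MultipleModDivergence g e f}
  have hopen : IsOpen A := by
    rw [isOpen_iff_mem_nhds]
    rintro x ⟨V, hV, h⟩
    filter_upwards [eventually_mem_nhds_iff.2 hV] with y hy
    exact ⟨V, hy, h⟩
  have hclosed : IsClosed A := by
    refine isClosed_of_closure_subset fun x hx => ?_
    obtain ⟨y, hyU, hyA⟩ := mem_closure_iff_nhds.1 hx _ (interior_mem_nhds.2 (hU x))
    obtain ⟨V, hV, h⟩ := hyA
    obtain ⟨b, hb, hb0, hb1, hbs⟩ := exists_bump (n := n)
      (inter_mem hV (isOpen_interior.mem_nhds hyU))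
    obtain ⟨C, W, hW, h1⟩ := hβ x b hb ((hbs.trans inter_subset_right).trans interior_subset)
    obtain ⟨C', W', hW', h2⟩ := h b hb (hbs.trans inter_subset_left)
    -- Otherwise b would be a divergence and have integral zero.
    have hC : C ≠ 0 := by
      rintro rfl
      have hpos : 0 < ∫ z, b z ∂(vol g) :=
        hb.continuous.integral_pos_of_hasCompactSupport_nonneg_nonzero
          (HasCompactSupport.of_compactSpace _) hb0 (by rw [hb1.eq_of_nhds]; exact one_ne_zero)
      have : ∀ z, b z = divergence g W z := fun z => by rw [h1, zero_mul, zero_add]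
      simp only [this, integral_divergence g hW] at hpos
      exact lt_irrefl _ hpos
    refine ⟨U x, hU x, fun f hf hfs => ?_⟩
    obtain ⟨D, W₂, hW₂, h3⟩ := hβ x f hf hfs
    refine ⟨D * C⁻¹ * C', fun z => (D * C⁻¹) • (W' z + (-1 : ℝ) • W z) + W₂ z,
      ((hW'.add (hW.const_smul (-1))).const_smul _).add hW₂, fun z => ?_⟩
    rw [divergence_add g ((hW'.add (hW.const_smul (-1))).const_smul _) hW₂,
      divergence_const_smul g (hW'.add (hW.const_smul (-1))),
      divergence_add g hW' (hW.const_smul (-1)), divergence_const_smul g hW, h3]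
    have h4 := (h1 z).symm.trans (h2 z)
    have h5 : β x z = C⁻¹ * (C' * e z + divergence g W' z - divergence g W z) := by
      rw [eq_inv_mul_iff_mul_eq₀ hC]
      linarith
    rw [h5]
    ring
  have hA : A = univ := IsClopen.eq_univ ⟨hclosed, hopen⟩ ⟨p₀, U p₀, hU p₀, hβ p₀⟩
  have hA' : ∀ x, x ∈ A := fun x => hA ▸ mem_univ x
  choose V hV h using hA'
  obtain ⟨s, χ, hχ, hχV, hχ1⟩ := exists_partition (n := n) hV
  refine ⟨e, fun f hf => ?_⟩
  have h1 : f = fun x => ∑ i ∈ s, χ i x * f x := by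
    ext x
    rw [← Finset.sum_mul, hχ1, one_mul]
  rw [h1]
  exact MultipleModDivergence.sum fun i _ => h i _ ((hχ i).mul hf)
    (tsupport_mul_subset_left.trans (hχV i))

/-- On a compact connected Riemannian manifold, a smooth function with zero mean is a divergence. -/
theorem exists_divergence_eq [ConnectedSpace M] (g : Metric n M) {f : M → ℝ}
    (hf : ContMDiff (𝓡 n) 𝓘(ℝ, ℝ) ∞ f) (hf0 : ∫ x, f x ∂(vol g) = 0) :
    ∃ W : VField n M, SmoothField W ∧ ∀ x, divergence g W x = f x := by
  obtain ⟨e, he⟩ := exists_multipleModDivergence g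
  have hint : ∀ {C : ℝ} {W : VField n M} {f : M → ℝ}, ContMDiff (𝓡 n) 𝓘(ℝ, ℝ) ∞ f → SmoothField W →
      (∀ x, f x = C * e x + divergence g W x) → ∫ x, f x ∂(vol g) = C * ∫ x, e x ∂(vol g) := by
    intro C W f hf hW h
    have h1 : ∀ x, C * e x = f x - divergence g W x := fun x => by rw [h]; ring
    rw [← integral_const_mul]
    simp only [h1]
    rw [integral_sub (integrable_vol g hf.continuous)
      (integrable_vol g (contMDiff_divergence g hW).continuous), integral_divergence g hW, sub_zero]
  obtain ⟨C, W, hW, h⟩ := he f hf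
  obtain ⟨C₁, W₁, hW₁, h₁⟩ := he (fun _ => 1) contMDiff_const
  have h2 := hint contMDiff_const hW₁ h₁
  have hpos : ∫ _ : M, (1 : ℝ) ∂(vol g) ≠ 0 := by
    obtain ⟨p₀⟩ : Nonempty M := inferInstance
    exact ((continuous_const (y := (1 : ℝ))).integral_pos_of_hasCompactSupport_nonneg_nonzero
      (x := p₀) (HasCompactSupport.of_compactSpace _) (fun _ => zero_le_one) one_ne_zero).ne'
  -- The constant 1 is itself a multiple of e modulo divergences and has nonzero integral.
  have he0 : ∫ x, e x ∂(vol g) ≠ 0 := by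
    intro h0
    rw [h0, mul_zero] at h2
    exact hpos h2
  have hC : C = 0 := by
    have := hint hf hW h
    rw [hf0] at this
    exact (mul_eq_zero.1 this.symm).resolve_right he0
  exact ⟨W, hW, fun x => by rw [h, hC, zero_mul, zero_add]⟩

end TopDegree

/-! ### Integral curves and local flows on the manifold. -/

section Curves

variable {n : ℕ} {M : Type*} [TopologicalSpace M] [ChartedSpace (EuclideanSpace ℝ (Fin n)) M]
  [IsManifold (𝓡 n) ∞ M]

/-- `γ` is an integral curve over `I` of the time-dependent field `X`. -/
def IsCurve (X : ℝ → VField n M) (I : Set ℝ) (γ : ℝ → M) : Prop :=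
  ∀ t ∈ I, ∀ f : M → ℝ, ContMDiff (𝓡 n) 𝓘(ℝ, ℝ) ∞ f →
    HasDerivAt (fun s => f (γ s)) (dirDeriv f (γ t) (X t (γ t))) t

theorem IsCurve.mono {X : ℝ → VField n M} {I I' : Set ℝ} {γ : ℝ → M} (h : IsCurve X I γ)
    (hI : I' ⊆ I) : IsCurve X I' γ := fun t ht => h t (hI ht)

theorem IsCurve.congr {X : ℝ → VField n M} {I : Set ℝ} (hI : IsOpen I) {γ γ' : ℝ → M}
    (h : IsCurve X I γ) (hγ : ∀ t ∈ I, γ' t = γ t) : IsCurve X I γ' := by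
  intro t ht f hf
  rw [hγ t ht]
  refine (h t ht f hf).congr_of_eventuallyEq ?_
  filter_upwards [hI.mem_nhds ht] with s hs
  rw [hγ s hs]

theorem fieldRep_chart (u : VField n M) {p x : M} (hx : x ∈ (extChartAt (𝓡 n) p).source) :
    fieldRep u p (extChartAt (𝓡 n) p x) =
      mfderiv (𝓡 n) 𝓘(ℝ, EuclideanSpace ℝ (Fin n)) (extChartAt (𝓡 n) p) x (u x) := by
  -- Equal base points still give distinct tangent space types; the point is generalised so that the
  -- equality can be substituted.
  have key : ∀ z, z = x → (show EuclideanSpace ℝ (Fin n) from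
      mfderiv (𝓡 n) 𝓘(ℝ, EuclideanSpace ℝ (Fin n)) (extChartAt (𝓡 n) p) z (u z)) =
      mfderiv (𝓡 n) 𝓘(ℝ, EuclideanSpace ℝ (Fin n)) (extChartAt (𝓡 n) p) x (u x) := by
    rintro _ rfl
    rfl
  exact key _ ((extChartAt (𝓡 n) p).left_inv hx)

variable [T2Space M]

/-- Integral curves are defined only through test functions. A bump function supported in U and
nonzero at γ t stays nonzero along the curve near t, which keeps the curve in U. -/
theorem IsCurve.continuousAt {X : ℝ → VField n M} {I : Set ℝ} {γ : ℝ → M} (h : IsCurve X I γ)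
    {t : ℝ} (ht : t ∈ I) : ContinuousAt γ t := by
  intro U hU
  obtain ⟨f, hf, -, hf1, hfU⟩ := exists_bump (n := n) hU
  have h1 : f (γ t) ≠ 0 := by
    rw [hf1.eq_of_nhds]
    exact one_ne_zero
  have h2 : ∀ᶠ s in 𝓝 t, f (γ s) ≠ 0 := (h t ht f hf).continuousAt.eventually_ne h1
  refine mem_map.2 ?_
  filter_upwards [h2] with s hs
  exact hfU (subset_tsupport f hs)

theorem hasDerivAt_euclidean {γ : ℝ → EuclideanSpace ℝ (Fin n)} {γ' : EuclideanSpace ℝ (Fin n)}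
    {t : ℝ} (h : ∀ i, HasDerivAt (fun s => γ s i) (γ' i) t) : HasDerivAt γ γ' t := by
  rw [hasDerivAt_iff_hasFDerivAt, ← hasFDerivWithinAt_univ, hasFDerivWithinAt_euclidean]
  intro i
  refine (h i).hasFDerivAt.hasFDerivWithinAt.congr_fderiv ?_
  ext
  simp

theorem IsCurve.hasDerivAt_chart {X : ℝ → VField n M} {I : Set ℝ} {γ : ℝ → M} (h : IsCurve X I γ)
    {t : ℝ} (ht : t ∈ I) {p : M} (hp : γ t ∈ (extChartAt (𝓡 n) p).source) :
    HasDerivAt (fun s => extChartAt (𝓡 n) p (γ s))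
      (fieldRep (X t) p (extChartAt (𝓡 n) p (γ t))) t := by
  refine hasDerivAt_euclidean fun i => ?_
  obtain ⟨f, hf, hfp⟩ := exists_coord hp i
  have h1 := h t ht f hf
  rw [dirDeriv_eq_mfderiv_chart hp hfp] at h1
  rw [fieldRep_chart _ hp]
  refine h1.congr_of_eventuallyEq ?_
  filter_upwards [(h.continuousAt ht).eventually hfp] with s hs
  exact hs.symm

/-- In the chart the field is C¹, hence locally Lipschitz in space uniformly in time, and uniqueness
for ordinary differential equations applies. -/
theorem IsCurve.eventuallyEq {X : ℝ → VField n M} {I J : Set ℝ} (hJ : IsOpen J)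
    (hX : SmoothTimeField J X) (hI : IsOpen I) (hIJ : I ⊆ J) {γ₁ γ₂ : ℝ → M}
    (h₁ : IsCurve X I γ₁) (h₂ : IsCurve X I γ₂) {t : ℝ} (ht : t ∈ I) (heq : γ₁ t = γ₂ t) :
    γ₁ =ᶠ[𝓝 t] γ₂ := by
  set p := γ₁ t with hp
  set φ := extChartAt (𝓡 n) p
  have hpS : p ∈ φ.source := mem_extChartAt_source p
  have hopen : IsOpen (J ×ˢ φ.target) := hJ.prod (isOpen_extChartAt_target p)
  have hV := smoothTimeField_iff.1 hX p
  have hVat : ContDiffAt ℝ 1 (fun z : ℝ × EuclideanSpace ℝ (Fin n) => fieldRep (X z.1) p z.2)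
      (t, φ p) :=
    (hV.contDiffAt (hopen.mem_nhds ⟨hIJ ht, φ.map_source hpS⟩)).of_le (by simp)
  obtain ⟨K, s, hs, hK⟩ := hVat.exists_lipschitzOnWith
  obtain ⟨A, hA, B, hB, hAB⟩ := mem_nhds_prod_iff.1 hs
  have hlip : ∀ᶠ r in 𝓝 t, LipschitzOnWith K (fun y => fieldRep (X r) p y) B := by
    filter_upwards [hA] with r hr
    refine LipschitzOnWith.of_dist_le_mul fun y hy z hz => ?_
    have := hK.dist_le_mul (r, y) (hAB ⟨hr, hy⟩) (r, z) (hAB ⟨hr, hz⟩)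
    simpa [Prod.dist_eq] using this
  have hcurve : ∀ γ : ℝ → M, IsCurve X I γ → γ t = p → ∀ᶠ r in 𝓝 t, γ r ∈ φ.source ∧
      HasDerivAt (fun s => φ (γ s)) (fieldRep (X r) p (φ (γ r))) r ∧ φ (γ r) ∈ B := by
    intro γ hγ hγt
    have hc := hγ.continuousAt ht
    have h1 : ∀ᶠ r in 𝓝 t, γ r ∈ φ.source :=
      hc.eventually (by rw [hγt]; exact (isOpen_extChartAt_source p).mem_nhds hpS)
    have h2 : ∀ᶠ r in 𝓝 t, φ (γ r) ∈ B := by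
      refine (ContinuousAt.comp (g := φ) (f := γ) (x := t) ?_ hc).eventually ?_
      · rw [hγt]
        exact continuousAt_extChartAt p
      · rw [Function.comp, hγt]
        exact hB
    filter_upwards [h1, h2, hI.mem_nhds ht] with r hr hr' hrI
    exact ⟨hr, hγ.hasDerivAt_chart hrI hr, hr'⟩
  have e₁ := hcurve γ₁ h₁ rfl
  have e₂ := hcurve γ₂ h₂ heq.symm
  have := ODE_solution_unique_of_eventually (v := fun r y => fieldRep (X r) p y) (s := fun _ => B)
    hlip (e₁.mono fun r hr => hr.2) (e₂.mono fun r hr => hr.2)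
    (congrArg φ heq)
  filter_upwards [this, e₁, e₂] with r hr h1 h2
  exact φ.injOn h1.1 h2.1 hr

/-- The agreement set is open by local uniqueness, and its complement is open because M is
Hausdorff. -/
theorem IsCurve.eqOn {X : ℝ → VField n M} {I J : Set ℝ} (hJ : IsOpen J)
    (hX : SmoothTimeField J X) (hI : IsOpen I) (hI' : IsPreconnected I) (hIJ : I ⊆ J)
    {γ₁ γ₂ : ℝ → M} (h₁ : IsCurve X I γ₁) (h₂ : IsCurve X I γ₂) {b : ℝ} (hb : b ∈ I)
    (heq : γ₁ b = γ₂ b) {t : ℝ} (ht : t ∈ I) : γ₁ t = γ₂ t := by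
  have hu : IsOpen {t | t ∈ I ∧ γ₁ t = γ₂ t} := by
    rw [isOpen_iff_mem_nhds]
    rintro s ⟨hs, hs'⟩
    filter_upwards [hI.mem_nhds hs, IsCurve.eventuallyEq hJ hX hI hIJ h₁ h₂ hs hs'] with r hr hr'
    exact ⟨hr, hr'⟩
  have hv : IsOpen {t | t ∈ I ∧ γ₁ t ≠ γ₂ t} := by
    rw [isOpen_iff_mem_nhds]
    rintro s ⟨hs, hs'⟩
    have h1 : ∀ᶠ r in 𝓝 s, γ₁ r ≠ γ₂ r :=
      ((h₁.continuousAt hs).prodMk (h₂.continuousAt hs)).eventually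
        ((isClosed_diagonal (X := M)).isOpen_compl.mem_nhds hs')
    filter_upwards [hI.mem_nhds hs, h1] with r hr hr'
    exact ⟨hr, hr'⟩
  exact (hI'.subset_left_of_subset_union hu hv
    (disjoint_left.2 fun r hr hr' => hr'.2 hr.2)
    (fun r hr => by
      by_cases h : γ₁ r = γ₂ r
      · exact Or.inl ⟨hr, h⟩
      · exact Or.inr ⟨hr, h⟩) ⟨b, hb, hb, heq⟩ ht).2

/-- Local flows of a time-dependent vector field. -/
theorem exists_localFlow {X : ℝ → VField n M} {J : Set ℝ} (hJ : IsOpen J)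
    (hX : SmoothTimeField J X) {s₀ : ℝ} (hs₀ : s₀ ∈ J) (p : M) :
    ∃ δ > 0, ∃ U ∈ 𝓝 p, ∃ F : ℝ → ℝ → M → M, IsOpen U ∧ Ioo (s₀ - δ) (s₀ + δ) ⊆ J ∧
      (∀ x ∈ U, ∀ s ∈ Ioo (s₀ - δ) (s₀ + δ), F s s x = x ∧
        IsCurve X (Ioo (s₀ - δ) (s₀ + δ)) fun t => F s t x) ∧
      ContMDiffOn (𝓘(ℝ, ℝ).prod (𝓡 n)) (𝓡 n) ∞ (fun q : ℝ × M => F s₀ q.1 q.2)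
        (Ioo (s₀ - δ) (s₀ + δ) ×ˢ U) ∧
      ContMDiffOn (𝓘(ℝ, ℝ).prod (𝓡 n)) (𝓡 n) ∞ (fun q : ℝ × M => F q.1 s₀ q.2)
        (Ioo (s₀ - δ) (s₀ + δ) ×ˢ U) := by
  set φ := extChartAt (𝓡 n) p with hφ
  have hpS : p ∈ φ.source := mem_extChartAt_source p
  set O : Set (ℝ × EuclideanSpace ℝ (Fin n)) := J ×ˢ φ.target with hO
  have hopen : IsOpen O := hJ.prod (isOpen_extChartAt_target p)
  set z₀ : ℝ × EuclideanSpace ℝ (Fin n) := (s₀, φ p) with hz₀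
  have hz₀O : O ∈ 𝓝 z₀ := hopen.mem_nhds ⟨hs₀, φ.map_source hpS⟩
  have hV := smoothTimeField_iff.1 hX p
  obtain ⟨χ, hχs, -, hχ, hχ1⟩ : ∃ χ : ℝ × EuclideanSpace ℝ (Fin n) → ℝ, tsupport χ ⊆ O ∧
      True ∧ ContDiff ℝ ∞ χ ∧ χ =ᶠ[𝓝 z₀] 1 := by
    obtain ⟨ε, hε, hεO⟩ := Metric.nhds_basis_closedBall.mem_iff.1 hz₀O
    let c : ContDiffBump z₀ := ⟨ε / 2, ε, by linarith, by linarith⟩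
    exact ⟨c, by rw [c.tsupport_eq]; exact hεO, trivial, c.contDiff, c.eventuallyEq_one⟩
  -- Time is added as a coordinate of unit speed to make the field autonomous, and χ cuts the field
  -- off to one that is smooth on the whole space.
  set f : ℝ × EuclideanSpace ℝ (Fin n) → ℝ × EuclideanSpace ℝ (Fin n) := fun z =>
    (1, χ z • fieldRep (X z.1) p z.2) with hf
  have hfs : ContDiff ℝ ∞ f := by
    refine contDiff_const.prodMk ?_
    rw [← contMDiff_iff_contDiff]
    refine contMDiff_of_tsupport fun z hz => ?_
    rw [contMDiffAt_iff_contDiffAt]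
    have hz' : z ∈ O := hχs (tsupport_smul_subset_left _ _ hz)
    exact hχ.contDiffAt.smul (hV.contDiffAt (hopen.mem_nhds hz'))
  obtain ⟨δ, hδ, α, hα0, hα, hαs⟩ := exists_contDiffOn_localFlow f hfs z₀
  have hfst : ∀ z ∈ Metric.ball z₀ δ, ∀ t ∈ Ioo (-δ) δ, (α (z, t)).1 = z.1 + t := by
    intro z hz t ht
    have h0 : (0 : ℝ) ∈ Ioo (-δ) δ := ⟨by linarith, hδ⟩
    have hd : ∀ s ∈ Ioo (-δ) δ, HasDerivAt (fun s => (α (z, s)).1 - s) 0 s := by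
      intro s hs
      have h1 : HasDerivAt (fun s => (α (z, s)).1) 1 s :=
        (ContinuousLinearMap.fst ℝ ℝ (EuclideanSpace ℝ (Fin n))).hasFDerivAt.comp_hasDerivAt s
          (hα z hz s hs)
      have h2 := h1.sub (hasDerivAt_id s)
      rw [sub_self] at h2
      exact h2
    have h1 := isOpen_Ioo.is_const_of_deriv_eq_zero (convex_Ioo _ _).isPreconnected
      (fun s hs => (hd s hs).differentiableAt.differentiableWithinAt)
      (fun s hs => (hd s hs).deriv) ht h0
    simp only [hα0 z hz] at h1
    linarith
  have hcont : ContinuousAt α (z₀, 0) := (hαs.continuousOn).continuousAt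
    ((Metric.isOpen_ball.prod isOpen_Ioo).mem_nhds
      ⟨Metric.mem_ball_self hδ, by simpa using hδ, hδ⟩)
  -- For short times the flow stays where χ = 1, so it follows the original field.
  have hW : ∀ᶠ w in 𝓝 (z₀, (0 : ℝ)), α w ∈ {z | z ∈ O ∧ χ z = 1} := by
    refine hcont.eventually ?_
    rw [hα0 z₀ (Metric.mem_ball_self hδ)]
    filter_upwards [hz₀O, hχ1] with z hz hz'
    exact ⟨hz, hz'⟩
  obtain ⟨ε₁, hε₁, hW₁⟩ := Metric.eventually_nhds_iff_ball.1 hW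
  obtain ⟨ε₂, hε₂, hJ₂⟩ := Metric.nhds_basis_ball.mem_iff.1 (hJ.mem_nhds hs₀)
  set ε := min (min ε₁ ε₂) δ with hε
  have hε0 : 0 < ε := lt_min (lt_min hε₁ hε₂) hδ
  have hεδ : ε ≤ δ := min_le_right _ _
  have hε1 : ε ≤ ε₁ := (min_le_left _ _).trans (min_le_left _ _)
  have hε2 : ε ≤ ε₂ := (min_le_left _ _).trans (min_le_right _ _)
  set U : Set M := φ.source ∩ φ ⁻¹' Metric.ball (φ p) ε with hU
  have hUo : IsOpen U :=
    (continuousOn_extChartAt p).isOpen_inter_preimage (isOpen_extChartAt_source p) Metric.isOpen_ball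
  set I := Ioo (s₀ - ε / 2) (s₀ + ε / 2) with hI
  have hs₀I : s₀ ∈ I := ⟨by linarith, by linarith⟩
  have hIJ : I ⊆ J := fun s hs => hJ₂ <| by
    rw [Real.ball_eq_Ioo]
    exact ⟨by linarith [hs.1], by linarith [hs.2]⟩
  have hball : ∀ s ∈ I, ∀ x ∈ U, (s, φ x) ∈ Metric.ball z₀ ε := by
    intro s hs x hx
    rw [Metric.mem_ball, Prod.dist_eq, max_lt_iff]
    refine ⟨?_, hx.2⟩
    rw [Real.dist_eq, abs_lt]
    exact ⟨by linarith [hs.1], by linarith [hs.2]⟩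
  have htime : ∀ s ∈ I, ∀ t ∈ I, t - s ∈ Ioo (-ε) ε := fun s hs t ht =>
    ⟨by linarith [hs.2, ht.1], by linarith [hs.1, ht.2]⟩
  have hball' : ∀ s ∈ I, ∀ x ∈ U, (s, φ x) ∈ Metric.ball z₀ δ := fun s hs x hx =>
    Metric.ball_subset_ball hεδ (hball s hs x hx)
  have htime' : ∀ s ∈ I, ∀ t ∈ I, t - s ∈ Ioo (-δ) δ := fun s hs t ht =>
    Ioo_subset_Ioo (by linarith) hεδ (htime s hs t ht)
  have hin : ∀ s ∈ I, ∀ t ∈ I, ∀ x ∈ U, α ((s, φ x), t - s) ∈ O ∧ χ (α ((s, φ x), t - s)) = 1 := by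
    intro s hs t ht x hx
    refine hW₁ _ ?_
    rw [Metric.mem_ball, Prod.dist_eq, max_lt_iff]
    refine ⟨lt_of_lt_of_le (hball s hs x hx) hε1, ?_⟩
    have := htime s hs t ht
    rw [Real.dist_eq, sub_zero, abs_lt]
    exact ⟨by linarith [this.1], by linarith [this.2]⟩
  refine ⟨ε / 2, by linarith, U, hUo.mem_nhds ⟨hpS, Metric.mem_ball_self hε0⟩,
    fun s t x => φ.symm (α ((s, φ x), t - s)).2, hUo, hIJ, ?_, ?_, ?_⟩
  · intro x hx s hs
    refine ⟨?_, fun t ht h hh => ?_⟩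
    · simp only [sub_self]
      rw [hα0 _ (hball' s hs x hx)]
      exact φ.left_inv hx.1
    · obtain ⟨hO', hχ'⟩ := hin s hs t ht x hx
      have h1 : HasDerivAt (fun r => (α ((s, φ x), r)).2)
          (f (α ((s, φ x), t - s))).2 (t - s) :=
        (ContinuousLinearMap.snd ℝ ℝ (EuclideanSpace ℝ (Fin n))).hasFDerivAt.comp_hasDerivAt _
          (hα _ (hball' s hs x hx) _ (htime' s hs t ht))
      have h2 : HasDerivAt (fun r => (α ((s, φ x), r - s)).2)
          (fieldRep (X t) p (α ((s, φ x), t - s)).2) t := by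
        have h3 := h1.scomp t ((hasDerivAt_id t).sub_const s)
        have hfst' := hfst _ (hball' s hs x hx) _ (htime' s hs t ht)
        have hts : (α ((s, φ x), t - s)).1 = t := by rw [hfst']; ring
        simp only [hf, hχ', one_smul, hts] at h3
        exact h3
      have hhd := (((hh.comp_contMDiffOn (contMDiffOn_symm p)).contDiffOn.contDiffAt
        ((isOpen_extChartAt_target (I := 𝓡 n) p).mem_nhds hO'.2)).differentiableAt
          (by simp)).hasFDerivAt
      have h4 := hhd.comp_hasDerivAt t h2
      rw [dirDeriv_eq_fderiv hO'.2 (hh.mdifferentiableAt (by simp))]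
      exact h4
  · refine (contMDiffOn_symm p).comp (t := φ.target)
      (f := fun q : ℝ × M => (α ((s₀, φ q.2), q.1 - s₀)).2) ?_
      fun q hq => (hin s₀ hs₀I q.1 hq.1 q.2 hq.2).1.2
    refine (contDiff_snd.contMDiff (n := ∞)).comp_contMDiffOn (hαs.contMDiffOn.comp (I := 𝓘(ℝ, ℝ).prod (𝓡 n))
      (f := fun q : ℝ × M => ((s₀, φ q.2), q.1 - s₀)) ?_ fun q hq =>
        ⟨hball' s₀ hs₀I q.2 hq.2, htime' s₀ hs₀I q.1 hq.1⟩)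
    have hc : ContMDiffOn (𝓘(ℝ, ℝ).prod (𝓡 n)) 𝓘(ℝ, EuclideanSpace ℝ (Fin n)) ∞
        (fun q : ℝ × M => φ q.2) (I ×ˢ U) :=
      (contMDiffOn_chart p).comp contMDiffOn_snd fun q hq => hq.2.1
    have ht : ContMDiffOn (𝓘(ℝ, ℝ).prod (𝓡 n)) 𝓘(ℝ, ℝ) ∞
        (fun q : ℝ × M => q.1 - s₀) (I ×ˢ U) := contMDiffOn_fst.sub contMDiffOn_const
    exact ((contMDiffOn_const (c := s₀)).prodMk_space hc).prodMk_space ht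
  · refine (contMDiffOn_symm p).comp (t := φ.target)
      (f := fun q : ℝ × M => (α ((q.1, φ q.2), s₀ - q.1)).2) ?_
      fun q hq => (hin q.1 hq.1 s₀ hs₀I q.2 hq.2).1.2
    refine (contDiff_snd.contMDiff (n := ∞)).comp_contMDiffOn (hαs.contMDiffOn.comp (I := 𝓘(ℝ, ℝ).prod (𝓡 n))
      (f := fun q : ℝ × M => ((q.1, φ q.2), s₀ - q.1)) ?_ fun q hq =>
        ⟨hball' q.1 hq.1 q.2 hq.2, htime' q.1 hq.1 s₀ hs₀I⟩)
    have hc : ContMDiffOn (𝓘(ℝ, ℝ).prod (𝓡 n)) 𝓘(ℝ, EuclideanSpace ℝ (Fin n)) ∞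
        (fun q : ℝ × M => φ q.2) (I ×ˢ U) :=
      (contMDiffOn_chart p).comp contMDiffOn_snd fun q hq => hq.2.1
    have ht : ContMDiffOn (𝓘(ℝ, ℝ).prod (𝓡 n)) 𝓘(ℝ, ℝ) ∞
        (fun q : ℝ × M => s₀ - q.1) (I ×ˢ U) := contMDiffOn_const.sub contMDiffOn_fst
    exact (contMDiffOn_fst.prodMk_space hc).prodMk_space ht

end Curves

/-! ### Global flows on a compact manifold. -/

section GlobalFlow

variable {n : ℕ} {M : Type*} [TopologicalSpace M] [ChartedSpace (EuclideanSpace ℝ (Fin n)) M]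
  [IsManifold (𝓡 n) ∞ M]

/-- A time-dependent map `M → M`, smooth on `J × M`. -/
def SmoothMap (n : ℕ) {M : Type*} [TopologicalSpace M] [ChartedSpace (EuclideanSpace ℝ (Fin n)) M]
    [IsManifold (𝓡 n) ∞ M] (J : Set ℝ) (ξ : ℝ → M → M) : Prop :=
  ContMDiffOn (𝓘(ℝ, ℝ).prod (𝓡 n)) (𝓡 n) ∞ (fun q : ℝ × M => ξ q.1 q.2) (J ×ˢ univ)

theorem SmoothMap.contMDiff {J : Set ℝ} {ξ : ℝ → M → M} (hξ : SmoothMap n J ξ) {t : ℝ}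
    (ht : t ∈ J) : ContMDiff (𝓡 n) (𝓡 n) ∞ (ξ t) := by
  rw [← contMDiffOn_univ]
  exact ContMDiffOn.comp (g := fun q : ℝ × M => ξ q.1 q.2) (f := fun x : M => (t, x)) hξ
    (contMDiff_const.prodMk contMDiff_id).contMDiffOn (fun x _ => ⟨ht, mem_univ _⟩)

theorem SmoothMap.comp {J : Set ℝ} {ξ η : ℝ → M → M} (hξ : SmoothMap n J ξ)
    (hη : SmoothMap n J η) : SmoothMap n J fun t x => ξ t (η t x) :=
  ContMDiffOn.comp hξ (contMDiffOn_fst.prodMk hη) fun _ hq => ⟨hq.1, mem_univ _⟩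

theorem smoothMap_const {J : Set ℝ} {a : M → M} (ha : ContMDiff (𝓡 n) (𝓡 n) ∞ a) :
    SmoothMap n J fun _ => a :=
  (ha.comp contMDiff_snd).contMDiffOn

/-- `ξ` is the flow over `I`, based at time `b`, of the time-dependent vector field `X`, and `η` is
its inverse. -/
structure IsFlow (X : ℝ → VField n M) (I : Set ℝ) (b : ℝ) (ξ η : ℝ → M → M) : Prop where
  smooth : SmoothMap n I ξ
  smooth_inv : SmoothMap n I η
  base : ∀ x, ξ b x = x
  left : ∀ t ∈ I, ∀ x, η t (ξ t x) = x
  right : ∀ t ∈ I, ∀ x, ξ t (η t x) = x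
  curve : ∀ x, IsCurve X I fun t => ξ t x

theorem IsFlow.rebase {X : ℝ → VField n M} {I : Set ℝ} {b : ℝ} {ξ η : ℝ → M → M}
    (h : IsFlow X I b ξ η) {c : ℝ} (hc : c ∈ I) :
    IsFlow X I c (fun t x => ξ t (η c x)) fun t x => ξ c (η t x) where
  smooth := h.smooth.comp (smoothMap_const (h.smooth_inv.contMDiff hc))
  smooth_inv := (smoothMap_const (h.smooth.contMDiff hc)).comp h.smooth_inv
  base x := h.right c hc x
  left t ht x := by rw [h.left t ht, h.right c hc]
  right t ht x := by rw [h.left c hc, h.right t ht]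
  curve x := h.curve (η c x)

variable [T2Space M]

theorem IsFlow.agree {X : ℝ → VField n M} {J : Set ℝ} (hJ : IsOpen J) (hX : SmoothTimeField J X)
    {I₁ I₂ : Set ℝ} (ho₁ : IsOpen I₁) (ho₂ : IsOpen I₂) (hp₁ : IsPreconnected I₁)
    (hp₂ : IsPreconnected I₂) (hJ₁ : I₁ ⊆ J) {b : ℝ} (hb₁ : b ∈ I₁) (hb₂ : b ∈ I₂)
    {ξ₁ η₁ ξ₂ η₂ : ℝ → M → M} (h₁ : IsFlow X I₁ b ξ₁ η₁) (h₂ : IsFlow X I₂ b ξ₂ η₂) {t : ℝ}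
    (ht₁ : t ∈ I₁) (ht₂ : t ∈ I₂) (x : M) : ξ₁ t x = ξ₂ t x ∧ η₁ t x = η₂ t x := by
  have hI : IsPreconnected (I₁ ∩ I₂) :=
    (hp₁.ordConnected.inter hp₂.ordConnected).isPreconnected
  have hξ : ∀ x, ξ₁ t x = ξ₂ t x := fun x =>
    IsCurve.eqOn hJ hX (ho₁.inter ho₂) hI (inter_subset_left.trans hJ₁)
      ((h₁.curve x).mono inter_subset_left) ((h₂.curve x).mono inter_subset_right) ⟨hb₁, hb₂⟩
      (by rw [h₁.base, h₂.base]) ⟨ht₁, ht₂⟩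
  refine ⟨hξ x, ?_⟩
  have h := h₁.right t ht₁ x
  rw [hξ] at h
  rw [← h₂.left t ht₂ (η₁ t x), h]

/-- Flows with a common base time agree wherever both are defined, so they glue to a flow over the
union of the intervals. -/
theorem exists_isFlow_iUnion {X : ℝ → VField n M} {J : Set ℝ} (hJ : IsOpen J)
    (hX : SmoothTimeField J X) {A : Type*} {I : A → Set ℝ} (ho : ∀ a, IsOpen (I a))
    (hp : ∀ a, IsPreconnected (I a)) (hIJ : ∀ a, I a ⊆ J) {b : ℝ} (hb : ∀ a, b ∈ I a)
    [Nonempty A] (hf : ∀ a, ∃ ξ η : ℝ → M → M, IsFlow X (I a) b ξ η) :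
    ∃ ξ η : ℝ → M → M, IsFlow X (⋃ a, I a) b ξ η := by
  classical
  choose ξ η hf using hf
  have hidx : ∀ t, ∃ a, t ∈ (⋃ a, I a) → t ∈ I a := by
    intro t
    by_cases ht : t ∈ ⋃ a, I a
    · obtain ⟨a, ha⟩ := mem_iUnion.1 ht
      exact ⟨a, fun _ => ha⟩
    · exact ⟨Classical.arbitrary A, fun h => absurd h ht⟩
  choose c hc using hidx
  have hagree : ∀ a t, t ∈ I a → ∀ x, ξ (c t) t x = ξ a t x ∧ η (c t) t x = η a t x :=
    fun a t ht x => IsFlow.agree hJ hX (ho _) (ho _) (hp _) (hp _) (hIJ _) (hb _) (hb _) (hf _)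
      (hf _) (hc t (mem_iUnion.2 ⟨a, ht⟩)) ht x
  have hsmooth : ∀ (ζ : A → ℝ → M → M), (∀ a, SmoothMap n (I a) (ζ a)) →
      (∀ a t, t ∈ I a → ∀ x, ζ (c t) t x = ζ a t x) →
      SmoothMap n (⋃ a, I a) fun t x => ζ (c t) t x := by
    rintro ζ hζ hag ⟨t, x⟩ ⟨ht, -⟩
    obtain ⟨a, ha⟩ := mem_iUnion.1 ht
    have hn : I a ×ˢ (univ : Set M) ∈ 𝓝 (t, x) :=
      ((ho a).prod isOpen_univ).mem_nhds ⟨ha, mem_univ x⟩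
    refine (((hζ a).contMDiffAt hn).congr_of_eventuallyEq ?_).contMDiffWithinAt
    filter_upwards [hn] with q hq
    exact hag a q.1 hq.1 q.2
  refine ⟨fun t x => ξ (c t) t x, fun t x => η (c t) t x, ?_, ?_, ?_, ?_, ?_, ?_⟩
  · exact hsmooth ξ (fun a => (hf a).smooth) fun a t ht x => (hagree a t ht x).1
  · exact hsmooth η (fun a => (hf a).smooth_inv) fun a t ht x => (hagree a t ht x).2
  · exact fun x => (hf _).base x
  · exact fun t ht x => (hf _).left t (hc t ht) x
  · exact fun t ht x => (hf _).right t (hc t ht) x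
  · intro x t ht
    exact (((hf (c t)).curve x).congr (ho _) fun s hs => (hagree (c t) s hs x).1) t (hc t ht)

variable [CompactSpace M]

/-- Finitely many local flows cover M, hence share a time δ, and by uniqueness they glue. The
inverse is the flow back to s₀, whose smoothness is the other clause of `exists_localFlow`. -/
theorem exists_isFlow_Ioo {X : ℝ → VField n M} {J : Set ℝ} (hJ : IsOpen J)
    (hX : SmoothTimeField J X) {s₀ : ℝ} (hs₀ : s₀ ∈ J) :
    ∃ δ > 0, Ioo (s₀ - δ) (s₀ + δ) ⊆ J ∧
      ∃ ξ η : ℝ → M → M, IsFlow X (Ioo (s₀ - δ) (s₀ + δ)) s₀ ξ η := by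
  choose d hd U hU F hUo hdJ hF hF₁ hF₂ using exists_localFlow (M := M) hJ hX hs₀
  obtain ⟨s, hs⟩ := isCompact_univ.elim_nhds_subcover U fun x _ => hU x
  obtain ⟨ε, hε, hεJ⟩ := Metric.nhds_basis_ball.mem_iff.1 (hJ.mem_nhds hs₀)
  rw [Real.ball_eq_Ioo] at hεJ
  obtain ⟨δ, ⟨hδε, hδd⟩, hδ⟩ : ∃ δ : ℝ, (δ < ε ∧ ∀ i ∈ s, δ < d i) ∧ 0 < δ := by
    have h1 : ∀ᶠ δ in 𝓝[>] (0 : ℝ), δ < ε ∧ ∀ i ∈ s, δ < d i :=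
      mem_nhdsWithin_of_mem_nhds (Filter.Eventually.and (gt_mem_nhds hε)
        ((Filter.eventually_all_finset s).2 fun i _ => gt_mem_nhds (hd i)))
    exact (h1.and self_mem_nhdsWithin).exists
  set I := Ioo (s₀ - δ) (s₀ + δ) with hI
  have hs₀I : s₀ ∈ I := ⟨by linarith, by linarith⟩
  have hIJ : I ⊆ J := (Ioo_subset_Ioo (by linarith) (by linarith)).trans hεJ
  have hId : ∀ i ∈ s, I ⊆ Ioo (s₀ - d i) (s₀ + d i) := fun i hi =>
    Ioo_subset_Ioo (by linarith [hδd i hi]) (by linarith [hδd i hi])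
  have hidx : ∀ x, ∃ i ∈ s, x ∈ U i := fun x => by
    simpa using hs.2 (mem_univ x)
  choose c hcs hcU using hidx
  have hcurve : ∀ i ∈ s, ∀ x ∈ U i, ∀ r ∈ I, IsCurve X I fun t => F i r t x := fun i hi x hx r hr =>
    (hF i x hx r (hId i hi hr)).2.mono (hId i hi)
  have hstart : ∀ i ∈ s, ∀ x ∈ U i, ∀ r ∈ I, F i r r x = x := fun i hi x hx r hr =>
    (hF i x hx r (hId i hi hr)).1
  have huniq : ∀ {γ₁ γ₂ : ℝ → M}, IsCurve X I γ₁ → IsCurve X I γ₂ → ∀ r ∈ I, γ₁ r = γ₂ r →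
      ∀ t ∈ I, γ₁ t = γ₂ t := fun h₁ h₂ r hr h t ht =>
    IsCurve.eqOn hJ hX isOpen_Ioo isPreconnected_Ioo hIJ h₁ h₂ hr h ht
  have hagree : ∀ i ∈ s, ∀ x ∈ U i, ∀ r ∈ I, ∀ t ∈ I, F (c x) r t x = F i r t x :=
    fun i hi x hx r hr t ht => huniq (hcurve _ (hcs x) x (hcU x) r hr) (hcurve i hi x hx r hr) r hr
      (by rw [hstart _ (hcs x) x (hcU x) r hr, hstart i hi x hx r hr]) t ht
  have hsm : ∀ G : M → ℝ → M → M, (∀ i ∈ s, ContMDiffOn (𝓘(ℝ, ℝ).prod (𝓡 n)) (𝓡 n) ∞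
      (fun q : ℝ × M => G i q.1 q.2) (I ×ˢ U i)) →
      (∀ i ∈ s, ∀ x ∈ U i, ∀ t ∈ I, G (c x) t x = G i t x) →
      SmoothMap n I fun t x => G (c x) t x := by
    rintro G hG hag ⟨t, x⟩ ⟨ht, -⟩
    have hn : I ×ˢ U (c x) ∈ 𝓝 (t, x) := (isOpen_Ioo.prod (hUo _)).mem_nhds ⟨ht, hcU x⟩
    refine (((hG _ (hcs x)).contMDiffAt hn).congr_of_eventuallyEq ?_).contMDiffWithinAt
    filter_upwards [hn] with q hq
    exact hag _ (hcs x) q.2 hq.2 q.1 hq.1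
  refine ⟨δ, hδ, hIJ, fun t x => F (c x) s₀ t x, fun t x => F (c x) t s₀ x, ?_, ?_, ?_, ?_, ?_, ?_⟩
  · exact hsm (fun i t x => F i s₀ t x)
      (fun i hi => (hF₁ i).mono (prod_mono_left (hId i hi)))
      fun i hi x hx t ht => hagree i hi x hx s₀ hs₀I t ht
  · exact hsm (fun i t x => F i t s₀ x)
      (fun i hi => (hF₂ i).mono (prod_mono_left (hId i hi)))
      fun i hi x hx t ht => hagree i hi x hx t ht s₀ hs₀I
  · exact fun x => hstart _ (hcs x) x (hcU x) s₀ hs₀I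
  · intro t ht x
    set y := F (c x) s₀ t x with hy
    -- Both curves pass through y at time t, so they also agree at time s₀.
    have := huniq (hcurve _ (hcs y) y (hcU y) t ht) (hcurve _ (hcs x) x (hcU x) s₀ hs₀I) t ht
      (by rw [hstart _ (hcs y) y (hcU y) t ht]) s₀ hs₀I
    rw [this, hstart _ (hcs x) x (hcU x) s₀ hs₀I]
  · intro t ht x
    set y := F (c x) t s₀ x with hy
    have := huniq (hcurve _ (hcs y) y (hcU y) s₀ hs₀I) (hcurve _ (hcs x) x (hcU x) t ht) s₀ hs₀I
      (by rw [hstart _ (hcs y) y (hcU y) s₀ hs₀I]) t ht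
    rw [this, hstart _ (hcs x) x (hcU x) t ht]
  · exact fun x => hcurve _ (hcs x) x (hcU x) s₀ hs₀I

/-- A time-dependent vector field on a compact manifold, smooth over an open interval, has a smooth
flow over this interval. -/
theorem exists_isFlow {X : ℝ → VField n M} {J : Set ℝ} (hJ : IsOpen J) (hJ' : IsPreconnected J)
    (hX : SmoothTimeField J X) {b : ℝ} (hb : b ∈ J) :
    ∃ ξ η : ℝ → M → M, IsFlow X J b ξ η := by
  let A := {I : Set ℝ // IsOpen I ∧ IsPreconnected I ∧ b ∈ I ∧ I ⊆ J ∧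
    ∃ ξ η : ℝ → M → M, IsFlow X I b ξ η}
  obtain ⟨δ, hδ, hδJ, hδf⟩ := exists_isFlow_Ioo (M := M) hJ hX hb
  have : Nonempty A := ⟨⟨_, isOpen_Ioo, isPreconnected_Ioo,
    ⟨by linarith, by linarith⟩, hδJ, hδf⟩⟩
  set U : Set ℝ := ⋃ a : A, a.1 with hU
  have hflow : ∃ ξ η : ℝ → M → M, IsFlow X U b ξ η :=
    exists_isFlow_iUnion hJ hX (I := fun a : A => a.1) (fun a => a.2.1) (fun a => a.2.2.1)
      (fun a => a.2.2.2.2.1) (fun a => a.2.2.2.1) fun a => a.2.2.2.2.2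
  have hUo : IsOpen U := isOpen_iUnion fun a : A => a.2.1
  have hbU : b ∈ U := mem_iUnion.2 ⟨Classical.arbitrary A, (Classical.arbitrary A).2.2.2.1⟩
  have hUJ : U ⊆ J := iUnion_subset fun a => a.2.2.2.2.1
  -- If an interval carrying a flow met the local flow interval around t at a time s, both flows
  -- could be rebased at s, glued, and rebased at b, which would put t in U.
  have hv : IsOpen {t | t ∈ J ∧ t ∉ U} := by
    rw [isOpen_iff_mem_nhds]
    rintro t ⟨htJ, htU⟩
    obtain ⟨ε, hε, hεJ, ξ₂, η₂, h₂⟩ := exists_isFlow_Ioo (M := M) hJ hX htJ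
    have htI : t ∈ Ioo (t - ε) (t + ε) := ⟨by linarith, by linarith⟩
    filter_upwards [isOpen_Ioo.mem_nhds htI] with s hs
    refine ⟨hεJ hs, fun hsU => htU ?_⟩
    obtain ⟨a, ha⟩ := mem_iUnion.1 hsU
    obtain ⟨ho, hp, hba, haJ, ξ₁, η₁, h₁⟩ := a.2
    have hglue := exists_isFlow_iUnion hJ hX (b := s) (A := Bool)
      (I := fun c => if c then a.1 else Ioo (t - ε) (t + ε))
      (by rintro (_ | _) <;> simp [ho, isOpen_Ioo]) (by rintro (_ | _) <;> simp [hp, isPreconnected_Ioo])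
      (by
        rintro (_ | _)
        · simpa using hεJ
        · simpa using haJ)
      (by
        rintro (_ | _)
        · simpa using hs
        · simpa using ha)
      (by
        rintro (_ | _)
        · exact ⟨_, _, by simpa using h₂.rebase hs⟩
        · exact ⟨_, _, by simpa using h₁.rebase ha⟩)
    have hun : (⋃ c : Bool, if c then a.1 else Ioo (t - ε) (t + ε)) = a.1 ∪ Ioo (t - ε) (t + ε) := by
      ext r
      simp [or_comm]
    simp only [hun] at hglue
    obtain ⟨ξ, η, h⟩ := hglue
    have hba' : b ∈ a.1 ∪ Ioo (t - ε) (t + ε) := Or.inl hba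
    exact mem_iUnion.2 ⟨⟨a.1 ∪ Ioo (t - ε) (t + ε), ho.union isOpen_Ioo,
      hp.union s ha hs isPreconnected_Ioo, hba', union_subset haJ hεJ, _, _, h.rebase hba'⟩,
      Or.inr htI⟩
  have hJU : J ⊆ U := hJ'.subset_left_of_subset_union hUo hv
    (disjoint_left.2 fun r hr hr' => hr'.2 hr)
    (fun r hr => by
      by_cases h : r ∈ U
      · exact Or.inl h
      · exact Or.inr ⟨hr, h⟩) ⟨b, hb, hbU⟩
  rwa [hUJ.antisymm hJU] at hflow

end GlobalFlow

/-! ### Velocity fields and transported densities. -/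

section Velocity

variable {n : ℕ} {M : Type*} [TopologicalSpace M] [ChartedSpace (EuclideanSpace ℝ (Fin n)) M]
  [IsManifold (𝓡 n) ∞ M]

theorem SmoothMap.smoothFun {J : Set ℝ} {ξ : ℝ → M → M} (hξ : SmoothMap n J ξ) {f : M → ℝ}
    (hf : ContMDiff (𝓡 n) 𝓘(ℝ, ℝ) ∞ f) : SmoothFun (n := n) J fun t x => f (ξ t x) :=
  (smoothFun_const hf).comp_map hξ

/-- The velocity at time `t` of the path `s ↦ ξ s x`. -/
def pathVelocity (n : ℕ) {M : Type*} [TopologicalSpace M]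
    [ChartedSpace (EuclideanSpace ℝ (Fin n)) M] (ξ : ℝ → M → M) (t : ℝ) (x : M) :
    EuclideanSpace ℝ (Fin n) :=
  mfderiv 𝓘(ℝ, ℝ) (𝓡 n) (fun s => ξ s x) t (1 : ℝ)

theorem dirDeriv_pathVelocity {J : Set ℝ} (hJ : IsOpen J) {ξ : ℝ → M → M} (hξ : SmoothMap n J ξ)
    {f : M → ℝ} (hf : ContMDiff (𝓡 n) 𝓘(ℝ, ℝ) ∞ f) {t : ℝ} (ht : t ∈ J) (x : M) :
    HasDerivAt (fun s => f (ξ s x)) (dirDeriv f (ξ t x) (pathVelocity n ξ t x)) t := by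
  have h1 : ContMDiffAt 𝓘(ℝ, ℝ) (𝓡 n) ∞ (fun s => ξ s x) t :=
    (ContMDiffOn.comp (g := fun q : ℝ × M => ξ q.1 q.2) (f := fun s => (s, x)) hξ
      (contMDiff_id.prodMk contMDiff_const).contMDiffOn
      (fun s hs => ⟨hs, mem_univ _⟩)).contMDiffAt (hJ.mem_nhds ht)
  have h2 := (hf.mdifferentiableAt (x := ξ t x) (by simp)).hasMFDerivAt.comp t
    (h1.mdifferentiableAt (by simp)).hasMFDerivAt
  have h3 : HasFDerivAt (fun s => f (ξ s x)) (show ℝ →L[ℝ] ℝ from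
      (mfderiv (𝓡 n) 𝓘(ℝ, ℝ) f (ξ t x)).comp (mfderiv 𝓘(ℝ, ℝ) (𝓡 n) (fun s => ξ s x) t)) t :=
    h2.hasFDerivAt
  exact h3.hasDerivAt

/-- A smooth family of diffeomorphisms has a smooth velocity field. -/
theorem exists_velocity [T2Space M] {J : Set ℝ} (hJ : IsOpen J) {ξ η : ℝ → M → M}
    (hξ : SmoothMap n J ξ)
    (hη : SmoothMap n J η) (hl : ∀ t ∈ J, ∀ x, η t (ξ t x) = x)
    (hr : ∀ t ∈ J, ∀ x, ξ t (η t x) = x) :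
    ∃ v : ℝ → VField n M, SmoothTimeField J v ∧ ∀ x, IsCurve v J fun t => ξ t x := by
  have hcurve : ∀ x, IsCurve (fun t y => (pathVelocity n ξ t (η t y) : EuclideanSpace ℝ (Fin n)))
      J fun t => ξ t x := by
    intro x t ht f hf
    have h1 := dirDeriv_pathVelocity hJ hξ hf ht x
    have h2 : pathVelocity n ξ t (η t (ξ t x)) = pathVelocity n ξ t x := by rw [hl t ht]
    simp only [h2]
    exact h1
  refine ⟨_, smoothTimeField_of_dirDeriv fun f hf => ?_, hcurve⟩
  refine (((hξ.smoothFun hf).dt hJ).comp_map hη).congr fun t ht y => ?_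
  have key : ∀ z, z = y → dirDeriv f y (pathVelocity n ξ t (η t y)) =
      dirDeriv f z (pathVelocity n ξ t (η t z)) := by
    rintro _ rfl
    rfl
  exact (key _ (hr t ht y)).trans (hcurve (η t y) t ht f hf).deriv.symm

theorem hasDerivAt_diag {G : ℝ × ℝ → ℝ} {t a b : ℝ} (hG : DifferentiableAt ℝ G (t, t))
    (ha : HasDerivAt (fun s => G (s, t)) a t) (hb : HasDerivAt (fun r => G (t, r)) b t) :
    HasDerivAt (fun s => G (s, s)) (a + b) t := by
  have h1 := hG.hasFDerivAt.comp_hasDerivAt (f := fun s : ℝ => (s, t)) t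
    ((hasDerivAt_id t).prodMk (hasDerivAt_const t t))
  have h2 := hG.hasFDerivAt.comp_hasDerivAt (f := fun s : ℝ => (t, s)) t
    ((hasDerivAt_const t t).prodMk (hasDerivAt_id t))
  have h3 := hG.hasFDerivAt.comp_hasDerivAt (f := fun s : ℝ => (s, s)) t
    ((hasDerivAt_id t).prodMk (hasDerivAt_id t))
  have e1 := ha.unique h1
  have e2 := hb.unique h2
  have e3 : fderiv ℝ G (t, t) (1, 1) = a + b := by
    rw [e1, e2, ← map_add]
    simp
  rw [← e3]
  exact h3

/-- The material derivative along a smooth family of integral curves. -/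
theorem hasDerivAt_material {J : Set ℝ} (hJ : IsOpen J) {X : ℝ → VField n M} {ξ : ℝ → M → M}
    (hξ : SmoothMap n J ξ) (hc : ∀ x, IsCurve X J fun t => ξ t x) {F : ℝ → M → ℝ}
    (hF : SmoothFun (n := n) J F) {t : ℝ} (ht : t ∈ J) (x : M) :
    HasDerivAt (fun s => F s (ξ s x))
      (deriv (fun s => F s (ξ t x)) t + dirDeriv (F t) (ξ t x) (X t (ξ t x))) t := by
  refine hasDerivAt_diag (G := fun z : ℝ × ℝ => F z.1 (ξ z.2 x)) ?_
    (hF.hasDerivAt hJ ht (ξ t x)) (hc x t ht (F t) (hF.contMDiff ht))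
  have h1 : ContMDiffOn (𝓘(ℝ, ℝ).prod 𝓘(ℝ, ℝ)) 𝓘(ℝ, ℝ) ∞ (fun z : ℝ × ℝ => F z.1 (ξ z.2 x))
      (J ×ˢ J) := by
    refine ContMDiffOn.comp (g := fun q : ℝ × M => F q.1 q.2)
      (f := fun z : ℝ × ℝ => (z.1, ξ z.2 x)) hF (contMDiffOn_fst.prodMk ?_)
      fun z hz => ⟨hz.1, mem_univ _⟩
    exact ContMDiffOn.comp (g := fun q : ℝ × M => ξ q.1 q.2) (f := fun z : ℝ × ℝ => (z.2, x)) hξ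
      (contMDiffOn_snd.prodMk contMDiffOn_const) fun z hz => ⟨hz.2, mem_univ _⟩
  rw [← modelWithCornersSelf_prod, chartedSpaceSelf_prod, contMDiffOn_iff_contDiffOn] at h1
  exact (h1.contDiffAt ((hJ.prod hJ).mem_nhds ⟨ht, ht⟩)).differentiableAt (by simp)

/-- The inverse of a flow transports functions along the flow. -/
theorem IsFlow.deriv_inv {J : Set ℝ} (hJ : IsOpen J) {X : ℝ → VField n M} {b : ℝ}
    {ξ η : ℝ → M → M} (h : IsFlow X J b ξ η) {f : M → ℝ} (hf : ContMDiff (𝓡 n) 𝓘(ℝ, ℝ) ∞ f)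
    {t : ℝ} (ht : t ∈ J) (y : M) :
    deriv (fun s => f (η s y)) t = -dirDeriv (fun z => f (η t z)) y (X t y) := by
  have h1 := hasDerivAt_material hJ h.smooth h.curve (h.smooth_inv.smoothFun hf) ht (η t y)
  have h2 : HasDerivAt (fun s => f (η s (ξ s (η t y)))) 0 t := by
    refine (hasDerivAt_const t (f (η t y))).congr_of_eventuallyEq ?_
    filter_upwards [hJ.mem_nhds ht] with s hs
    rw [h.left s hs]
  have h3 := h1.unique h2
  rw [h.right t ht] at h3
  linarith

variable [T2Space M] [CompactSpace M] [MeasurableSpace M] [BorelSpace M]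

/-- If `w` solves the continuity equation for `X`, then `w_t μ` is transported by the flow of `X`. -/
theorem integral_inv_mul_density (g : Metric n M) {J : Set ℝ} (hJ : IsOpen J)
    (hJ' : IsPreconnected J) {X : ℝ → VField n M} (hX : SmoothTimeField J X) {b : ℝ} (hb : b ∈ J)
    {ξ η : ℝ → M → M} (h : IsFlow X J b ξ η) {w : ℝ → M → ℝ} (hw : SmoothFun (n := n) J w)
    (hwb : ∀ x, w b x = 1)
    (hwX : ∀ t ∈ J, ∀ x, deriv (fun s => w s x) t + divergence g (fun x => w t x • X t x) x = 0)
    {f : M → ℝ} (hf : ContMDiff (𝓡 n) 𝓘(ℝ, ℝ) ∞ f) :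
    ∀ t ∈ J, HasDerivAt (fun s => ∫ x, f (η s x) * w s x ∂(vol g)) 0 t ∧
      ∫ x, f (η t x) * w t x ∂(vol g) = ∫ x, f x ∂(vol g) := by
  have hfη := h.smooth_inv.smoothFun hf
  have hd : ∀ t ∈ J, HasDerivAt (fun s => ∫ x, f (η s x) * w s x ∂(vol g)) 0 t := by
    intro t ht
    have h1 := hasDerivAt_integral_vol g hJ (hfη.mul hw) ht
    have hwXt : SmoothField fun x => w t x • X t x := (hX.smul hw).smoothField ht
    -- By the transport equation for f ∘ η and the continuity equation for w, the integrand is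
    -- -div((f ∘ η) w X), which integrates to zero.
    have h2 : ∀ x, deriv (fun s => f (η s x) * w s x) t =
        -(dirDeriv (fun z => f (η t z)) x (w t x • X t x) +
          f (η t x) * divergence g (fun x => w t x • X t x) x) := by
      intro x
      rw [((hfη.hasDerivAt hJ ht x).fun_mul (hw.hasDerivAt hJ ht x)).deriv, h.deriv_inv hJ hf ht,
        dirDeriv_smul, eq_neg_of_add_eq_zero_left (hwX t ht x)]
      ring
    have hft := hfη.contMDiff ht
    have h3 := integral_mul_divergence g hwXt hft
    simp only [h2] at h1
    rw [integral_neg, integral_add (integrable_vol g (continuous_dirDeriv hft hwXt))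
      (integrable_vol g (hft.continuous.fun_mul (contMDiff_divergence g hwXt).continuous)), h3,
      add_neg_cancel, neg_zero] at h1
    exact h1
  refine fun t ht => ⟨hd t ht, ?_⟩
  have h1 := hJ.is_const_of_deriv_eq_zero hJ'
    (fun s hs => (hd s hs).differentiableAt.differentiableWithinAt)
    (fun s hs => (hd s hs).deriv) ht hb
  refine h1.trans ?_
  have hηb : ∀ x, η b x = x := fun x => by
    conv_lhs => rw [← h.base x]
    rw [h.left b hb]
  simp only [hwb, hηb, mul_one]

/-- The divergence of the velocity of the inverse flow is the logarithmic derivative of the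
transported density. -/
theorem divergence_inverse_velocity (g : Metric n M) {J : Set ℝ} (hJ : IsOpen J)
    (hJ' : IsPreconnected J) {X : ℝ → VField n M} (hX : SmoothTimeField J X) {b : ℝ} (hb : b ∈ J)
    {ξ η : ℝ → M → M} (h : IsFlow X J b ξ η) {w : ℝ → M → ℝ} (hw : SmoothFun (n := n) J w)
    (hw0 : ∀ t ∈ J, ∀ x, w t x ≠ 0) (hwb : ∀ x, w b x = 1)
    (hwX : ∀ t ∈ J, ∀ x, deriv (fun s => w s x) t + divergence g (fun x => w t x • X t x) x = 0)
    {v : ℝ → VField n M} (hv : SmoothTimeField J v) (hηv : ∀ x, IsCurve v J fun t => η t x)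
    {t : ℝ} (ht : t ∈ J) (x : M) :
    divergence g (v t) x = deriv (fun s => w s (ξ t x)) t * (w t (ξ t x))⁻¹ := by
  have hratio : ContMDiff (𝓡 n) 𝓘(ℝ, ℝ) ∞
      fun x => deriv (fun s => w s (ξ t x)) t * (w t (ξ t x))⁻¹ :=
    (((hw.dt hJ).mul (hw.inv hw0)).contMDiff ht).comp (h.smooth.contMDiff ht)
  refine divergence_eq_of_forall_integral g (hv.smoothField ht) hratio.continuous
    (fun f hf => ?_) x
  have hvt := hv.smoothField ht
  -- Differentiating ∫ (f ∘ η) w = ∫ f gives ∫ ⟨v, ∇f⟩ ∘ η · w + ∫ (f ∘ η) ∂ₜw = 0. Transporting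
  -- both terms back to μ turns this into the weak form of div v = (∂ₜw / w) ∘ ξ.
  have h1 := (integral_inv_mul_density g hJ hJ' hX hb h hw hwb hwX (hf.mul hratio) t ht).2
  have h2 := (integral_inv_mul_density g hJ hJ' hX hb h hw hwb hwX
    (contMDiff_dirDeriv hf hvt) t ht).2
  have h3 := (integral_inv_mul_density g hJ hJ' hX hb h hw hwb hwX hf t ht).1
  have hfη := h.smooth_inv.smoothFun hf
  have h4 := h3.unique (hasDerivAt_integral_vol g hJ (hfη.mul hw) ht)
  have h5 : ∀ x, deriv (fun s => f (η s x) * w s x) t =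
      dirDeriv f (η t x) (v t (η t x)) * w t x + f (η t x) * deriv (fun s => w s x) t := by
    intro x
    exact ((hηv x t ht f hf).fun_mul (hw.hasDerivAt hJ ht x)).deriv
  simp only [h5] at h4
  have hc1 : Continuous fun x => dirDeriv f (η t x) (v t (η t x)) * w t x :=
    ((continuous_dirDeriv hf hvt).comp (h.smooth_inv.contMDiff ht).continuous).mul
      (hw.contMDiff ht).continuous
  have hc2 : Continuous fun x => f (η t x) * deriv (fun s => w s x) t :=
    (hfη.contMDiff ht).continuous.mul ((hw.dt hJ).contMDiff ht).continuous
  rw [integral_add (integrable_vol g hc1) (integrable_vol g hc2), h2] at h4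
  have h6 : ∀ x, (f * fun x => deriv (fun s => w s (ξ t x)) t * (w t (ξ t x))⁻¹) (η t x) * w t x =
      f (η t x) * deriv (fun s => w s x) t := by
    intro x
    simp only [Pi.mul_apply, h.right t ht]
    have := hw0 t ht x
    field_simp
  simp only [h6] at h1
  rw [h1] at h4
  simp only [Pi.mul_apply] at h4
  linarith

end Velocity

/-! ### Moser's construction of solutions from the density φ². -/

section Transport

variable {n : ℕ} {M : Type*} [TopologicalSpace M] [ChartedSpace (EuclideanSpace ℝ (Fin n)) M]
  [IsManifold (𝓡 n) ∞ M]

/-- The solution `φ` of `φ'' = -κ² φ` with `φ = 1` and `φ' = κ τ` at time `b`. -/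
def amplitude (κ b : ℝ) (τ : M → ℝ) (t : ℝ) (x : M) : ℝ :=
  cos (κ * (t - b)) + τ x * sin (κ * (t - b))

/-- The time derivative of the amplitude. -/
def amplitudeDeriv (κ b : ℝ) (τ : M → ℝ) (t : ℝ) (x : M) : ℝ :=
  κ * (τ x * cos (κ * (t - b)) - sin (κ * (t - b)))

theorem hasDerivAt_amplitude (κ b : ℝ) (τ : M → ℝ) (t : ℝ) (x : M) :
    HasDerivAt (fun s => amplitude κ b τ s x) (amplitudeDeriv κ b τ t x) t := by
  have h1 : HasDerivAt (fun s => κ * (s - b)) κ t := by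
    simpa using ((hasDerivAt_id t).sub_const b).const_mul κ
  refine (h1.cos.add (h1.sin.const_mul (τ x))).congr_deriv ?_
  rw [amplitudeDeriv]
  ring

theorem hasDerivAt_amplitudeDeriv (κ b : ℝ) (τ : M → ℝ) (t : ℝ) (x : M) :
    HasDerivAt (fun s => amplitudeDeriv κ b τ s x) (-κ ^ 2 * amplitude κ b τ t x) t := by
  have h1 : HasDerivAt (fun s => κ * (s - b)) κ t := by
    simpa using ((hasDerivAt_id t).sub_const b).const_mul κ
  refine (((h1.cos.const_mul (τ x)).sub h1.sin).const_mul κ).congr_deriv ?_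
  rw [amplitude]
  ring

theorem smoothFun_amplitude {J : Set ℝ} (κ b : ℝ) {τ : M → ℝ} (hτ : ContMDiff (𝓡 n) 𝓘(ℝ, ℝ) ∞ τ) :
    SmoothFun (n := n) J (amplitude κ b τ) := by
  have h1 : ContDiff ℝ ∞ fun t : ℝ => κ * (t - b) := contDiff_const.mul (contDiff_id.sub contDiff_const)
  exact (smoothFun_time h1.cos.contDiffOn).add
    ((smoothFun_const hτ).mul (smoothFun_time h1.sin.contDiffOn))

theorem hasDerivAt_amplitude_sq (κ b : ℝ) (τ : M → ℝ) (t : ℝ) (x : M) :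
    HasDerivAt (fun s => amplitude κ b τ s x * amplitude κ b τ s x)
      (2 * amplitude κ b τ t x * amplitudeDeriv κ b τ t x) t := by
  have h := hasDerivAt_amplitude κ b τ t x
  refine (h.fun_mul h).congr_deriv ?_
  ring

theorem amplitude_base (κ b : ℝ) (τ : M → ℝ) (x : M) : amplitude κ b τ b x = 1 := by
  simp [amplitude]

variable [T2Space M] [CompactSpace M] [MeasurableSpace M] [BorelSpace M]

theorem vol_real_univ_pos [Nonempty M] (g : Metric n M) : 0 < (vol g).real univ :=
  ENNReal.toReal_pos (isOpen_univ.measure_pos _ univ_nonempty).ne' (measure_ne_top _ _)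

/-- A smooth field whose divergence solves the Riccati equation has constant `∫ (div v)²`. -/
theorem integral_divergence_sq_of_riccati (g : Metric n M) {J : Set ℝ} (hJ : IsOpen J)
    {v : ℝ → VField n M} (hv : SmoothTimeField J v) {κ t : ℝ} (ht : t ∈ J)
    (h : ∀ x, deriv (fun s => divergence g (v s) x) t + dirDeriv (divergence g (v t)) x (v t x)
      + (1 / 2) * divergence g (v t) x ^ 2 = -(2 * κ ^ 2)) :
    ∫ x, divergence g (v t) x ^ 2 ∂(vol g) = 4 * κ ^ 2 * (vol g).real univ := by
  have hk := smoothFun_divergence g hJ.uniqueDiffOn hv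
  have hvt := hv.smoothField ht
  have hkt := contMDiff_divergence g hvt
  -- The Riccati equation is integrated over M: the time term vanishes since every divergence has
  -- zero mean, and the transport term equals -∫ (div v)².
  have h1 : ∫ x, deriv (fun s => divergence g (v s) x) t ∂(vol g) = 0 := by
    refine (hasDerivAt_integral_vol g hJ hk ht).unique
      ((hasDerivAt_const t (0 : ℝ)).congr_of_eventuallyEq ?_)
    filter_upwards [hJ.mem_nhds ht] with s hs
    exact integral_divergence g (hv.smoothField hs)
  have h2 := integral_mul_divergence g hvt hkt
  have i1 := integrable_vol g ((hk.dt hJ).contMDiff ht).continuous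
  have i2 := integrable_vol g (continuous_dirDeriv hkt hvt)
  have i3 := integrable_vol g (hkt.continuous.fun_pow 2)
  have h3 : ∫ x, (deriv (fun s => divergence g (v s) x) t + dirDeriv (divergence g (v t)) x (v t x)
      + (1 / 2) * divergence g (v t) x ^ 2) ∂(vol g) = ∫ _x : M, -(2 * κ ^ 2) ∂(vol g) := by
    simp only [h]
  rw [integral_add (i1.fun_add i2) (i3.const_mul _), integral_add i1 i2, h1, integral_const_mul,
    integral_const] at h3
  simp only [← pow_two] at h2
  rw [smul_eq_mul] at h3
  linarith

/-- Moser's construction: a field `X` realising the density `φ²` by its flow yields a solution `v`,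
the velocity of the inverse flow. -/
theorem exists_solution_of_transport (g : Metric n M) {J : Set ℝ} (hJ : IsOpen J)
    (hJ' : IsPreconnected J) {κ b : ℝ} (hb : b ∈ J) {τ : M → ℝ}
    (hτ : ContMDiff (𝓡 n) 𝓘(ℝ, ℝ) ∞ τ) (hφ : ∀ t ∈ J, ∀ x, amplitude κ b τ t x ≠ 0)
    {X : ℝ → VField n M} (hX : SmoothTimeField J X)
    (hwX : ∀ t ∈ J, ∀ x, 2 * amplitude κ b τ t x * amplitudeDeriv κ b τ t x +
      divergence g (fun x => (amplitude κ b τ t x * amplitude κ b τ t x) • X t x) x = 0) :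
    ∃ (ξ η : ℝ → M → M) (v : ℝ → VField n M), IsFlow X J b ξ η ∧ SmoothTimeField J v ∧
      (∀ x, IsCurve v J fun t => η t x) ∧
      (∀ t ∈ J, ∀ x, divergence g (v t) x =
        2 * amplitudeDeriv κ b τ t (ξ t x) * (amplitude κ b τ t (ξ t x))⁻¹) ∧
      ∀ t ∈ J, ∀ x, deriv (fun s => divergence g (v s) x) t
        + dirDeriv (divergence g (v t)) x (v t x)
        + (1 / 2) * divergence g (v t) x ^ 2 = -(2 * κ ^ 2) := by
  obtain ⟨ξ, η, h⟩ := exists_isFlow hJ hJ' hX hb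
  obtain ⟨v, hv, hηv⟩ := exists_velocity hJ h.smooth_inv h.smooth h.right h.left
  have hA := smoothFun_amplitude (J := J) κ b hτ
  have hdiv : ∀ t ∈ J, ∀ x, divergence g (v t) x =
      2 * amplitudeDeriv κ b τ t (ξ t x) * (amplitude κ b τ t (ξ t x))⁻¹ := by
    intro t ht x
    rw [divergence_inverse_velocity g hJ hJ' hX hb h (hA.mul hA)
      (fun t ht x => mul_self_ne_zero.2 (hφ t ht x)) (fun x => by rw [amplitude_base, one_mul])
      (fun t ht x => by rw [(hasDerivAt_amplitude_sq κ b τ t x).deriv]; exact hwX t ht x) hv hηv ht,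
      (hasDerivAt_amplitude_sq κ b τ t (ξ t x)).deriv]
    have := hφ t ht (ξ t x)
    field_simp
  refine ⟨ξ, η, v, h, hv, hηv, hdiv, fun t ht x => ?_⟩
  have hk := smoothFun_divergence g hJ.uniqueDiffOn hv
  have h1 := hasDerivAt_material hJ h.smooth_inv hηv hk ht (ξ t x)
  rw [h.left t ht] at h1
  have hφx := hφ t ht (ξ t x)
  -- Along the trajectory labelled by ξ t x the divergence is the explicit function 2φ'/φ of time,
  -- and φ'' = -κ²φ makes it satisfy the Riccati equation.
  have h2 : HasDerivAt (fun s => 2 * amplitudeDeriv κ b τ s (ξ t x) *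
      (amplitude κ b τ s (ξ t x))⁻¹)
      (2 * (-κ ^ 2 * amplitude κ b τ t (ξ t x)) * (amplitude κ b τ t (ξ t x))⁻¹ +
        2 * amplitudeDeriv κ b τ t (ξ t x) *
          (-amplitudeDeriv κ b τ t (ξ t x) / amplitude κ b τ t (ξ t x) ^ 2)) t :=
    ((hasDerivAt_amplitudeDeriv κ b τ t (ξ t x)).const_mul 2).fun_mul
      ((hasDerivAt_amplitude κ b τ t (ξ t x)).fun_inv hφx)
  have h3 := h1.unique (h2.congr_of_eventuallyEq (by
    filter_upwards [hJ.mem_nhds ht] with s hs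
    rw [hdiv s hs, h.right s hs]))
  rw [h3, hdiv t ht]
  field_simp
  ring

/-- The transport equation for the density `φ²` is solvable. -/
theorem exists_transport_field [ConnectedSpace M] (g : Metric n M) {J : Set ℝ}
    {κ b : ℝ} (hκ : κ ≠ 0) {u : VField n M} (hu : SmoothField u)
    (hκu : ∫ x, divergence g u x ^ 2 ∂(vol g) = 4 * κ ^ 2 * (vol g).real univ)
    (hφ : ∀ t ∈ J, ∀ x, amplitude κ b (fun x => divergence g u x / (2 * κ)) t x ≠ 0) :
    ∃ X : ℝ → VField n M, SmoothTimeField J X ∧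
      (b ∈ J → ∀ x, X b x = -u x) ∧
      ∀ t ∈ J, ∀ x, 2 * amplitude κ b (fun x => divergence g u x / (2 * κ)) t x *
        amplitudeDeriv κ b (fun x => divergence g u x / (2 * κ)) t x +
        divergence g (fun x => (amplitude κ b (fun x => divergence g u x / (2 * κ)) t x *
          amplitude κ b (fun x => divergence g u x / (2 * κ)) t x) • X t x) x = 0 := by
  set τ : M → ℝ := fun x => divergence g u x / (2 * κ) with hτdef
  have hτ : ContMDiff (𝓡 n) 𝓘(ℝ, ℝ) ∞ τ := by
    have := (contMDiff_divergence g hu).mul (contMDiff_const (c := (2 * κ)⁻¹))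
    simp only [hτdef, div_eq_mul_inv]
    exact this
  have hf : ContMDiff (𝓡 n) 𝓘(ℝ, ℝ) ∞ fun x => τ x * τ x - 1 := (hτ.mul hτ).sub contMDiff_const
  -- The normalisation of κ says precisely that τ² has mean one.
  have hf0 : ∫ x, (τ x * τ x - 1) ∂(vol g) = 0 := by
    have h1 : ∀ x, τ x * τ x = (4 * κ ^ 2)⁻¹ * divergence g u x ^ 2 := by
      intro x
      simp only [hτdef]
      field_simp
      ring
    rw [integral_sub (integrable_vol g (hτ.continuous.fun_mul hτ.continuous)) (integrable_const 1)]
    simp only [h1]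
    rw [integral_const_mul, hκu, integral_const]
    simp only [smul_eq_mul, mul_one]
    field_simp
    ring
  obtain ⟨W, hW, hWd⟩ := exists_divergence_eq g hf hf0
  have h1 : ContDiff ℝ ∞ fun t : ℝ => 2 * (κ * (t - b)) :=
    contDiff_const.mul (contDiff_const.mul (contDiff_id.sub contDiff_const))
  -- With θ = κ(t - b), 2φφ' = 2κτ cos 2θ + κ(τ² - 1) sin 2θ. Here 2κτ = div u and τ² - 1 = div W,
  -- so Y has divergence ∂ₜφ² and is explicit and smooth in time.
  set Y : ℝ → VField n M := fun t x =>
    cos (2 * (κ * (t - b))) • u x + (κ * sin (2 * (κ * (t - b)))) • W x with hY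
  have hYs : SmoothTimeField J Y :=
    ((smoothTimeField_const hu).smul (smoothFun_time h1.cos.contDiffOn)).add
      ((smoothTimeField_const hW).smul
        (smoothFun_time (contDiff_const.mul h1.sin).contDiffOn))
  have hA := smoothFun_amplitude (J := J) κ b hτ
  have hA0 : ∀ t ∈ J, ∀ x, amplitude κ b τ t x * amplitude κ b τ t x ≠ 0 := fun t ht x =>
    mul_self_ne_zero.2 (hφ t ht x)
  have hYd : ∀ t x, divergence g (Y t) x =
      2 * amplitude κ b τ t x * amplitudeDeriv κ b τ t x := by
    intro t x
    rw [hY, divergence_add g (hu.const_smul _) (hW.const_smul _), divergence_const_smul g hu,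
      divergence_const_smul g hW, hWd, amplitude, amplitudeDeriv, sin_two_mul, cos_two_mul']
    have : divergence g u x = 2 * κ * τ x := by
      simp only [hτdef]
      field_simp
    rw [this]
    ring
  -- X = -Y/φ² solves the transport equation. At time b it equals -u, which gives the inverse flow
  -- initial velocity u.
  refine ⟨fun t x => (-(amplitude κ b τ t x * amplitude κ b τ t x)⁻¹) • Y t x,
    hYs.smul ((((hA.mul hA).inv hA0).comp_contDiffAt (a := fun s => -s)
      fun _ _ _ => contDiffAt_id.neg)), fun _ x => ?_, fun t ht x => ?_⟩
  · simp [hY, amplitude_base]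
  · have hX : (fun x => (amplitude κ b τ t x * amplitude κ b τ t x) •
        (-(amplitude κ b τ t x * amplitude κ b τ t x)⁻¹) • Y t x) = fun x => (-1 : ℝ) • Y t x := by
      ext1 x
      rw [smul_smul, mul_neg, mul_inv_cancel₀ (hA0 t ht x)]
    rw [hX, divergence_const_smul g (hYs.smoothField ht), hYd]
    ring

end Transport

/-! ### The amplitude in terms of its phase. -/

section Trigonometry

variable {M : Type*}

theorem cos_arctan_mul (s : ℝ) : s * cos (arctan s) = sin (arctan s) := by
  conv_lhs => rw [← tan_arctan s]
  rw [arctan_tan (neg_pi_div_two_lt_arctan _) (arctan_lt_pi_div_two _)]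
  exact tan_mul_cos (cos_arctan_pos s).ne'

/-- Phase form: with a = arctan τ, φ = cos(a - κ(t - b)) / cos a, so the sign of φ is read off from
the phase. -/
theorem amplitude_mul_cos_arctan (κ b : ℝ) (τ : M → ℝ) (t : ℝ) (x : M) :
    amplitude κ b τ t x * cos (arctan (τ x)) = cos (arctan (τ x) - κ * (t - b)) := by
  rw [amplitude, cos_sub, ← cos_arctan_mul]
  ring

theorem amplitudeDeriv_mul_cos_arctan (κ b : ℝ) (τ : M → ℝ) (t : ℝ) (x : M) :
    amplitudeDeriv κ b τ t x * cos (arctan (τ x)) = κ * sin (arctan (τ x) - κ * (t - b)) := by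
  rw [amplitudeDeriv, sin_sub, ← cos_arctan_mul]
  ring

theorem amplitude_pos {κ b : ℝ} {τ : M → ℝ} {t : ℝ} {x : M}
    (h1 : -(π / 2) < arctan (τ x) - κ * (t - b)) (h2 : arctan (τ x) - κ * (t - b) < π / 2) :
    0 < amplitude κ b τ t x := by
  have h := cos_pos_of_mem_Ioo ⟨h1, h2⟩
  rw [← amplitude_mul_cos_arctan] at h
  exact pos_of_mul_pos_left h (cos_arctan_pos _).le

/-- This is h = 2κ tan(phase) = 2φ'/φ, multiplied out so that φ ≠ 0 is not needed. It links a
solution with the conserved phase to the amplitude. -/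
theorem mul_amplitude_eq {κ b : ℝ} (hκ : κ ≠ 0) {τ : M → ℝ} {t : ℝ} {x : M} {h : ℝ}
    (hh : arctan (h / (2 * κ)) = arctan (τ x) - κ * (t - b)) :
    h * amplitude κ b τ t x = 2 * amplitudeDeriv κ b τ t x := by
  have hc := (cos_arctan_pos (τ x)).ne'
  rw [← mul_left_inj' hc, mul_assoc, amplitude_mul_cos_arctan, mul_assoc,
    amplitudeDeriv_mul_cos_arctan, ← hh, ← cos_arctan_mul]
  field_simp

end Trigonometry

/-! ### Conservation laws for smooth solutions. -/

section SmoothSolution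

variable {n : ℕ} {M : Type*} [TopologicalSpace M] [ChartedSpace (EuclideanSpace ℝ (Fin n)) M]
  [IsManifold (𝓡 n) ∞ M] [T2Space M] [CompactSpace M] [MeasurableSpace M] [BorelSpace M]

theorem integral_divergence_sq_eq [Nonempty M] (g : Metric n M) (u₀ : VField n M) :
    ∫ x, divergence g u₀ x ^ 2 ∂(vol g) = 4 * kappa g u₀ ^ 2 * (vol g).real univ := by
  have hV := vol_real_univ_pos g
  have h0 : 0 ≤ ∫ x, divergence g u₀ x ^ 2 ∂(vol g) := integral_nonneg fun x => sq_nonneg _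
  rw [kappa, sq_sqrt (by positivity)]
  field_simp

theorem kappa_pos (g : Metric n M) {u₀ : VField n M} (hu₀ : SmoothField u₀)
    (hdiv : ∃ x, divergence g u₀ x ≠ 0) : 0 < kappa g u₀ := by
  obtain ⟨x, hx⟩ := hdiv
  have : Nonempty M := ⟨x⟩
  have hV := vol_real_univ_pos g
  have hpos : 0 < ∫ x, divergence g u₀ x ^ 2 ∂(vol g) :=
    ((contMDiff_divergence g hu₀).continuous.fun_pow 2).integral_pos_of_hasCompactSupport_nonneg_nonzero
      (x := x) (HasCompactSupport.of_compactSpace _) (fun x => sq_nonneg _) (pow_ne_zero 2 hx)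
  rw [kappa, sqrt_pos]
  exact mul_pos (by positivity) hpos

variable {g : Metric n M} {u₀ : VField n M} {T : ℝ} {u : ℝ → VField n M}

theorem IsSmoothSolution.smoothFun_divergence (h : IsSmoothSolution g u₀ T u) :
    SmoothFun (n := n) (Ico 0 T) fun t => divergence g (u t) :=
  FisherRao.smoothFun_divergence g (uniqueDiffOn_Ico 0 T) h.smooth

theorem IsSmoothSolution.smoothTimeField (h : IsSmoothSolution g u₀ T u) :
    SmoothTimeField (Ioo 0 T) u :=
  SmoothTimeField.mono (J := Ico 0 T) h.smooth Ioo_subset_Ico_self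

theorem IsSmoothSolution.deriv_eq (h : IsSmoothSolution g u₀ T u) {t : ℝ} (ht : t ∈ Ioo 0 T)
    (x : M) : deriv (fun s => divergence g (u s) x) t =
      -(1 / (2 * (vol g).real univ)) * (∫ z, divergence g (u t) z ^ 2 ∂(vol g))
        - dirDeriv (divergence g (u t)) x (u t x) - (1 / 2) * divergence g (u t) x ^ 2 := by
  obtain ⟨ht', h1, h2⟩ := h.equation t (Ioo_subset_Ico_self ht) x
  rw [(h1.hasDerivAt (Ici_mem_nhds ht.1)).deriv]
  linarith

/-- Multiply the equation by 2h and integrate. The right-hand side contributes a multiple of ∫ h =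
0, and ∫ ⟨u, ∇h²⟩ = -∫ h³ cancels the cubic term. -/
theorem IsSmoothSolution.hasDerivAt_integral_sq (h : IsSmoothSolution g u₀ T u) {t : ℝ}
    (ht : t ∈ Ioo 0 T) : HasDerivAt (fun s => ∫ z, divergence g (u s) z ^ 2 ∂(vol g)) 0 t := by
  have hk := h.smoothFun_divergence.mono Ioo_subset_Ico_self
  have hut := h.smoothTimeField.smoothField ht
  have hkt := contMDiff_divergence g hut
  have h1 := hasDerivAt_integral_vol g isOpen_Ioo (hk.mul hk) ht
  simp only [← pow_two] at h1
  refine h1.congr_deriv ?_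
  set c := -(1 / (2 * (vol g).real univ)) * (∫ z, divergence g (u t) z ^ 2 ∂(vol g)) with hc
  have h2 : ∀ x, deriv (fun s => divergence g (u s) x ^ 2) t =
      2 * c * divergence g (u t) x - (dirDeriv (fun y => divergence g (u t) y * divergence g (u t) y)
        x (u t x) + (divergence g (u t) x * divergence g (u t) x) * divergence g (u t) x) := by
    intro x
    have hd := hk.hasDerivAt isOpen_Ioo ht x
    rw [h.deriv_eq ht x] at hd
    have hd2 := hd.fun_pow 2
    rw [hd2.deriv, dirDeriv_mul (hkt.mdifferentiableAt (by simp)) (hkt.mdifferentiableAt (by simp))]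
    simp only [Nat.cast_ofNat, Nat.add_one_sub_one, pow_one]
    ring
  have hkk : ContMDiff (𝓡 n) 𝓘(ℝ, ℝ) ∞ fun y => divergence g (u t) y * divergence g (u t) y :=
    hkt.mul hkt
  have i1 := integrable_vol g hkt.continuous
  have i2 := integrable_vol g (continuous_dirDeriv hkk hut)
  have i3 := integrable_vol g (hkk.continuous.fun_mul hkt.continuous)
  have h3 := integral_mul_divergence g hut hkk
  simp only [h2]
  rw [integral_sub (i1.const_mul _) (i2.fun_add i3), integral_const_mul, integral_divergence g hut,
    integral_add i2 i3, h3]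
  ring

/-- The integral is constant on the open interval; continuity up to t = 0 identifies the constant
with the initial value. -/
theorem IsSmoothSolution.integral_sq [Nonempty M] (h : IsSmoothSolution g u₀ T u) {t : ℝ}
    (ht : t ∈ Ioo 0 T) :
    ∫ z, divergence g (u t) z ^ 2 ∂(vol g) = 4 * kappa g u₀ ^ 2 * (vol g).real univ := by
  set F : ℝ → ℝ := fun s => ∫ z, divergence g (u s) z ^ 2 ∂(vol g) with hF
  have hk := h.smoothFun_divergence
  have hcont : ContinuousOn F (Ico 0 T) :=
    continuousOn_integral_of_compact_support (k := univ) isCompact_univ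
      (f := fun s z => divergence g (u s) z ^ 2) (hk.continuousOn.pow 2)
      fun _ x _ hx => absurd (mem_univ x) hx
  have hconst : ∀ s ∈ Ioo 0 T, F s = F t := fun s hs =>
    isOpen_Ioo.is_const_of_deriv_eq_zero isPreconnected_Ioo
      (fun r hr => (h.hasDerivAt_integral_sq hr).differentiableAt.differentiableWithinAt)
      (fun r hr => (h.hasDerivAt_integral_sq hr).deriv) hs ht
  have h0 : (0 : ℝ) ∈ Ico 0 T := ⟨le_rfl, h.pos⟩
  have hlim : Tendsto F (𝓝[Ioo 0 T] 0) (𝓝 (F 0)) :=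
    (hcont 0 h0).mono Ioo_subset_Ico_self
  have hne : (𝓝[Ioo 0 T] (0 : ℝ)).NeBot := by
    rw [nhdsWithin_Ioo_eq_nhdsGT h.pos]
    infer_instance
  have hlim2 : Tendsto F (𝓝[Ioo 0 T] 0) (𝓝 (F t)) :=
    tendsto_const_nhds.congr' (by
      filter_upwards [self_mem_nhdsWithin] with s hs
      exact (hconst s hs).symm)
  have h1 := tendsto_nhds_unique hlim2 hlim
  have h2 : F 0 = ∫ x, divergence g u₀ x ^ 2 ∂(vol g) := by
    simp only [hF, h.initial]
  rw [← integral_divergence_sq_eq g u₀, ← h2]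
  exact h1

/-- Conservation of ∫ h² turns the nonlocal term into the constant -2κ². -/
theorem IsSmoothSolution.riccati [Nonempty M] (h : IsSmoothSolution g u₀ T u) {t : ℝ}
    (ht : t ∈ Ioo 0 T) (x : M) :
    deriv (fun s => divergence g (u s) x) t + dirDeriv (divergence g (u t)) x (u t x)
      = -(2 * kappa g u₀ ^ 2) - (1 / 2) * divergence g (u t) x ^ 2 := by
  have hV := vol_real_univ_pos g
  rw [h.deriv_eq ht, h.integral_sq ht]
  field_simp
  ring

/-- Along the flow, `arctan (div u / (2 κ)) + κ t` is constant. -/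
theorem IsSmoothSolution.arctan_flow (h : IsSmoothSolution g u₀ T u)
    (hκ : 0 < kappa g u₀) {b : ℝ} (hb : b ∈ Ioo 0 T) {ζ ζ' : ℝ → M → M}
    (hζ : IsFlow u (Ioo 0 T) b ζ ζ') {t : ℝ} (ht : t ∈ Ioo 0 T) (x : M) :
    arctan (divergence g (u t) (ζ t x) / (2 * kappa g u₀)) + kappa g u₀ * t =
      arctan (divergence g (u b) x / (2 * kappa g u₀)) + kappa g u₀ * b := by
  have : Nonempty M := ⟨x⟩
  set κ := kappa g u₀ with hκdef
  have hk := h.smoothFun_divergence.mono Ioo_subset_Ico_self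
  have hd : ∀ s ∈ Ioo 0 T,
      HasDerivAt (fun s => arctan (divergence g (u s) (ζ s x) / (2 * κ)) + κ * s) 0 s := by
    intro s hs
    have h1 := hasDerivAt_material isOpen_Ioo hζ.smooth hζ.curve hk hs x
    rw [h.riccati hs] at h1
    refine ((h1.div_const (2 * κ)).arctan.add ((hasDerivAt_id s).const_mul κ)).congr_deriv ?_
    rw [← hκdef]
    have : 0 < 4 * κ ^ 2 + divergence g (u s) (ζ s x) ^ 2 := by positivity
    field_simp
    ring
  have h1 := isOpen_Ioo.is_const_of_deriv_eq_zero isPreconnected_Ioo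
    (fun r hr => (hd r hr).differentiableAt.differentiableWithinAt)
    (fun r hr => (hd r hr).deriv) ht hb
  simpa only [hζ.base] using h1

theorem exists_eq_iInf_divergence [Nonempty M] (g : Metric n M) {v : VField n M}
    (hv : SmoothField v) :
    ∃ x, (⨅ y, divergence g v y) = divergence g v x ∧ ∀ y, divergence g v x ≤ divergence g v y := by
  obtain ⟨x, -, hx⟩ := isCompact_univ.exists_isMinOn univ_nonempty
    (contMDiff_divergence g hv).continuous.continuousOn
  have hx' : ∀ y, divergence g v x ≤ divergence g v y := fun y => hx (mem_univ y)
  have hbdd : BddBelow (range (divergence g v)) := ⟨divergence g v x, by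
    rintro _ ⟨y, rfl⟩
    exact hx' y⟩
  exact ⟨x, le_antisymm (ciInf_le hbdd x) (le_ciInf hx'), hx'⟩

theorem IsSmoothSolution.continuousOn_arctan (h : IsSmoothSolution g u₀ T u) (κ : ℝ) :
    ContinuousOn (fun q : ℝ × M => arctan (divergence g (u q.1) q.2 / (2 * κ)) + κ * q.1)
      (Ico 0 T ×ˢ univ) :=
  (continuous_arctan.comp_continuousOn (h.smoothFun_divergence.continuousOn.div_const _)).add
    (continuous_const.mul continuous_fst).continuousOn

/-- Take z minimising div u(t). The trajectory through x₀ at time s has at time t a value at least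
that at z, while its conserved quantity is the one at (s, x₀). The flow exists only over the open
interval, so s tends to 0, with x₀ a minimum point of div u₀. -/
theorem IsSmoothSolution.exists_arctan_le [Nonempty M] (h : IsSmoothSolution g u₀ T u)
    (hu₀ : SmoothField u₀) (hκ : 0 < kappa g u₀) {t : ℝ} (ht : t ∈ Ioo 0 T) :
    ∃ z, arctan (divergence g (u t) z / (2 * kappa g u₀)) + kappa g u₀ * t ≤
      arctan ((⨅ x, divergence g u₀ x) / (2 * kappa g u₀)) := by
  set κ := kappa g u₀ with hκdef
  obtain ⟨z, -, hz⟩ := exists_eq_iInf_divergence g (h.smoothTimeField.smoothField ht)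
    |>.imp fun z hz => (⟨trivial, hz.2⟩ : True ∧ _)
  obtain ⟨x₀, hx₀, -⟩ := exists_eq_iInf_divergence g hu₀
  refine ⟨z, ?_⟩
  have hle : ∀ s ∈ Ioo 0 T, arctan (divergence g (u t) z / (2 * κ)) + κ * t ≤
      arctan (divergence g (u s) x₀ / (2 * κ)) + κ * s := by
    intro s hs
    obtain ⟨ζ, ζ', hζ⟩ := exists_isFlow isOpen_Ioo isPreconnected_Ioo h.smoothTimeField hs
    rw [← h.arctan_flow hκ hs hζ ht x₀]
    gcongr
    exact hz _
  have hne : (𝓝[Ioo 0 T] (0 : ℝ)).NeBot := by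
    rw [nhdsWithin_Ioo_eq_nhdsGT h.pos]
    infer_instance
  have hc : ContinuousOn (fun s => arctan (divergence g (u s) x₀ / (2 * κ)) + κ * s) (Ico 0 T) :=
    (h.continuousOn_arctan κ).comp (f := fun s : ℝ => (s, x₀))
      (continuous_id.prodMk continuous_const).continuousOn fun s hs => ⟨hs, mem_univ _⟩
  have hlim := (hc 0 ⟨le_rfl, h.pos⟩).mono Ioo_subset_Ico_self
  have h1 := ge_of_tendsto hlim (by
    filter_upwards [self_mem_nhdsWithin] with s hs
    exact hle s hs)
  rw [hx₀, ← h.initial]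
  simpa using h1

/-- These bounds keep the phase of the amplitude based at time b inside (-π/2, π/2) on all of (0,
Tmax). Both come from following the trajectory through x back towards time 0; the upper one needs
only arctan < π/2. -/
theorem IsSmoothSolution.le_arctan [Nonempty M] (h : IsSmoothSolution g u₀ T u)
    (hu₀ : SmoothField u₀) (hκ : 0 < kappa g u₀) {b : ℝ} (hb : b ∈ Ioo 0 T) (x : M) :
    arctan ((⨅ x, divergence g u₀ x) / (2 * kappa g u₀)) ≤
        arctan (divergence g (u b) x / (2 * kappa g u₀)) + kappa g u₀ * b ∧
      arctan (divergence g (u b) x / (2 * kappa g u₀)) + kappa g u₀ * b ≤ π / 2 := by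
  set κ := kappa g u₀ with hκdef
  obtain ⟨ζ, ζ', hζ⟩ := exists_isFlow isOpen_Ioo isPreconnected_Ioo h.smoothTimeField hb
  have hne : (𝓝[Ioo 0 T] (0 : ℝ)).NeBot := by
    rw [nhdsWithin_Ioo_eq_nhdsGT h.pos]
    infer_instance
  obtain ⟨x₀, hx₀, hmin⟩ := exists_eq_iInf_divergence g hu₀
  constructor
  · refine le_of_forall_pos_sub_le fun ε hε => ?_
    -- The point ζ s x moves as s tends to 0, so the lower bound near time 0 must hold uniformly
    -- over M; compactness provides this.
    have hmem : {q : ℝ × M | arctan ((⨅ x, divergence g u₀ x) / (2 * κ)) - ε <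
        arctan (divergence g (u q.1) q.2 / (2 * κ)) + κ * q.1} ∈ 𝓝[Ioo 0 T] (0 : ℝ) ×ˢ 𝓝ˢ univ := by
      refine isCompact_univ.mem_prod_nhdsSet_of_forall fun y _ => ?_
      have h1 := (h.continuousOn_arctan κ) (0, y) ⟨⟨le_rfl, h.pos⟩, mem_univ y⟩
      have h2 : ∀ᶠ q in 𝓝[Ico 0 T ×ˢ univ] ((0 : ℝ), y),
          arctan ((⨅ x, divergence g u₀ x) / (2 * κ)) - ε <
            arctan (divergence g (u q.1) q.2 / (2 * κ)) + κ * q.1 := by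
        refine h1.eventually (lt_mem_nhds ?_)
        have h3 : arctan ((⨅ x, divergence g u₀ x) / (2 * κ)) ≤
            arctan (divergence g (u 0) y / (2 * κ)) := by
          rw [h.initial, hx₀]
          gcongr
          exact hmin y
        simp only [mul_zero, add_zero]
        linarith
      rw [nhdsWithin_prod_eq, nhdsWithin_univ] at h2
      exact Filter.prod_mono (nhdsWithin_mono _ Ioo_subset_Ico_self) le_rfl h2
    rw [nhdsSet_univ, mem_prod_top] at hmem
    obtain ⟨s, hs, hsI⟩ := (Filter.Eventually.and hmem self_mem_nhdsWithin).exists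
    rw [← h.arctan_flow hκ hb hζ hsI x]
    exact (hs (ζ s x)).le
  · have hle : ∀ s ∈ Ioo 0 T, arctan (divergence g (u b) x / (2 * κ)) + κ * b ≤ π / 2 + κ * s := by
      intro s hs
      rw [← h.arctan_flow hκ hb hζ hs x]
      have := (arctan_lt_pi_div_two (divergence g (u s) (ζ s x) / (2 * κ))).le
      linarith
    have hlim : Tendsto (fun s => π / 2 + κ * s) (𝓝[Ioo 0 T] 0) (𝓝 (π / 2 + κ * 0)) :=
      (continuous_const.add (continuous_const.mul continuous_id)).continuousWithinAt
    rw [mul_zero, add_zero] at hlim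
    refine ge_of_tendsto hlim ?_
    filter_upwards [self_mem_nhdsWithin] with s hs
    exact hle s hs

end SmoothSolution

/-! ### Derivative of the determinant and the trace inequality. -/

section Jacobi

variable {n : ℕ}

theorem contDiff_det_of : ContDiff ℝ ∞ fun B : Fin n → Fin n → ℝ => (Matrix.of B).det := by
  simp only [Matrix.det_apply, Matrix.of_apply]
  refine ContDiff.sum fun σ _ => ContDiff.const_smul _ (contDiff_prod fun i _ => ?_)
  exact contDiff_pi.1 (contDiff_pi.1 contDiff_id _) _

theorem hasDerivAt_det_one_add_smul (A : Matrix (Fin n) (Fin n) ℝ) :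
    HasDerivAt (fun s : ℝ => (1 + s • A).det) A.trace 0 := by
  rw [funext fun s : ℝ => Matrix.det_one_add_smul s A]
  have h1 : HasDerivAt (fun s : ℝ => s ^ 2) 0 0 := by simpa using hasDerivAt_pow 2 (0 : ℝ)
  have h2 := (Polynomial.hasDerivAt ((1 + (Polynomial.X : Polynomial ℝ) •
    A.map Polynomial.C).det.divX.divX) (0 : ℝ)).fun_mul h1
  have h3 := (((hasDerivAt_id (0 : ℝ)).const_mul A.trace).const_add 1).fun_add h2
  simpa using h3

/-- Jacobi's formula for the derivative of a determinant. -/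
theorem hasDerivAt_det {A : ℝ → Matrix (Fin n) (Fin n) ℝ} {A' : Matrix (Fin n) (Fin n) ℝ} {t : ℝ}
    (hA : ∀ i j, HasDerivAt (fun s => A s i j) (A' i j) t) (hdet : (A t).det ≠ 0) :
    HasDerivAt (fun s => (A s).det) ((A t).det * ((A t)⁻¹ * A').trace) t := by
  have hF := (contDiff_det_of (n := n)).differentiable (by simp)
  have h1 : HasDerivAt (fun s => (Matrix.of.symm (A s) : Fin n → Fin n → ℝ)) (Matrix.of.symm A') t :=
    hasDerivAt_pi.2 fun i => hasDerivAt_pi.2 fun j => hA i j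
  have h2 : HasDerivAt (fun s : ℝ => (Matrix.of.symm (A t) + s • Matrix.of.symm A' :
      Fin n → Fin n → ℝ)) (Matrix.of.symm A') 0 := by
    simpa using ((hasDerivAt_id (0 : ℝ)).smul_const (Matrix.of.symm A')).const_add
      (Matrix.of.symm (A t))
  have e1 := (hF (Matrix.of.symm (A t))).hasFDerivAt.comp_hasDerivAt t h1
  have e2 := HasFDerivAt.comp_hasDerivAt (l := fun B : Fin n → Fin n → ℝ => (Matrix.of B).det)
    (l' := fderiv ℝ (fun B : Fin n → Fin n → ℝ => (Matrix.of B).det) (Matrix.of.symm (A t)))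
    (0 : ℝ) (by simpa using (hF (Matrix.of.symm (A t))).hasFDerivAt) h2
  have hunit : IsUnit (A t).det := hdet.isUnit
  -- As det is differentiable, only its derivative in the direction A' matters. It is computed on
  -- the straight line A + sA' = A(1 + sA⁻¹A').
  have h3 : ∀ s : ℝ, (Matrix.of (Matrix.of.symm (A t) + s • Matrix.of.symm A')).det =
      (A t).det * (1 + s • ((A t)⁻¹ * A')).det := by
    intro s
    rw [← Matrix.det_mul, mul_add, mul_one, Matrix.mul_smul, Matrix.mul_nonsing_inv_cancel_left _ _ hunit]
    rfl
  have e3 := (hasDerivAt_det_one_add_smul ((A t)⁻¹ * A')).const_mul (A t).det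
  have e4 : HasDerivAt (fun s : ℝ => (A t).det * (1 + s • ((A t)⁻¹ * A')).det) _ 0 :=
    e2.congr_of_eventuallyEq (Eventually.of_forall fun s => (h3 s).symm)
  rw [e3.unique e4]
  exact e1

open scoped MatrixOrder in
theorem exists_eq_transpose_mul_self {G : Matrix (Fin n) (Fin n) ℝ} (hG : G.PosDef) :
    ∃ B : Matrix (Fin n) (Fin n) ℝ, G = B.transpose * B := by
  obtain ⟨B, hB⟩ := CStarAlgebra.nonneg_iff_eq_star_mul_self.1 hG.posSemidef.nonneg
  refine ⟨B, ?_⟩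
  rw [hB, Matrix.star_eq_conjTranspose, Matrix.conjTranspose_eq_transpose_of_trivial]

/-- Writing G = BᵀB and C = BAB⁻¹ turns the quadruple sum into the Frobenius norm of C and preserves
the trace; Cauchy–Schwarz on the diagonal entries concludes. -/
theorem sq_trace_le {G : Matrix (Fin n) (Fin n) ℝ} (hG : G.PosDef) (A : Matrix (Fin n) (Fin n) ℝ) :
    0 ≤ ∑ i, ∑ j, ∑ k, ∑ l, G⁻¹ i j * G k l * A k i * A l j ∧
    A.trace ^ 2 ≤ n * ∑ i, ∑ j, ∑ k, ∑ l, G⁻¹ i j * G k l * A k i * A l j := by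
  obtain ⟨B, hB⟩ := exists_eq_transpose_mul_self hG
  have hdet : IsUnit B.det := by
    rw [isUnit_iff_ne_zero]
    intro h0
    have := hG.det_pos
    rw [hB, Matrix.det_mul, h0, mul_zero] at this
    exact lt_irrefl _ this
  set C := B * A * B⁻¹ with hC
  have htr : A.trace = C.trace := by
    rw [hC, Matrix.trace_mul_comm, ← mul_assoc, Matrix.nonsing_inv_mul _ hdet, one_mul]
  have hGinv : G⁻¹ = B⁻¹ * B⁻¹.transpose := by
    rw [hB, Matrix.mul_inv_rev, Matrix.transpose_nonsing_inv]
  have hQ : ∑ i, ∑ j, ∑ k, ∑ l, G⁻¹ i j * G k l * A k i * A l j = ∑ i, ∑ j, C i j ^ 2 := by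
    have h1 : ∑ i, ∑ j, ∑ k, ∑ l, G⁻¹ i j * G k l * A k i * A l j =
        (G⁻¹ * (A.transpose * G * A).transpose).trace := by
      simp only [Matrix.trace, Matrix.diag_apply, Matrix.mul_apply, Matrix.transpose_apply,
        Finset.sum_mul, Finset.mul_sum]
      refine Finset.sum_congr rfl fun i _ => Finset.sum_congr rfl fun j _ => ?_
      rw [Finset.sum_comm]
      refine Finset.sum_congr rfl fun k _ => Finset.sum_congr rfl fun l _ => ?_
      ring
    have h2 : (C.transpose * C).trace = ∑ i, ∑ j, C i j ^ 2 := by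
      simp only [Matrix.trace, Matrix.diag_apply, Matrix.mul_apply, Matrix.transpose_apply]
      rw [Finset.sum_comm]
      simp only [pow_two]
    rw [h1, ← h2, hGinv, hC, hB]
    simp only [Matrix.transpose_mul, Matrix.transpose_transpose, mul_assoc]
    rw [Matrix.trace_mul_comm]
    simp only [mul_assoc]
  rw [hQ, htr]
  refine ⟨Finset.sum_nonneg fun i _ => Finset.sum_nonneg fun j _ => sq_nonneg _, ?_⟩
  have h3 := sq_sum_le_card_mul_sum_sq (s := Finset.univ) (f := fun i => C i i)
  rw [Finset.card_univ, Fintype.card_fin] at h3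
  refine h3.trans ?_
  gcongr with i
  exact Finset.single_le_sum (f := fun j => C i j ^ 2) (fun j _ => sq_nonneg _) (Finset.mem_univ i)

end Jacobi

/-! ### The divergence controlled by the covariant derivative. -/

section CovariantDerivative

variable {n : ℕ} {M : Type*} [TopologicalSpace M] [ChartedSpace (EuclideanSpace ℝ (Fin n)) M]
  [IsManifold (𝓡 n) ∞ M]

theorem hasDerivAt_pd {f : EuclideanSpace ℝ (Fin n) → ℝ} {y : EuclideanSpace ℝ (Fin n)}
    (hf : DifferentiableAt ℝ f y) (i : Fin n) :
    HasDerivAt (fun s : ℝ => f (y + s • EuclideanSpace.single i (1 : ℝ))) (pd i f y) 0 := by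
  have h2 : HasDerivAt (fun s : ℝ => y + s • EuclideanSpace.single i (1 : ℝ))
      (EuclideanSpace.single i (1 : ℝ)) 0 := by
    simpa using ((hasDerivAt_id (0 : ℝ)).smul_const (EuclideanSpace.single i (1 : ℝ))).const_add y
  exact HasFDerivAt.comp_hasDerivAt (l := f) (l' := fderiv ℝ f y) (0 : ℝ)
    (by simpa using hf.hasFDerivAt) h2

theorem pd_det_gram (g : Metric n M) {p : M} {y : EuclideanSpace ℝ (Fin n)}
    (hy : y ∈ (extChartAt (𝓡 n) p).target) (i : Fin n) :
    pd i (fun z => (gram g p z).det) y = (gram g p y).det *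
      ∑ k, ∑ l, (gram g p y)⁻¹ k l * pd i (fun z => gram g p z l k) y := by
  have hT := (isOpen_extChartAt_target (I := 𝓡 n) p).mem_nhds hy
  have h1 := hasDerivAt_pd (((contDiffOn_det_gram g p).contDiffAt hT).differentiableAt (by simp)) i
  have h2 := hasDerivAt_det (t := 0)
    (A := fun s : ℝ => gram g p (y + s • EuclideanSpace.single i (1 : ℝ)))
    (A' := Matrix.of fun k l => pd i (fun z => gram g p z k l) y)
    (fun k l => hasDerivAt_pd
      (((contDiffOn_gram g p k l).contDiffAt hT).differentiableAt (by simp)) i)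
    (by simpa using (posDef_gram g hy).det_pos.ne')
  rw [h1.unique h2]
  simp [Matrix.trace, Matrix.mul_apply]

theorem pd_volDensity (g : Metric n M) {p : M} {y : EuclideanSpace ℝ (Fin n)}
    (hy : y ∈ (extChartAt (𝓡 n) p).target) (i : Fin n) :
    pd i (volDensity g p) y = volDensity g p y * ((1 / 2) *
      ∑ k, ∑ l, (gram g p y)⁻¹ k l * pd i (fun z => gram g p z l k) y) := by
  have hT := (isOpen_extChartAt_target (I := 𝓡 n) p).mem_nhds hy
  have hdet := (posDef_gram g hy).det_pos
  have h1 := ((((contDiffOn_det_gram g p).contDiffAt hT).differentiableAt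
    (by simp)).hasFDerivAt.sqrt hdet.ne').fderiv
  have h2 : pd i (volDensity g p) y = 1 / (2 * volDensity g p y) *
      pd i (fun z => (gram g p z).det) y := by
    have := DFunLike.congr_fun h1 (EuclideanSpace.single i (1 : ℝ))
    exact this
  have hρ := volDensity_pos g hy
  have h3 : (gram g p y).det = volDensity g p y * volDensity g p y :=
    (mul_self_sqrt hdet.le).symm
  rw [h2, pd_det_gram g hy, h3]
  field_simp

/-- By symmetry of the metric and its inverse, two of the three terms cancel. What remains is the
logarithmic derivative of the volume density. -/
theorem sum_christoffel (g : Metric n M) {p : M} {y : EuclideanSpace ℝ (Fin n)} (j : Fin n) :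
    ∑ k, christoffel g p k k j y =
      (1 / 2) * ∑ k, ∑ l, (gram g p y)⁻¹ k l * pd j (fun z => gram g p z l k) y := by
  have hsymm : ∀ k l, (fun z => gram g p z k l) = fun z => gram g p z l k := by
    intro k l
    ext z
    exact (isSymm_gram g p z).apply l k
  have hinv : ∀ k l, (gram g p y)⁻¹ k l = (gram g p y)⁻¹ l k := by
    intro k l
    have h : ((gram g p y)⁻¹).IsSymm := (isSymm_gram g p y).inv
    exact h.apply l k
  have h1 : ∑ k, ∑ l, (gram g p y)⁻¹ k l * pd k (fun z => gram g p z j l) y =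
      ∑ k, ∑ l, (gram g p y)⁻¹ k l * pd l (fun z => gram g p z k j) y := by
    rw [Finset.sum_comm]
    refine Finset.sum_congr rfl fun l _ => Finset.sum_congr rfl fun k _ => ?_
    rw [hinv k l, hsymm j l]
  simp only [christoffel, ← Finset.mul_sum]
  congr 1
  simp only [mul_sub, mul_add, Finset.sum_sub_distrib, Finset.sum_add_distrib]
  rw [h1, add_sub_cancel_left]
  refine Finset.sum_congr rfl fun k _ => Finset.sum_congr rfl fun l _ => ?_
  rw [hsymm k l]

/-- The divergence is the trace of the covariant derivative. -/
theorem trace_covDeriv (g : Metric n M) {u : VField n M} (hu : SmoothField u) (p : M) :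
    (covDeriv g u p).trace = divergence g u p := by
  have hy := mem_extChartAt_target (I := 𝓡 n) p
  have hT := (isOpen_extChartAt_target (I := 𝓡 n) p).mem_nhds hy
  set y := extChartAt (𝓡 n) p p
  have hρ := volDensity_pos g hy
  have h1 : ∀ i, pd i (fun y => volDensity g p y * comp u p i y) y =
      volDensity g p y * (pd i (comp u p i) y +
        (∑ k, christoffel g p k k i y) * comp u p i y) := by
    intro i
    have hd1 : DifferentiableAt ℝ (volDensity g p) y :=
      ((contDiffOn_volDensity g p).contDiffAt hT).differentiableAt (by simp)
    have hd2 : DifferentiableAt ℝ (comp u p i) y :=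
      ((contDiffOn_comp hu p i).contDiffAt hT).differentiableAt (by simp)
    rw [pd, fderiv_fun_mul hd1 hd2]
    simp only [add_apply, smul_apply, smul_eq_mul]
    change volDensity g p y * pd i (comp u p i) y + comp u p i y * pd i (volDensity g p) y = _
    rw [pd_volDensity g hy, sum_christoffel]
    ring
  rw [divergence, Finset.sum_congr rfl fun i _ => h1 i, ← Finset.mul_sum,
    inv_mul_cancel_left₀ hρ.ne']
  simp only [Matrix.trace, Matrix.diag_apply, covDeriv, Matrix.of_apply, Finset.sum_add_distrib]
  congr 1
  rw [Finset.sum_comm]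
  simp only [Finset.sum_mul]
  rfl

theorem abs_divergence_le (g : Metric n M) {u : VField n M} (hu : SmoothField u) (p : M) :
    |divergence g u p| ≤ √n * normCovDerivAt g u p := by
  have h := (sq_trace_le (posDef_gram g (mem_extChartAt_target (I := 𝓡 n) p)) (covDeriv g u p)).2
  rw [trace_covDeriv g hu] at h
  rw [normCovDerivAt, ← sqrt_mul (Nat.cast_nonneg n)]
  exact abs_le_sqrt h

theorem ofReal_abs_divergence_le (g : Metric n M) {u : VField n M} (hu : SmoothField u) (p : M) :
    ENNReal.ofReal (|divergence g u p|) ≤ ENNReal.ofReal (√n) * c1Norm g u := by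
  refine (ENNReal.ofReal_le_ofReal (abs_divergence_le g hu p)).trans ?_
  rw [ENNReal.ofReal_mul (sqrt_nonneg _)]
  gcongr
  exact (le_iSup (fun p => ENNReal.ofReal (normCovDerivAt g u p)) p).trans le_add_self

end CovariantDerivative

/-! ### Existence, maximality, continuation and blow-up. -/

section Lifespan

variable {n : ℕ} {M : Type*} [TopologicalSpace M] [ChartedSpace (EuclideanSpace ℝ (Fin n)) M]
  [IsManifold (𝓡 n) ∞ M]

theorem SmoothTimeField.of_locally {J : Set ℝ} {u : ℝ → VField n M}
    (h : ∀ t ∈ J, ∃ U, IsOpen U ∧ t ∈ U ∧ SmoothTimeField (J ∩ U) u) : SmoothTimeField J u := by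
  refine contMDiffOn_of_locally_contMDiffOn fun q hq => ?_
  obtain ⟨U, hU, hqU, hu⟩ := h q.1 hq.1
  refine ⟨U ×ˢ univ, hU.prod isOpen_univ, ⟨hqU, mem_univ _⟩, ?_⟩
  rw [prod_inter_prod, inter_self]
  exact hu

theorem IsCurve.congr_field {X X' : ℝ → VField n M} {I : Set ℝ} {γ : ℝ → M} (h : IsCurve X I γ)
    (hX : ∀ t ∈ I, X' t = X t) : IsCurve X' I γ := by
  intro t ht f hf
  rw [hX t ht]
  exact h t ht f hf

theorem IsFlow.inv_base {X : ℝ → VField n M} {I : Set ℝ} {b : ℝ} {ξ η : ℝ → M → M}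
    (h : IsFlow X I b ξ η) (hb : b ∈ I) (x : M) : η b x = x := by
  conv_lhs => rw [← h.base x]
  rw [h.left b hb]

variable [T2Space M]

theorem IsCurve.field_eq {X X' : ℝ → VField n M} {I : Set ℝ} {γ : ℝ → M} (h : IsCurve X I γ)
    (h' : IsCurve X' I γ) {t : ℝ} (ht : t ∈ I) : X t (γ t) = X' t (γ t) :=
  eq_of_forall_dirDeriv fun f hf => (h t ht f hf).unique (h' t ht f hf)

/-- At the base time both flow maps are the identity, so differentiating η ∘ ξ = id gives opposite
velocities. -/
theorem IsFlow.inverse_velocity_base {X : ℝ → VField n M} {J : Set ℝ} (hJ : IsOpen J) {b : ℝ}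
    (hb : b ∈ J) {ξ η : ℝ → M → M} (h : IsFlow X J b ξ η) {v : ℝ → VField n M}
    (hηv : ∀ x, IsCurve v J fun t => η t x) (x : M) : v b x = -X b x := by
  refine eq_of_forall_dirDeriv fun f hf => ?_
  have h1 := (hηv x b hb f hf).deriv
  rw [h.deriv_inv hJ hf hb] at h1
  have h2 : (fun z => f (η b z)) = f := by
    ext z
    rw [h.inv_base hb]
  rw [h2] at h1
  have key : ∀ z, z = x → dirDeriv f z (v b z) = dirDeriv f x (v b x) := by
    rintro _ rfl
    rfl
  rw [← key _ (h.inv_base hb x), ← h1]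
  exact (map_neg _ _).symm

variable [CompactSpace M] [MeasurableSpace M] [BorelSpace M]

/-- A field satisfying the Riccati equation at all points at time t automatically has ∫ (div v)² =
4κ²V then, so the constant right-hand side is the required nonlocal one. -/
theorem equation_of_riccati [Nonempty M] (g : Metric n M) {J : Set ℝ} (hJ : IsOpen J)
    {v : ℝ → VField n M} (hv : SmoothTimeField J v) {κ t : ℝ} (ht : t ∈ J)
    (h : ∀ x, deriv (fun s => divergence g (v s) x) t + dirDeriv (divergence g (v t)) x (v t x)
      + (1 / 2) * divergence g (v t) x ^ 2 = -(2 * κ ^ 2)) (x : M) :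
    HasDerivAt (fun s => divergence g (v s) x) (deriv (fun s => divergence g (v s) x) t) t ∧
    deriv (fun s => divergence g (v s) x) t + dirDeriv (divergence g (v t)) x (v t x)
      + (1 / 2) * divergence g (v t) x ^ 2 =
      - (1 / (2 * (vol g).real univ)) * ∫ z, divergence g (v t) z ^ 2 ∂(vol g) := by
  have hV := vol_real_univ_pos g
  refine ⟨(smoothFun_divergence g hJ.uniqueDiffOn hv).hasDerivAt hJ ht x, ?_⟩
  rw [h x, integral_divergence_sq_of_riccati g hJ hv ht h]
  field_simp
  ring

variable {g : Metric n M} {u₀ : VField n M} {T : ℝ} {u : ℝ → VField n M}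

theorem exists_isSmoothSolution_eq [ConnectedSpace M] (hu₀ : SmoothField u₀)
    (hκ : 0 < kappa g u₀)
    (hT : kappa g u₀ * T = π / 2 + arctan ((⨅ x, divergence g u₀ x) / (2 * kappa g u₀))) :
    ∃ u : ℝ → VField n M, IsSmoothSolution g u₀ T u ∧ u 0 = u₀ := by
  set κ := kappa g u₀ with hκdef
  obtain ⟨x₀, hx₀, hmin⟩ := exists_eq_iInf_divergence g hu₀
  obtain ⟨x₁, -, hx₁⟩ := isCompact_univ.exists_isMaxOn univ_nonempty
    (contMDiff_divergence g hu₀).continuous.continuousOn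
  have hT0 : 0 < T := by
    have := neg_pi_div_two_lt_arctan ((⨅ x, divergence g u₀ x) / (2 * κ))
    exact pos_of_mul_pos_right (by rw [hT]; linarith) hκ.le
  set α := arctan (divergence g u₀ x₁ / (2 * κ)) with hα
  have hα' : α < π / 2 := arctan_lt_pi_div_two _
  -- At time -ε the largest initial phase, α, reaches π/2. The room before time 0 gives an open
  -- interval containing 0, hence smoothness up to t = 0.
  set ε := (π / 2 - α) / κ with hε
  have hε0 : 0 < ε := div_pos (by linarith) hκ
  have hκε : κ * ε = π / 2 - α := by rw [hε]; field_simp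
  set J := Ioo (-ε) T with hJ
  have h0J : (0 : ℝ) ∈ J := ⟨by linarith, hT0⟩
  have hφ : ∀ t ∈ J, ∀ x, amplitude κ 0 (fun x => divergence g u₀ x / (2 * κ)) t x ≠ 0 := by
    intro t ht x
    have h1 : arctan ((⨅ x, divergence g u₀ x) / (2 * κ)) ≤ arctan (divergence g u₀ x / (2 * κ)) := by
      rw [hx₀]
      gcongr
      exact hmin x
    have h2 : arctan (divergence g u₀ x / (2 * κ)) ≤ α := by
      rw [hα]
      gcongr
      exact hx₁ (mem_univ x)
    have h3 : κ * t < κ * T := mul_lt_mul_of_pos_left ht.2 hκ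
    have h4 : κ * -ε < κ * t := mul_lt_mul_of_pos_left ht.1 hκ
    refine (amplitude_pos ?_ ?_).ne'
    · rw [sub_zero]
      linarith
    · rw [sub_zero]
      linarith
  have hτ : ContMDiff (𝓡 n) 𝓘(ℝ, ℝ) ∞ fun x => divergence g u₀ x / (2 * κ) := by
    simp only [div_eq_mul_inv]
    exact (contMDiff_divergence g hu₀).mul contMDiff_const
  obtain ⟨X, hX, hXb, hwX⟩ := exists_transport_field g (J := J) (b := 0) hκ.ne' hu₀
    (integral_divergence_sq_eq g u₀) hφ
  obtain ⟨ξ, η, v, hflow, hv, hηv, -, hric⟩ :=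
    exists_solution_of_transport g isOpen_Ioo isPreconnected_Ioo h0J hτ hφ hX hwX
  have hv0 : v 0 = u₀ := by
    funext x
    rw [hflow.inverse_velocity_base isOpen_Ioo h0J hηv, hXb h0J, neg_neg]
  have hsub : Ico 0 T ⊆ J := fun t ht => ⟨by linarith [ht.1], ht.2⟩
  refine ⟨v, ⟨hT0, SmoothTimeField.mono hv hsub, fun t ht x => ?_, fun x => by rw [hv0]⟩, hv0⟩
  obtain ⟨h1, h2⟩ := equation_of_riccati g isOpen_Ioo hv (hsub ht) (hric t (hsub ht)) x
  exact ⟨_, h1.hasDerivWithinAt, h2⟩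

/-- A solution still alive at time Tm would have a point there with arctan(div u/(2κ)) ≤ -π/2. -/
theorem IsSmoothSolution.le_lifespan [Nonempty M] (h : IsSmoothSolution g u₀ T u)
    (hu₀ : SmoothField u₀) (hκ : 0 < kappa g u₀) {Tm : ℝ}
    (hT : kappa g u₀ * Tm = π / 2 + arctan ((⨅ x, divergence g u₀ x) / (2 * kappa g u₀))) :
    T ≤ Tm := by
  by_contra! hlt
  have hT0 : 0 < Tm := by
    have := neg_pi_div_two_lt_arctan ((⨅ x, divergence g u₀ x) / (2 * kappa g u₀))
    exact pos_of_mul_pos_right (by rw [hT]; linarith) hκ.le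
  obtain ⟨z, hz⟩ := h.exists_arctan_le hu₀ hκ ⟨hT0, hlt⟩
  have := neg_pi_div_two_lt_arctan (divergence g (u Tm) z / (2 * kappa g u₀))
  linarith

theorem IsSmoothSolution.tendsto_c1Norm [Nonempty M] (h : IsSmoothSolution g u₀ T u)
    (hu₀ : SmoothField u₀) (hκ : 0 < kappa g u₀)
    (hT : kappa g u₀ * T = π / 2 + arctan ((⨅ x, divergence g u₀ x) / (2 * kappa g u₀))) :
    Tendsto (fun t => c1Norm g (u t)) (𝓝[<] T) (𝓝 ⊤) := by
  set κ := kappa g u₀ with hκdef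
  set a := arctan ((⨅ x, divergence g u₀ x) / (2 * κ)) with ha
  rw [ENNReal.tendsto_nhds_top_iff_nat]
  intro N
  set L : ℝ := √n * N with hL
  -- After this time the minimum of div u is below -L = -√n N, and the trace inequality then pushes
  -- the C¹ norm above N.
  have hlt : (a - arctan (-L / (2 * κ))) / κ < T := by
    have := neg_pi_div_two_lt_arctan (-L / (2 * κ))
    rw [div_lt_iff₀ hκ, mul_comm T, hT]
    linarith
  filter_upwards [Ioo_mem_nhdsLT (max_lt hlt h.pos)] with t ht
  have ht0 : t ∈ Ioo 0 T := ⟨lt_of_le_of_lt (le_max_right _ _) ht.1, ht.2⟩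
  obtain ⟨z, hz⟩ := h.exists_arctan_le hu₀ hκ ht0
  have h1 : (a - arctan (-L / (2 * κ))) / κ < t := lt_of_le_of_lt (le_max_left _ _) ht.1
  rw [div_lt_iff₀ hκ, mul_comm t] at h1
  have h2 : arctan (divergence g (u t) z / (2 * κ)) < arctan (-L / (2 * κ)) := by linarith
  have h3 : divergence g (u t) z < -L := by
    have := arctan_strictMono.lt_iff_lt.1 h2
    rwa [div_lt_div_iff_of_pos_right (by positivity)] at this
  have h4 : L < |divergence g (u t) z| := by
    have := neg_abs_le (divergence g (u t) z)
    linarith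
  by_contra! hle
  have h5 := (ofReal_abs_divergence_le g (h.smoothTimeField.smoothField ht0) z).trans
    (mul_le_mul_right hle (ENNReal.ofReal √n))
  rw [← ENNReal.ofReal_natCast, ← ENNReal.ofReal_mul (sqrt_nonneg _),
    ENNReal.ofReal_le_ofReal_iff (by positivity)] at h5
  linarith

/-- The inverse flow of a smooth solution realises the density `φ²`. -/
theorem IsSmoothSolution.exists_inverse_field [Nonempty M] (h : IsSmoothSolution g u₀ T u)
    (hκ : 0 < kappa g u₀) {b : ℝ} (hb : b ∈ Ioo 0 T)
    (hφ : ∀ t ∈ Ioo 0 T, ∀ x,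
      amplitude (kappa g u₀) b (fun x => divergence g (u b) x / (2 * kappa g u₀)) t x ≠ 0)
    {ζ ζ' : ℝ → M → M} (hζ : IsFlow u (Ioo 0 T) b ζ ζ') :
    ∃ X : ℝ → VField n M, SmoothTimeField (Ioo 0 T) X ∧
      (∀ x, IsCurve X (Ioo 0 T) fun t => ζ' t x) ∧
      ∀ t ∈ Ioo 0 T, ∀ x,
        2 * amplitude (kappa g u₀) b (fun x => divergence g (u b) x / (2 * kappa g u₀)) t x *
        amplitudeDeriv (kappa g u₀) b (fun x => divergence g (u b) x / (2 * kappa g u₀)) t x +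
        divergence g (fun x =>
          (amplitude (kappa g u₀) b (fun x => divergence g (u b) x / (2 * kappa g u₀)) t x *
          amplitude (kappa g u₀) b (fun x => divergence g (u b) x / (2 * kappa g u₀)) t x) • X t x)
            x = 0 := by
  set κ := kappa g u₀ with hκdef
  set τ : M → ℝ := fun x => divergence g (u b) x / (2 * κ) with hτdef
  set I := Ioo 0 T
  have hI : IsOpen I := isOpen_Ioo
  have hu := h.smoothTimeField
  have hτ : ContMDiff (𝓡 n) 𝓘(ℝ, ℝ) ∞ τ := by
    simp only [hτdef, div_eq_mul_inv]
    exact (contMDiff_divergence g (hu.smoothField hb)).mul contMDiff_const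
  have hA := smoothFun_amplitude (J := I) κ b hτ
  have hAA := hA.mul hA
  have hAA0 : ∀ t ∈ I, ∀ x, amplitude κ b τ t x * amplitude κ b τ t x ≠ 0 := fun t ht x =>
    mul_self_ne_zero.2 (hφ t ht x)
  have hrel : ∀ t ∈ I, ∀ x, divergence g (u t) (ζ t x) * amplitude κ b τ t x =
      2 * amplitudeDeriv κ b τ t x := by
    intro t ht x
    refine mul_amplitude_eq hκ.ne' ?_
    have := h.arctan_flow hκ hb hζ ht x
    simp only [hτdef]
    linarith
  -- This is the density into which the flow ζ of u carries μ. It solves the continuity equation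
  -- because (div u ∘ ζ) φ = 2φ'.
  set w : ℝ → M → ℝ := fun t y => (amplitude κ b τ t (ζ' t y) * amplitude κ b τ t (ζ' t y))⁻¹
    with hw
  have hws : SmoothFun (n := n) I w := (hAA.comp_map hζ.smooth_inv).inv fun t ht x => hAA0 t ht _
  have hw0 : ∀ t ∈ I, ∀ x, w t x ≠ 0 := fun t ht x => inv_ne_zero (hAA0 t ht _)
  have hwb : ∀ x, w b x = 1 := fun x => by
    simp only [hw, amplitude_base, mul_one, inv_one]
  have hwu : ∀ t ∈ I, ∀ y, deriv (fun s => w s y) t + divergence g (fun x => w t x • u t x) y = 0 := by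
    intro t ht y
    rw [divergence_smul g (hu.smoothField ht) (hws.contMDiff ht)]
    have h1 := hasDerivAt_material hI hζ.smooth hζ.curve hws ht (ζ' t y)
    have hφx := hφ t ht (ζ' t y)
    have h2 := (hasDerivAt_amplitude_sq κ b τ t (ζ' t y)).fun_inv (hAA0 t ht (ζ' t y))
    have h3 := h1.unique (h2.congr_of_eventuallyEq (by
      filter_upwards [hI.mem_nhds ht] with s hs
      simp only [hw, hζ.left s hs]))
    have h4 := hrel t ht (ζ' t y)
    rw [hζ.right t ht] at h3 h4
    have h5 : w t y * divergence g (u t) y = 2 * amplitudeDeriv κ b τ t (ζ' t y) *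
        ((amplitude κ b τ t (ζ' t y))⁻¹) ^ 3 := by
      rw [← h4]
      simp only [hw]
      field_simp
    have h6 : deriv (fun s => w s y) t + dirDeriv (w t) y (u t y) = -(2 * amplitudeDeriv κ b τ t (ζ' t y) *
        ((amplitude κ b τ t (ζ' t y))⁻¹) ^ 3) := by
      rw [h3]
      field_simp
    linarith
  obtain ⟨X, hX, hXc⟩ := exists_velocity hI hζ.smooth_inv hζ.smooth hζ.right hζ.left
  refine ⟨X, hX, hXc, fun t ht x => ?_⟩
  have hdiv := divergence_inverse_velocity g hI isPreconnected_Ioo hu hb hζ hws hw0 hwb hwu hX hXc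
    ht x
  rw [divergence_smul g (hX.smoothField ht) (hAA.contMDiff ht), hdiv]
  have h1 := hasDerivAt_material hI hζ.smooth_inv hXc hAA ht (ζ t x)
  have h2 := (hws.hasDerivAt hI ht (ζ t x)).fun_inv (hw0 t ht (ζ t x))
  -- With y = ζ t x fixed, φ² along the inverse trajectory is 1/w(s, y). Hence ∂ₜφ² + ⟨X, ∇φ²⟩ =
  -- -∂ₜw/w², which cancels φ² div X = ∂ₜw/w².
  have h3 := h1.unique (h2.congr_of_eventuallyEq (by
    filter_upwards with s
    simp only [hw, inv_inv]))
  rw [hζ.left t ht, (hasDerivAt_amplitude_sq κ b τ t x).deriv] at h3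
  have h4 : amplitude κ b τ t x * amplitude κ b τ t x = (w t (ζ t x))⁻¹ := by
    simp only [hw, hζ.left t ht, inv_inv]
  have h5 := hw0 t ht (ζ t x)
  have h6 : amplitude κ b τ t x * amplitude κ b τ t x *
      (deriv (fun s => w s (ζ t x)) t * (w t (ζ t x))⁻¹) =
      deriv (fun s => w s (ζ t x)) t / w t (ζ t x) ^ 2 := by
    rw [h4]
    field_simp
  rw [h6]
  rw [neg_div] at h3
  linarith

/-- Every smooth solution can be continued, after modification near its final time, up to the
lifespan. -/
theorem IsSmoothSolution.exists_extension [ConnectedSpace M] (h : IsSmoothSolution g u₀ T u)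
    (hu₀ : SmoothField u₀) (hκ : 0 < kappa g u₀) {Tm : ℝ}
    (hTm : kappa g u₀ * Tm = π / 2 + arctan ((⨅ x, divergence g u₀ x) / (2 * kappa g u₀)))
    {S : ℝ} (hS : S ∈ Ico 0 T) :
    ∃ v : ℝ → VField n M, IsSmoothSolution g u₀ Tm v ∧ ∀ t ∈ Icc 0 S, v t = u t := by
  have hTT := h.le_lifespan hu₀ hκ hTm
  obtain ⟨R, hSR, hRT⟩ := exists_between hS.2
  obtain ⟨R', hRR', hRT'⟩ := exists_between hRT
  have hR0 : 0 < R := lt_of_le_of_lt hS.1 hSR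
  -- The base time is positive because the flow of u lives on the open interval, and below R so that
  -- it lies where the field will not be modified.
  obtain ⟨b, hb0, hbR⟩ := exists_between hR0
  have hb : b ∈ Ioo 0 T := ⟨hb0, hbR.trans hRT⟩
  have hIJ : Ioo 0 T ⊆ Ioo 0 Tm := Ioo_subset_Ioo le_rfl hTT
  have hTm0 : 0 < Tm := h.pos.trans_le hTT
  have hub := h.smoothTimeField.smoothField hb
  have hφ : ∀ t ∈ Ioo 0 Tm, ∀ x,
      amplitude (kappa g u₀) b (fun x => divergence g (u b) x / (2 * kappa g u₀)) t x ≠ 0 := by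
    intro t ht x
    obtain ⟨h1, h2⟩ := h.le_arctan hu₀ hκ hb x
    have h3 : kappa g u₀ * t < kappa g u₀ * Tm := mul_lt_mul_of_pos_left ht.2 hκ
    have h4 : 0 < kappa g u₀ * t := mul_pos hκ ht.1
    refine (amplitude_pos ?_ ?_).ne' <;> linarith
  obtain ⟨ζ, ζ', hζ⟩ := exists_isFlow isOpen_Ioo isPreconnected_Ioo h.smoothTimeField hb
  obtain ⟨X₁, hX₁, hX₁c, hwX₁⟩ := h.exists_inverse_field hκ hb (fun t ht => hφ t (hIJ ht)) hζ
  obtain ⟨X₂, hX₂, -, hwX₂⟩ := exists_transport_field g hκ.ne' hub (h.integral_sq hb) hφ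
  set κ := kappa g u₀ with hκdef
  set τ : M → ℝ := fun x => divergence g (u b) x / (2 * κ) with hτdef
  have hτ : ContMDiff (𝓡 n) 𝓘(ℝ, ℝ) ∞ τ := by
    simp only [hτdef, div_eq_mul_inv]
    exact (contMDiff_divergence g hub).mul contMDiff_const
  obtain ⟨χ, hχ, hχ1, hχ0⟩ : ∃ χ : ℝ → ℝ, ContDiff ℝ ∞ χ ∧ (∀ t ≤ R, χ t = 1) ∧
      ∀ t, R' ≤ t → χ t = 0 := by
    have hRR : 0 < R' - R := sub_pos.2 hRR'
    refine ⟨fun t => 1 - smoothTransition ((t - R) / (R' - R)), ?_, fun t ht => ?_, fun t ht => ?_⟩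
    · exact contDiff_const.sub (smoothTransition.contDiff.comp
        ((contDiff_id.sub contDiff_const).div_const _))
    · simp only
      rw [smoothTransition.zero_of_nonpos (div_nonpos_of_nonpos_of_nonneg (by linarith) hRR.le),
        sub_zero]
    · simp only
      rw [smoothTransition.one_of_one_le (by rw [le_div_iff₀ hRR]; linarith), sub_self]
  -- The transport equation is affine in X and involves no time derivative of X, so combinations
  -- with time-dependent weights of sum one still solve it.
  set X : ℝ → VField n M := fun t x => χ t • X₁ t x + (1 - χ t) • X₂ t x with hXdef
  have hXR : ∀ t ≤ R, X t = X₁ t := by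
    intro t ht
    funext x
    simp only [hXdef, hχ1 t ht, one_smul, sub_self, zero_smul, add_zero]
  have hXR' : ∀ t, R' ≤ t → X t = X₂ t := by
    intro t ht
    funext x
    simp only [hXdef, hχ0 t ht, one_smul, sub_zero, zero_smul, zero_add]
  have hX : SmoothTimeField (Ioo 0 Tm) X := by
    refine SmoothTimeField.of_locally fun t ht => ?_
    rcases lt_or_ge t T with htT | htT
    · refine ⟨Iio T, isOpen_Iio, htT, ?_⟩
      refine SmoothTimeField.mono (J := Ioo 0 T) ?_ fun s hs => ⟨hs.1.1, hs.2⟩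
      exact (hX₁.smul (smoothFun_time hχ.contDiffOn)).add
        ((hX₂.mono hIJ).smul (smoothFun_time (contDiff_const.sub hχ).contDiffOn))
    · refine ⟨Ioi R', isOpen_Ioi, lt_of_lt_of_le hRT' htT, ?_⟩
      exact (hX₂.mono inter_subset_left).congr fun s hs x => by rw [hXR' s hs.2.le]
  have hwX : ∀ t ∈ Ioo 0 Tm, ∀ x, 2 * amplitude κ b τ t x * amplitudeDeriv κ b τ t x +
      divergence g (fun x => (amplitude κ b τ t x * amplitude κ b τ t x) • X t x) x = 0 := by
    intro t ht x
    rcases lt_or_ge t T with htT | htT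
    · have htI : t ∈ Ioo 0 T := ⟨ht.1, htT⟩
      have hA := smoothFun_amplitude (J := Ioo 0 T) κ b hτ
      have s1 := (hX₁.smul (hA.mul hA)).smoothField htI
      have s2 := ((hX₂.mono hIJ).smul (hA.mul hA)).smoothField htI
      have e : (fun x => (amplitude κ b τ t x * amplitude κ b τ t x) • X t x) = fun x =>
          χ t • ((amplitude κ b τ t x * amplitude κ b τ t x) • X₁ t x) +
          (1 - χ t) • ((amplitude κ b τ t x * amplitude κ b τ t x) • X₂ t x) := by
        funext x
        simp only [hXdef, smul_add]
        rw [smul_comm, smul_comm _ (1 - χ t)]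
      rw [e, divergence_add g (s1.const_smul _) (s2.const_smul _), divergence_const_smul g s1,
        divergence_const_smul g s2, eq_neg_of_add_eq_zero_right (hwX₁ t htI x),
        eq_neg_of_add_eq_zero_right (hwX₂ t ht x)]
      ring
    · rw [hXR' t (hRT'.le.trans htT)]
      exact hwX₂ t ht x
  have hbJ := hIJ hb
  obtain ⟨ξ, η, v, hflow, hv, hηv, -, hric⟩ :=
    exists_solution_of_transport g isOpen_Ioo isPreconnected_Ioo hbJ hτ hφ hX hwX
  have hR_I : Ioo 0 R ⊆ Ioo 0 T := Ioo_subset_Ioo le_rfl hRT.le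
  -- On (0, R) both are integral curves of X₁ through x at time b. The inverse flows then agree too,
  -- and so do their velocities v and u.
  have hξ : ∀ t ∈ Ioo 0 R, ∀ x, ξ t x = ζ' t x := by
    intro t ht x
    refine IsCurve.eqOn (I := Ioo 0 R) isOpen_Ioo hX isOpen_Ioo isPreconnected_Ioo (hR_I.trans hIJ)
      ((hflow.curve x).mono (hR_I.trans hIJ))
      (((hX₁c x).mono hR_I).congr_field fun s hs => hXR s hs.2.le) (b := b) ⟨hb0, hbR⟩ ?_ ht
    rw [hflow.base, hζ.inv_base hb]
  have hη : ∀ t ∈ Ioo 0 R, ∀ y, η t y = ζ t y := by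
    intro t ht y
    have h1 := hflow.left t (hIJ (hR_I ht)) (ζ t y)
    rwa [hξ t ht, hζ.left t (hR_I ht)] at h1
  have hvu : ∀ t ∈ Ioo 0 R, v t = u t := by
    intro t ht
    funext y
    have h1 := IsCurve.field_eq ((hηv (ξ t y)).mono (hR_I.trans hIJ))
      (((hζ.curve (ξ t y)).mono hR_I).congr isOpen_Ioo fun s hs => hη s hs (ξ t y)) ht
    have key : ∀ z, z = y → v t z = u t z → v t y = u t y := by
      rintro _ rfl hz
      exact hz
    exact key _ (hflow.left t (hIJ (hR_I ht)) y) h1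
  classical
  -- The constructed field v is controlled only on the open interval (0, Tm), so u itself supplies
  -- the values near time 0.
  set V : ℝ → VField n M := fun t => if t < R then u t else v t with hVdef
  have hVu : ∀ t < R, V t = u t := fun t ht => if_pos ht
  have hVv : ∀ t ∈ Ioo 0 Tm, V t = v t := by
    intro t ht
    by_cases htR : t < R
    · rw [hVu t htR, hvu t ⟨ht.1, htR⟩]
    · exact if_neg htR
  refine ⟨V, ⟨hTm0, ?_, fun t ht x => ?_, fun x => ?_⟩, fun t ht => hVu t (ht.2.trans_lt hSR)⟩
  · refine SmoothTimeField.of_locally (J := Ico 0 Tm) fun t ht => ?_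
    rcases lt_or_ge t R with htR | htR
    · refine ⟨Iio R, isOpen_Iio, htR, ?_⟩
      refine (SmoothTimeField.mono (J := Ico 0 T) h.smooth ?_).congr
        fun s hs x => by rw [hVu s hs.2]
      exact fun s hs => ⟨hs.1.1, lt_trans hs.2 hRT⟩
    · refine ⟨Ioi 0, isOpen_Ioi, hR0.trans_le htR, ?_⟩
      have hsub : Ico 0 Tm ∩ Ioi 0 ⊆ Ioo 0 Tm := fun s hs => ⟨hs.2, hs.1.2⟩
      exact (hv.mono hsub).congr fun s hs x => by rw [hVv s (hsub hs)]
  · rcases lt_or_ge t R with htR | htR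
    · obtain ⟨ht', h1, h2⟩ := h.equation t ⟨ht.1, htR.trans hRT⟩ x
      refine ⟨ht', h1.congr_of_eventuallyEq ?_ ?_, ?_⟩
      · filter_upwards [mem_nhdsWithin_of_mem_nhds (Iio_mem_nhds htR)] with s hs
        rw [hVu s hs]
      · rw [hVu t htR]
      · rw [hVu t htR]
        exact h2
    · have htJ : t ∈ Ioo 0 Tm := ⟨hR0.trans_le htR, ht.2⟩
      obtain ⟨h1, h2⟩ := equation_of_riccati g isOpen_Ioo hv htJ (hric t htJ) x
      refine ⟨_, (h1.congr_of_eventuallyEq ?_).hasDerivWithinAt, ?_⟩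
      · filter_upwards [isOpen_Ioo.mem_nhds htJ] with s hs
        rw [hVv s hs]
      · rw [hVv t htJ]
        exact h2
  · rw [hVu 0 hR0]
    exact h.initial x

end Lifespan
end FisherRao
end

/-! ### The lifespan theorem. -/

theorem mainTheorem8 {n : ℕ} {M : Type*} [TopologicalSpace M]
    [ChartedSpace (EuclideanSpace ℝ (Fin n)) M] [IsManifold (𝓡 n) ∞ M]
    [T2Space M] [CompactSpace M] [ConnectedSpace M] [MeasurableSpace M] [BorelSpace M]
    (g : FisherRao.Metric n M) (u₀ : FisherRao.VField n M) (hu₀ : FisherRao.SmoothField u₀)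
    (hdiv : ∃ x, FisherRao.divergence g u₀ x ≠ 0)
    (κ : ℝ) (hκ : κ = FisherRao.kappa g u₀)
    (Tmax : ℝ)
    (hTmax : Tmax = π / (2 * κ)
      + (1 / κ) * arctan ((1 / (2 * κ)) * ⨅ x : M, FisherRao.divergence g u₀ x)) :
    0 < Tmax ∧
    -- smooth solutions with `u(0) = u₀` exist up to time `Tmax`
    (∃ u : ℝ → FisherRao.VField n M, FisherRao.IsSmoothSolution g u₀ Tmax u ∧ u 0 = u₀) ∧
    -- no smooth solution lives longer than `Tmax`
    (∀ (T : ℝ) (u : ℝ → FisherRao.VField n M), FisherRao.IsSmoothSolution g u₀ T u → T ≤ Tmax) ∧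
    -- no smooth solution is forced to break down before `Tmax`
    (∀ (T : ℝ) (u : ℝ → FisherRao.VField n M), FisherRao.IsSmoothSolution g u₀ T u →
      ∀ S ∈ Ico 0 T, ∃ v : ℝ → FisherRao.VField n M,
        FisherRao.IsSmoothSolution g u₀ Tmax v ∧ ∀ t ∈ Icc 0 S, v t = u t) ∧
    -- blow-up of the `C¹` norm
    (∀ u : ℝ → FisherRao.VField n M, FisherRao.IsSmoothSolution g u₀ Tmax u →
      Tendsto (fun t => FisherRao.c1Norm g (u t)) (𝓝[<] Tmax) (𝓝 ⊤)) := by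
  subst hκ
  have hκ0 := FisherRao.kappa_pos g hu₀ hdiv
  set κ := FisherRao.kappa g u₀ with hκ
  have hT : κ * Tmax = π / 2 + arctan ((⨅ x, FisherRao.divergence g u₀ x) / (2 * κ)) := by
    rw [hTmax, one_div_mul_eq_div (2 * κ)]
    field_simp
  have hpos := neg_pi_div_two_lt_arctan ((⨅ x, FisherRao.divergence g u₀ x) / (2 * κ))
  exact ⟨pos_of_mul_pos_right (by rw [hT]; linarith) hκ0.le,
    FisherRao.exists_isSmoothSolution_eq hu₀ hκ0 hT,
    fun _ _ h => h.le_lifespan hu₀ hκ0 hT,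
    fun _ _ h _ hS => h.exists_extension hu₀ hκ0 hT hS,
    fun _ h => h.tendsto_c1Norm hu₀ hκ0 hT⟩
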